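/- Let $V$ be a complex vector space of finite dimension $n$ with a nondegenerate bilinear form $(\cdot,\cdot)$ that is symmetric (the orthogonal case) or alternating (the symplectic case), and let $\mathfrak g(V)=\{g\in\operatorname{End}(V) : (gx,y)+(x,gy)=0 \text{ for all } x,y\in V\}$ be the Lie algebra of its isometry group. Let $m\ge 0$ be an integer with $n\ge 2m$ and, in the orthogonal case, $m$ even. Let $\mathcal C_\lambda\subset\mathfrak g(V)$ be the nilpotent conjugacy class associated to the partition $\lambda=(2^m,1^{n-2m})$, that is, the set of all elements of $\mathfrak g(V)$ that are nilpotent with Jordan blocks of sizes $\lambda$; let $\overline{\mathcal C}_\lambda$ be its Zariski closure, and let $J_m(V)$ be the closed subvariety of the Grassmannian of $m$-dimensional subspaces of $V$ formed by the isotropic ones (the form vanishes identically on them). Put $$\widetilde{\mathcal C}_\lambda=\{(g,U)\in\overline{\mathcal C}_\lambda\times J_m(V) : \operatorname{Im} g\subset U\}.$$ Then: (1) the projection $\widetilde{\mathcal C}_\lambda\to J_m(V)$, $(g,U)\mapsto U$, is an algebraic vector bundle, whose fibre over $U$ is the vector space $\{g\in\mathfrak g(V) : \operatorname{Im} g\subset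 U\}$; (2) the projection $p_0:\widetilde{\mathcal C}_\lambda\to\overline{\mathcal C}_\lambda$, $(g,U)\mapsto g$, is a resolution of singularities: $\widetilde{\mathcal C}_\lambda$ is a smooth variety, and $p_0$ is a proper morphism which is birational, that is, it restricts to an isomorphism $p_0^{-1}(\Omega)\to\Omega$ for some dense open subset $\Omega\subset\overline{\mathcal C}_\lambda$ with $p_0^{-1}(\Omega)$ dense in $\widetilde{\mathcal C}_\lambda$. (Varieties need not be irreducible.) -/

import Mathlib

open Topology Filter

universe u v w

/-- A space with functions over a field `k`: a topological space together with a sheaf of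
`k`-algebras of `k`-valued functions. The sheaf is recorded by saying, for every point `x`, which
functions are regular at `x`, that is, on some neighbourhood of `x`. This depends on the germ at `x`
only, and a function that is regular at `x` is regular at all points near `x`. -/
structure SpaceWithFunctions (k : Type v) [Field k] where
  carrier : Type u
  top : TopologicalSpace carrier
  regularAt : carrier → Subalgebra k (carrier → k)
  regularAt_congr : ∀ (x : carrier) (f g : carrier → k), f ∈ regularAt x →
    f =ᶠ[@nhds carrier top x] g → g ∈ regularAt x
  eventually_regularAt : ∀ (x : carrier) (f : carrier → k), f ∈ regularAt x →
    ∀ᶠ y in @nhds carrier top x, f ∈ regularAt y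

namespace SpaceWithFunctions

variable {k : Type v} [Field k]

/-- The functions that are regular at every point of `U` (for `U` open: the sections of the
structure sheaf over `U`, except that the values outside `U` are arbitrary). -/
def regularOn (X : SpaceWithFunctions.{u} k) (U : Set X.carrier) :
    Subalgebra k (X.carrier → k) :=
  ⨅ x ∈ U, X.regularAt x

/-- The local ring at `x`: the ring of germs at `x` of functions that are regular at `x`. -/
def stalk (X : SpaceWithFunctions.{u} k) (x : X.carrier) :
    Subring (Filter.Germ (@nhds X.carrier X.top x) k) :=
  (X.regularAt x).toSubring.map (Filter.Germ.coeRingHom (@nhds X.carrier X.top x))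

/-- Morphisms are the continuous maps that pull regular functions back to regular functions. -/
structure IsMorphism (X : SpaceWithFunctions.{u} k) (Y : SpaceWithFunctions.{w} k)
    (f : X.carrier → Y.carrier) : Prop where
  continuous : Continuous[X.top, Y.top] f
  comp_mem : ∀ (x : X.carrier) (φ : Y.carrier → k), φ ∈ Y.regularAt (f x) →
    φ ∘ f ∈ X.regularAt x

/-- Isomorphisms: bijections that are morphisms in both directions. -/
structure IsIsomorphism (X : SpaceWithFunctions.{u} k) (Y : SpaceWithFunctions.{w} k)
    (e : X.carrier ≃ Y.carrier) : Prop where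
  toFun : IsMorphism X Y e
  invFun : IsMorphism Y X e.symm

section LocalAlgebras

variable {X : Type u} {I : Type w} (dom : I → Set X) (A : I → Subalgebra k (X → k))

/-- The topology generated by the sets `{x ∈ dom i | a x ≠ 0}` with `a ∈ A i`. -/
abbrev localAlgebraTopology : TopologicalSpace X :=
  TopologicalSpace.generateFrom {W | ∃ i, ∃ a ∈ A i, W = {x | x ∈ dom i ∧ a x ≠ 0}}

/-- Near `x`, the function `f` is a quotient `a / b` with `a b ∈ A i` for some `i` with `x ∈ dom i`,
and `b x ≠ 0`. -/
def IsLocalQuotient (x : X) (f : X → k) : Prop :=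
  ∃ i, x ∈ dom i ∧ ∃ a ∈ A i, ∃ b ∈ A i, b x ≠ 0 ∧
    f =ᶠ[@nhds X (localAlgebraTopology dom A) x] fun y => a y / b y

variable {dom A}

theorem eventually_mem_dom_and_ne {i : I} {a : X → k} (ha : a ∈ A i) {x : X} (hx : x ∈ dom i)
    (hax : a x ≠ 0) :
    ∀ᶠ y in @nhds X (localAlgebraTopology dom A) x, y ∈ dom i ∧ a y ≠ 0 :=
  @IsOpen.mem_nhds X (localAlgebraTopology dom A) x _
    (TopologicalSpace.isOpen_generateFrom_of_mem ⟨i, a, ha, rfl⟩) ⟨hx, hax⟩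

theorem IsLocalQuotient.op
    (h_inter : ∀ i j, ∃ l, dom l = dom i ∩ dom j ∧ A i ≤ A l ∧ A j ≤ A l)
    {x : X} {f g : X → k} (op : k → k → k)
    (hop : ∀ C : Subalgebra k (X → k), ∀ a ∈ C, ∀ b ∈ C, ∀ c ∈ C, ∀ d ∈ C,
      ∃ e ∈ C, ∀ y, b y ≠ 0 → d y ≠ 0 → op (a y / b y) (c y / d y) = e y / (b y * d y))
    (hf : IsLocalQuotient dom A x f) (hg : IsLocalQuotient dom A x g) :
    IsLocalQuotient dom A x (fun y => op (f y) (g y)) := by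
  obtain ⟨i, hi, a, ha, b, hb, hbx, hf⟩ := hf
  obtain ⟨j, hj, c, hc, d, hd, hdx, hg⟩ := hg
  obtain ⟨l, hl, hil, hjl⟩ := h_inter i j
  obtain ⟨e, he, hee⟩ := hop (A l) a (hil ha) b (hil hb) c (hjl hc) d (hjl hd)
  refine ⟨l, hl ▸ ⟨hi, hj⟩, e, he, b * d, mul_mem (hil hb) (hjl hd), mul_ne_zero hbx hdx, ?_⟩
  filter_upwards [hf, hg, eventually_mem_dom_and_ne hb hi hbx,
    eventually_mem_dom_and_ne hd hj hdx] with y h1 h2 h3 h4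
  rw [h1, h2, hee y h3.2 h4.2]
  rfl

variable (dom A)

/-- The space with functions on `X` defined by a family of sets `dom i`, closed under intersection
and containing the whole space, and algebras `A i` of functions that are to be regular on `dom i`.
The sets `{x ∈ dom i | a x ≠ 0}` with `a ∈ A i` generate the topology, and the regular functions are
locally quotients of functions in the algebras `A i`. -/
abbrev ofLocalAlgebras (h_univ : ∃ i, dom i = Set.univ)
    (h_inter : ∀ i j, ∃ l, dom l = dom i ∩ dom j ∧ A i ≤ A l ∧ A j ≤ A l) :
    SpaceWithFunctions.{u} k where
  carrier := X
  top := localAlgebraTopology dom A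
  regularAt := fun x =>
    { carrier := {f | IsLocalQuotient dom A x f}
      mul_mem' := fun {f g} hf hg => IsLocalQuotient.op h_inter (· * ·)
        (fun C a ha b _ c hc d _ => ⟨a * c, mul_mem ha hc,
          fun y _ _ => div_mul_div_comm (a y) (b y) (c y) (d y)⟩) hf hg
      add_mem' := fun {f g} hf hg => IsLocalQuotient.op h_inter (· + ·)
        (fun C a ha b hb c hc d hd => ⟨a * d + b * c,
          add_mem (mul_mem ha hd) (mul_mem hb hc),
          fun y h1 h2 => div_add_div (a y) (c y) h1 h2⟩) hf hg
      algebraMap_mem' := fun r => by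
        obtain ⟨i, hi⟩ := h_univ
        refine ⟨i, hi ▸ Set.mem_univ x, algebraMap k _ r, algebraMap_mem _ r, 1, one_mem _,
          one_ne_zero, Filter.Eventually.of_forall fun y => ?_⟩
        simp }
  regularAt_congr := by
    rintro x f g ⟨i, hi, a, ha, b, hb, hbx, hf⟩ hfg
    exact ⟨i, hi, a, ha, b, hb, hbx, hfg.symm.trans hf⟩
  eventually_regularAt := by
    rintro x f ⟨i, hi, a, ha, b, hb, hbx, hf⟩
    let _ : TopologicalSpace X := localAlgebraTopology dom A
    filter_upwards [Filter.Eventually.eventually_nhds hf,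
      eventually_mem_dom_and_ne hb hi hbx] with y h1 h2
    exact ⟨i, h2.1, a, ha, b, hb, h2.2, h1⟩

end LocalAlgebras

/-- A vector space `M` as an affine space: the Zariski topology, and regular functions which are
locally quotients of polynomial functions. -/
abbrev affineSpace (k : Type v) [Field k] (M : Type u) [AddCommGroup M] [Module k M] :
    SpaceWithFunctions.{u} k :=
  ofLocalAlgebras (X := M) (fun _ : Unit => Set.univ)
    (fun _ => Algebra.adjoin k (Set.range fun φ : Module.Dual k M => (φ : M → k)))
    ⟨(), rfl⟩ (fun _ _ => ⟨(), (Set.inter_self _).symm, le_rfl, le_rfl⟩)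

/-- A subset of a space with functions, with the induced topology; the regular functions are those
which locally extend to regular functions on the ambient space. -/
abbrev sub (X : SpaceWithFunctions.{u} k) (S : Set X.carrier) : SpaceWithFunctions.{u} k where
  carrier := S
  top := TopologicalSpace.induced Subtype.val X.top
  regularAt := fun x =>
    { carrier := {f | ∃ g ∈ X.regularAt x.1,
        f =ᶠ[@nhds S (TopologicalSpace.induced Subtype.val X.top) x] fun y => g y.1}
      mul_mem' := by
        rintro f f' ⟨g, hg, h⟩ ⟨g', hg', h'⟩
        exact ⟨g * g', mul_mem hg hg', h.mul h'⟩
      add_mem' := by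
        rintro f f' ⟨g, hg, h⟩ ⟨g', hg', h'⟩
        exact ⟨g + g', add_mem hg hg', h.add h'⟩
      algebraMap_mem' := fun r =>
        ⟨algebraMap k _ r, algebraMap_mem _ r, Filter.EventuallyEq.rfl⟩ }
  regularAt_congr := by
    rintro x f f' ⟨g, hg, h⟩ hf
    exact ⟨g, hg, hf.symm.trans h⟩
  eventually_regularAt := by
    let _ := X.top
    rintro x f ⟨g, hg, h⟩
    have h1 : ∀ᶠ y in 𝓝 x, g ∈ X.regularAt y.1 :=
      (continuous_subtype_val.tendsto x).eventually (X.eventually_regularAt x.1 g hg)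
    filter_upwards [h1, Filter.Eventually.eventually_nhds h] with y hy1 hy2
    exact ⟨g, hy1, hy2⟩

/-- The quotient structure along a map `q` from `X` to a set `Y`: the quotient topology, and a
function is regular on an open set if its composition with `q` is regular on the preimage. -/
abbrev quotient (X : SpaceWithFunctions.{u} k) {Y : Type w} (q : X.carrier → Y) :
    SpaceWithFunctions.{w} k where
  carrier := Y
  top := TopologicalSpace.coinduced q X.top
  regularAt := fun y =>
    { carrier := {f | ∀ᶠ z in @nhds Y (TopologicalSpace.coinduced q X.top) y,
        ∀ x, q x = z → f ∘ q ∈ X.regularAt x}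
      mul_mem' := by
        intro f f' hf hf'
        filter_upwards [hf, hf'] with z h h' x hx
        exact mul_mem (h x hx) (h' x hx)
      add_mem' := by
        intro f f' hf hf'
        filter_upwards [hf, hf'] with z h h' x hx
        exact add_mem (h x hx) (h' x hx)
      algebraMap_mem' := fun r =>
        Filter.Eventually.of_forall fun _ x _ => algebraMap_mem (X.regularAt x) r }
  regularAt_congr := by
    let _ := X.top
    let _ : TopologicalSpace Y := TopologicalSpace.coinduced q X.top
    intro y f f' hf hff
    have hf : ∀ᶠ z in 𝓝 y, ∀ x, q x = z → f ∘ q ∈ X.regularAt x := hf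
    change ∀ᶠ z in 𝓝 y, ∀ x, q x = z → f' ∘ q ∈ X.regularAt x
    have hq : Continuous q := continuous_coinduced_rng
    filter_upwards [hf, Filter.Eventually.eventually_nhds hff] with z h1 h2 x hx
    subst hx
    exact X.regularAt_congr x _ _ (h1 x rfl) ((hq.tendsto x).eventually h2)
  eventually_regularAt := by
    let _ : TopologicalSpace Y := TopologicalSpace.coinduced q X.top
    intro y f hf
    exact Filter.Eventually.eventually_nhds
      (show ∀ᶠ z in 𝓝 y, ∀ x, q x = z → f ∘ q ∈ X.regularAt x from hf)

/-- The functions `(x, y) ↦ ∑ i, f i x * g i y` with `f i` regular on `U` and `g i` regular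
on `V`. -/
def tensorFunctions (X : SpaceWithFunctions.{u} k) (Y : SpaceWithFunctions.{w} k)
    (U : Set X.carrier) (V : Set Y.carrier) : Subalgebra k (X.carrier × Y.carrier → k) :=
  Algebra.adjoin k ({h | ∃ f ∈ X.regularOn U, h = fun p => f p.1} ∪
    {h | ∃ g ∈ Y.regularOn V, h = fun p => g p.2})

theorem tensorFunctions_mono (X : SpaceWithFunctions.{u} k) (Y : SpaceWithFunctions.{w} k)
    {U U' : Set X.carrier} {V V' : Set Y.carrier} (hU : U' ⊆ U) (hV : V' ⊆ V) :
    tensorFunctions X Y U V ≤ tensorFunctions X Y U' V' := by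
  refine Algebra.adjoin_mono (Set.union_subset_union ?_ ?_)
  · rintro h ⟨f, hf, rfl⟩
    exact ⟨f, (biInf_mono hU : X.regularOn U ≤ X.regularOn U') hf, rfl⟩
  · rintro h ⟨f, hf, rfl⟩
    exact ⟨f, (biInf_mono hV : Y.regularOn V ≤ Y.regularOn V') hf, rfl⟩

/-- The product. Its topology is in general finer than the product topology: it is generated by
the nonvanishing loci, in products `U × V` of open sets, of the functions `∑ i, f i x * g i y`
with `f i` regular on `U` and `g i` regular on `V`. The regular functions are locally quotients of
such functions. -/
abbrev prod (X : SpaceWithFunctions.{u} k) (Y : SpaceWithFunctions.{w} k) :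
    SpaceWithFunctions.{max u w} k :=
  ofLocalAlgebras (X := X.carrier × Y.carrier)
    (I := {U : Set X.carrier // IsOpen[X.top] U} × {V : Set Y.carrier // IsOpen[Y.top] V})
    (fun i => i.1.1 ×ˢ i.2.1)
    (fun i => tensorFunctions X Y i.1.1 i.2.1)
    ⟨(⟨Set.univ, @isOpen_univ _ X.top⟩, ⟨Set.univ, @isOpen_univ _ Y.top⟩), Set.univ_prod_univ⟩
    (fun i j => ⟨(⟨i.1.1 ∩ j.1.1, @IsOpen.inter _ X.top _ _ i.1.2 j.1.2⟩,
        ⟨i.2.1 ∩ j.2.1, @IsOpen.inter _ Y.top _ _ i.2.2 j.2.2⟩), Set.prod_inter_prod.symm,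
      tensorFunctions_mono X Y Set.inter_subset_left Set.inter_subset_left,
      tensorFunctions_mono X Y Set.inter_subset_right Set.inter_subset_right⟩)

/-- Affine varieties: up to isomorphism, the Zariski closed subsets of the affine spaces `k ^ n`. -/
def IsAffineVariety (X : SpaceWithFunctions.{u} k) : Prop :=
  ∃ (n : ℕ) (S : Set (Fin n → k)), IsClosed[(affineSpace k (Fin n → k)).top] S ∧
    ∃ e : X.carrier ≃ S, IsIsomorphism X ((affineSpace k (Fin n → k)).sub S) e

/-- Algebraic varieties over (an algebraically closed field) `k`, not necessarily irreducible or
connected: spaces with functions which have a finite open cover by affine varieties and are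
separated, that is, the diagonal of `X × X` is closed. -/
structure IsVariety (X : SpaceWithFunctions.{u} k) : Prop where
  exists_affine_cover : ∃ 𝒰 : Set (Set X.carrier), 𝒰.Finite ∧ ⋃₀ 𝒰 = Set.univ ∧
    ∀ U ∈ 𝒰, IsOpen[X.top] U ∧ IsAffineVariety (X.sub U)
  separated : IsClosed[(X.prod X).top] (Set.diagonal X.carrier)

/-- Smooth varieties: all local rings are regular. -/
def IsSmooth (X : SpaceWithFunctions.{u} k) : Prop :=
  ∀ x : X.carrier, IsRegularLocalRing (X.stalk x)

/-- Proper morphisms of varieties (all varieties are separated): the morphisms `f : X → Y` that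
are universally closed, that is, for every variety `T` and morphism `h : T → Y` the projection of
the fibre product `{(x, t) | f x = h t}` to `T` is a closed map. -/
structure IsProperMorphism (X Y : SpaceWithFunctions.{u} k) (f : X.carrier → Y.carrier) :
    Prop where
  isMorphism : IsMorphism X Y f
  universally_closed : ∀ T : SpaceWithFunctions.{u} k, IsVariety T →
    ∀ h : T.carrier → Y.carrier, IsMorphism T Y h →
      ∀ Z : Set {p : X.carrier × T.carrier | f p.1 = h p.2},
        IsClosed[((X.prod T).sub {p | f p.1 = h p.2}).top] Z →
          IsClosed[T.top] ((fun p => p.1.2) '' Z)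

/-- Birational morphisms of (possibly reducible) varieties: `f` restricts to an isomorphism from
`f ⁻¹ U` to `U`, for some dense open subset `U` of `Y` such that `f ⁻¹ U` is dense in `X`. -/
structure IsBirationalMorphism (X Y : SpaceWithFunctions.{u} k) (f : X.carrier → Y.carrier) :
    Prop where
  isMorphism : IsMorphism X Y f
  exists_isomorphism : ∃ U : Set Y.carrier, IsOpen[Y.top] U ∧ closure[Y.top] U = Set.univ ∧
    closure[X.top] (f ⁻¹' U) = Set.univ ∧
    ∃ e : ↥(f ⁻¹' U) ≃ ↥U, (∀ x, (e x : Y.carrier) = f x) ∧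
      IsIsomorphism (X.sub (f ⁻¹' U)) (Y.sub U) e

/-- A resolution of singularities of a variety `Y`: a proper birational morphism to `Y` from a
smooth variety `X`. -/
structure IsResolutionOfSingularities (X Y : SpaceWithFunctions.{u} k)
    (f : X.carrier → Y.carrier) : Prop where
  isVariety_source : IsVariety X
  isVariety_target : IsVariety Y
  isSmooth : IsSmooth X
  isProper : IsProperMorphism X Y f
  isBirational : IsBirationalMorphism X Y f

/-- The morphism `π : E → X`, whose fibre over each `x` is identified by `ι x` with a vector space
`F x`, is an algebraic vector bundle: locally on `X` it is isomorphic, linearly on the fibres, to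
the projection of a product `W × k ^ r` to `W`. -/
structure IsVectorBundle (E : SpaceWithFunctions.{u} k) (X : SpaceWithFunctions.{w} k)
    (π : E.carrier → X.carrier) (F : X.carrier → Type*)
    [∀ x, AddCommGroup (F x)] [∀ x, Module k (F x)]
    (ι : ∀ x, {p : E.carrier // π p = x} ≃ F x) : Prop where
  isMorphism : IsMorphism E X π
  locally_trivial : ∀ x₀ : X.carrier, ∃ W : Set X.carrier, IsOpen[X.top] W ∧ x₀ ∈ W ∧
    ∃ (r : ℕ) (e : ↥(π ⁻¹' W) ≃ ↥W × (Fin r → k)),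
      IsIsomorphism (E.sub (π ⁻¹' W)) ((X.sub W).prod (affineSpace k (Fin r → k))) e ∧
      (∀ p, ((e p).1 : X.carrier) = π p) ∧
      ∃ L : ∀ x, F x →ₗ[k] (Fin r → k), ∀ p, (e p).2 = L (π p) (ι (π p) ⟨p, rfl⟩)

end SpaceWithFunctions

section NilpotentClasses

open SpaceWithFunctions

variable (k : Type v) [Field k] (V : Type u) [AddCommGroup V] [Module k V]

/-- The Grassmannian of `m`-dimensional subspaces of `V`, as the quotient of the space of linearly
independent `m`-tuples in `V` (an open subset of the affine space `V ^ m`) along the map that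
sends a tuple to its span. -/
abbrev grassmannianVariety (m : ℕ) : SpaceWithFunctions.{u} k :=
  ((affineSpace k (Fin m → V)).sub {b | LinearIndependent k b}).quotient
    (Y := {U : Submodule k V // Module.finrank k U = m})
    (fun b => ⟨Submodule.span k (Set.range b.1), by
      rw [finrank_span_eq_card b.2, Fintype.card_fin]⟩)

variable {k V}

/-- The nilpotent endomorphism `g` has Jordan blocks of the sizes in `l`. -/
def HasNilpotentJordanType (g : Module.End k V) (l : List ℕ) : Prop :=
  ∃ b : Module.Basis (Σ i : Fin l.length, Fin (l.get i)) k V,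
    ∀ (i : Fin l.length) (j : Fin (l.get i)),
      (j.1 = 0 → g (b ⟨i, j⟩) = 0) ∧
      ∀ j' : Fin (l.get i), j'.1 + 1 = j.1 → g (b ⟨i, j⟩) = b ⟨i, j'⟩

variable (B : LinearMap.BilinForm k V) (m : ℕ)

/-- The nilpotent class of the partition `(2 ^ m, 1 ^ (n - 2 m))` of `n = dim V` in the Lie algebra
of the isometry group of `B`: the elements of this Lie algebra with this Jordan type. -/
def twoColumnClass : Set (Module.End k V) :=
  {g | g ∈ skewAdjointLieSubalgebra B ∧ HasNilpotentJordanType g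
    (List.replicate m 2 ++ List.replicate (Module.finrank k V - 2 * m) 1)}

/-- The Zariski closure of the class, as a variety. -/
abbrev twoColumnClosure : SpaceWithFunctions.{u} k :=
  (affineSpace k (Module.End k V)).sub
    (closure[(affineSpace k (Module.End k V)).top] (twoColumnClass B m))

/-- The variety of `m`-dimensional isotropic subspaces of `V`. -/
abbrev isotropicGrassmannian : SpaceWithFunctions.{u} k :=
  (grassmannianVariety k V m).sub {U | ∀ x ∈ U.1, ∀ y ∈ U.1, B x y = 0}

/-- The variety of pairs `(g, U)` with `g` in the closure of the class, `U` an isotropic subspace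
of dimension `m`, and `Im g ⊆ U`. -/
abbrev twoColumnPairs : SpaceWithFunctions.{u} k :=
  ((twoColumnClosure B m).prod (isotropicGrassmannian B m)).sub
    {p | LinearMap.range p.1.1 ≤ p.2.1.1}

/-- The vector space of elements of the Lie algebra with image contained in `U`. -/
def skewAdjointInto (U : Submodule k V) : Submodule k (Module.End k V) where
  carrier := {g | g ∈ skewAdjointLieSubalgebra B ∧ ∀ x, g x ∈ U}
  add_mem' := fun hf hg => ⟨add_mem hf.1 hg.1, fun x => add_mem (hf.2 x) (hg.2 x)⟩
  zero_mem' := ⟨zero_mem (skewAdjointLieSubalgebra B), fun _ => zero_mem U⟩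
  smul_mem' := fun c _ hf =>
    ⟨B.skewAdjointSubmodule.smul_mem c hf.1, fun x => U.smul_mem c (hf.2 x)⟩

end NilpotentClasses

-- Both cases are treated at once: `B x y = ε * B y x` with `ε = 1` or `ε = -1`.
--
-- Bundle. Fix a linear map `π : V → k ^ m` and write its coordinates as `B · (f j)`. A subspace `U`
-- which `π` maps isomorphically onto `k ^ m` has a unique basis `b` with `π (b i) = e i`, that is,
-- dual to the fixed tuple `f`, and `b` depends regularly on `U`. An element `g` of the Lie algebra
-- with image in `U` is recovered from the matrix `s i j = B (g (f j)) (f i)`, and the matrices that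
-- occur are exactly those with `s i j = -ε * s j i` (`eq_gramEnd`, `gramEnd_dual`). So the fibres
-- are one and the same vector space over the whole cell of `π`.
--
-- The fibres lie in the closure of the class. Since `m` is even if `ε = 1`, some such `s` is
-- invertible, so each fibre contains an element of rank `m`. On the line through it and any other
-- point of the fibre, almost all elements have rank `m`; they square to zero because `U` is
-- isotropic, hence belong to the class. Conversely skewness, `g ^ 2 = 0` and rank at most `m` are
-- closed conditions. Thus the pairs are exactly the points of the bundle over the isotropic
-- Grassmannian.
--
-- Birationality. On the open set of rank `m` the inclusion `Im g ⊆ U` is an equality, so `U` is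
-- determined by `g`, and regularly so.
--
-- Smoothness. Near an isotropic `U₀` with basis `b`, and with `f` corrected to be isotropic too,
-- the isotropic subspaces have the bases `b i + w i + ∑ j, (c i j - B (w j) (w i) / 2) • f j` with
-- `w i` orthogonal to `b` and `f` and `c` of the same symmetry as `s`. Together with `s` this makes
-- an open neighbourhood isomorphic to a vector space, whose local rings are localizations of a
-- polynomial ring.
--
-- Properness. It reduces to completeness of the Grassmannian (`isClosed_exists_linearIndependent`).
-- The vectors of a basis are eliminated one at a time, each by the main theorem of elimination
-- theory (`exists_ne_zero_of_no_common_zero`), which is proved by the Nullstellensatz and a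
-- determinant.

universe u'

set_option autoImplicit false

/-! ### Morphisms near a point; subspaces, products and quotients. -/

namespace SpaceWithFunctions

variable {k : Type v} [Field k] {X : SpaceWithFunctions.{u} k}

/-- A regular function that does not vanish at a point does not vanish near this point, and its
inverse is regular there. -/
def IsLocal (X : SpaceWithFunctions.{u} k) : Prop :=
  ∀ x, ∀ f ∈ X.regularAt x, f x ≠ 0 →
    (∀ᶠ y in @nhds _ X.top x, f y ≠ 0) ∧ (fun y => (f y)⁻¹) ∈ X.regularAt x

/-- `f` is a morphism on a neighbourhood of `x`, as far as this can be seen from the germ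
of `f`. -/
structure IsMorphismAt (X : SpaceWithFunctions.{u} k) (Y : SpaceWithFunctions.{w} k)
    (f : X.carrier → Y.carrier) (x : X.carrier) : Prop where
  tendsto : Tendsto f (@nhds _ X.top x) (@nhds _ Y.top (f x))
  comp_mem : ∀ φ ∈ Y.regularAt (f x), φ ∘ f ∈ X.regularAt x

theorem isMorphism_iff {Y : SpaceWithFunctions.{w} k} {f : X.carrier → Y.carrier} :
    IsMorphism X Y f ↔ ∀ x, IsMorphismAt X Y f x := by
  let _ := X.top
  let _ := Y.top
  exact ⟨fun h x => ⟨h.continuous.tendsto x, h.comp_mem x⟩,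
    fun h => ⟨continuous_iff_continuousAt.2 fun x => (h x).tendsto, fun x => (h x).comp_mem⟩⟩

theorem IsMorphism.at {Y : SpaceWithFunctions.{w} k} {f : X.carrier → Y.carrier}
    (h : IsMorphism X Y f) (x : X.carrier) : IsMorphismAt X Y f x :=
  isMorphism_iff.1 h x

namespace IsMorphismAt

universe u₁ u₂ u₃

variable {Y : SpaceWithFunctions.{u₁} k} {Z : SpaceWithFunctions.{u₂} k}

theorem comp {g : Y.carrier → Z.carrier} {f : X.carrier → Y.carrier} {x : X.carrier}
    (hg : IsMorphismAt Y Z g (f x)) (hf : IsMorphismAt X Y f x) :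
    IsMorphismAt X Z (fun y => g (f y)) x :=
  ⟨hg.tendsto.comp hf.tendsto, fun φ hφ => hf.comp_mem _ (hg.comp_mem φ hφ)⟩

theorem congr {f g : X.carrier → Y.carrier} {x : X.carrier} (hf : IsMorphismAt X Y f x)
    (h : f =ᶠ[@nhds _ X.top x] g) : IsMorphismAt X Y g x := by
  let _ := X.top
  have hx : f x = g x := h.eq_of_nhds
  refine ⟨hx ▸ hf.tendsto.congr' h, fun φ hφ => ?_⟩
  exact X.regularAt_congr x _ _ (hf.comp_mem φ (hx ▸ hφ)) (h.fun_comp φ)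

theorem id (x : X.carrier) : IsMorphismAt X X (fun y => y) x := ⟨tendsto_id, fun _ h => h⟩

theorem val (S : Set X.carrier) (x : S) : IsMorphismAt (X.sub S) X (fun y => y.1) x := by
  let _ := X.top
  exact ⟨continuous_subtype_val.tendsto x, fun φ hφ => ⟨φ, hφ, EventuallyEq.rfl⟩⟩

theorem sub_mk {S : Set Y.carrier} {f : X.carrier → S} {x : X.carrier}
    (hf : IsMorphismAt X Y (fun y => (f y).1) x) : IsMorphismAt X (Y.sub S) f x := by
  let _ := X.top
  let _ := Y.top
  have ht : Tendsto f (𝓝 x) (𝓝 (f x)) := tendsto_subtype_rng.2 hf.tendsto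
  refine ⟨ht, ?_⟩
  rintro φ ⟨g, hg, h⟩
  exact X.regularAt_congr x _ _ (hf.comp_mem g hg) ((ht.eventually h).mono fun y hy => hy.symm)

theorem comp_val {f : X.carrier → Y.carrier} {S : Set X.carrier} {x : S}
    (hf : IsMorphismAt X Y f x.1) : IsMorphismAt (X.sub S) Y (fun y => f y.1) x :=
  hf.comp (val S x)

end IsMorphismAt

theorem IsLocal.sub (h : X.IsLocal) (S : Set X.carrier) : (X.sub S).IsLocal := by
  let _ := X.top
  rintro x f ⟨g, hg, hfg⟩ hfx
  have hfg : f =ᶠ[𝓝 x] fun y => g y.1 := hfg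
  have hgx : g x.1 ≠ 0 := hfg.eq_of_nhds ▸ hfx
  obtain ⟨h1, h2⟩ := h x.1 g hg hgx
  refine ⟨?_, _, h2, ?_⟩
  · filter_upwards [hfg, (continuous_subtype_val.tendsto x).eventually h1] with y h3 h4
    rwa [h3]
  · exact hfg.mono fun y hy => by simp only [hy]

section OfLocalAlgebras

variable {T : Type u} {I : Type w} {dom : I → Set T} {A : I → Subalgebra k (T → k)}
  {h_univ : ∃ i, dom i = Set.univ}
  {h_inter : ∀ i j, ∃ l, dom l = dom i ∩ dom j ∧ A i ≤ A l ∧ A j ≤ A l}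

theorem isLocal_ofLocalAlgebras : (ofLocalAlgebras dom A h_univ h_inter).IsLocal := by
  rintro x f ⟨i, hi, a, ha, b, hb, hbx, hf⟩ hfx
  let _ : TopologicalSpace T := localAlgebraTopology dom A
  have hf : f =ᶠ[𝓝 x] fun y => a y / b y := hf
  have hax : a x ≠ 0 := fun h => hfx (by rw [hf.eq_of_nhds, h, zero_div])
  refine ⟨?_, i, hi, b, hb, a, ha, hax, hf.mono fun y hy => by simp only [hy, inv_div]⟩
  filter_upwards [hf, eventually_mem_dom_and_ne hb hi hbx, eventually_mem_dom_and_ne ha hi hax]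
    with y h1 h2 h3
  rw [h1]
  exact div_ne_zero h3.2 h2.2

/-- It suffices to test the generators: locality of `X` turns the pullback of a basic open set into
a neighbourhood and makes pulled back denominators invertible. -/
theorem IsMorphismAt.to_ofLocalAlgebras {X : SpaceWithFunctions.{u'} k} (hX : X.IsLocal) {f : X.carrier → T} {x : X.carrier}
    (hdom : ∀ i, f x ∈ dom i → ∀ᶠ y in @nhds _ X.top x, f y ∈ dom i)
    (hA : ∀ i, f x ∈ dom i → ∀ a ∈ A i, a ∘ f ∈ X.regularAt x) :
    IsMorphismAt X (ofLocalAlgebras dom A h_univ h_inter) f x := by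
  let _ := X.top
  let _ : TopologicalSpace T := localAlgebraTopology dom A
  have ht : Tendsto f (𝓝 x) (𝓝 (f x)) := by
    refine TopologicalSpace.tendsto_nhds_generateFrom_iff.2 ?_
    rintro _ ⟨i, a, ha, rfl⟩ ⟨hi, hax⟩
    exact (hdom i hi).and (hX x _ (hA i hi a ha) hax).1
  refine ⟨ht, ?_⟩
  rintro φ ⟨i, hi, a, ha, b, hb, hbx, hφ⟩
  refine X.regularAt_congr x _ _ (mul_mem (hA i hi a ha) (hX x _ (hA i hi b hb) hbx).2) ?_
  filter_upwards [ht.eventually hφ] with y hy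
  simp only [Function.comp_apply, hy, Pi.mul_apply, div_eq_mul_inv]

end OfLocalAlgebras

section Prod

universe u₁ u₂

variable {Y : SpaceWithFunctions.{u₁} k} {Z : SpaceWithFunctions.{u₂} k}

theorem isLocal_prod : (X.prod Y).IsLocal := isLocal_ofLocalAlgebras

theorem mem_regularOn {U : Set X.carrier} {f : X.carrier → k} :
    f ∈ X.regularOn U ↔ ∀ x ∈ U, f ∈ X.regularAt x := by
  simp [regularOn, Algebra.mem_iInf]

theorem exists_open_regularOn {x : X.carrier} {f : X.carrier → k} (hf : f ∈ X.regularAt x) :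
    ∃ U, IsOpen[X.top] U ∧ x ∈ U ∧ f ∈ X.regularOn U := by
  let _ := X.top
  obtain ⟨U, hU, hUo, hx⟩ := eventually_nhds_iff.1 (X.eventually_regularAt x f hf)
  exact ⟨U, hUo, hx, mem_regularOn.2 hU⟩

theorem eventually_nhds_prod {U : Set X.carrier} (hU : IsOpen[X.top] U) {V : Set Y.carrier}
    (hV : IsOpen[Y.top] V) {p : (X.prod Y).carrier} (h1 : p.1 ∈ U) (h2 : p.2 ∈ V) :
    ∀ᶠ q in @nhds _ (X.prod Y).top p, q.1 ∈ U ∧ q.2 ∈ V := by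
  have := eventually_mem_dom_and_ne (k := k)
    (I := {U : Set X.carrier // IsOpen[X.top] U} × {V : Set Y.carrier // IsOpen[Y.top] V})
    (dom := fun i => i.1.1 ×ˢ i.2.1) (A := fun i => tensorFunctions X Y i.1.1 i.2.1)
    (i := (⟨U, hU⟩, ⟨V, hV⟩)) (a := 1) (one_mem _) (x := p) ⟨h1, h2⟩ one_ne_zero
  exact this.mono fun q hq => hq.1

theorem mem_regularAt_prod {U : Set X.carrier} (hU : IsOpen[X.top] U) {V : Set Y.carrier}
    (hV : IsOpen[Y.top] V) {p : (X.prod Y).carrier} (h1 : p.1 ∈ U) (h2 : p.2 ∈ V)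
    {a : X.carrier × Y.carrier → k} (ha : a ∈ tensorFunctions X Y U V) :
    a ∈ (X.prod Y).regularAt p :=
  ⟨(⟨U, hU⟩, ⟨V, hV⟩), ⟨h1, h2⟩, a, ha, 1, one_mem _, one_ne_zero,
    Eventually.of_forall fun y => by simp⟩

theorem IsMorphismAt.fst (p : (X.prod Y).carrier) : IsMorphismAt (X.prod Y) X (fun q => q.1) p := by
  refine ⟨fun N hN => ?_, fun φ hφ => ?_⟩
  · obtain ⟨U, hUN, hU, hp⟩ :=
      (@mem_nhds_iff _ X.top p.1 N).1 hN
    exact Filter.mem_map.2 <| Filter.mem_of_superset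
      (eventually_nhds_prod (p := p) hU (@isOpen_univ _ Y.top) hp trivial) fun q hq => hUN hq.1
  · obtain ⟨U, hU, hp, hf⟩ := exists_open_regularOn hφ
    exact mem_regularAt_prod (p := p) hU (@isOpen_univ _ Y.top) hp trivial
      (Algebra.subset_adjoin (Or.inl ⟨φ, hf, rfl⟩))

theorem IsMorphismAt.snd (p : (X.prod Y).carrier) : IsMorphismAt (X.prod Y) Y (fun q => q.2) p := by
  refine ⟨fun N hN => ?_, fun φ hφ => ?_⟩
  · obtain ⟨U, hUN, hU, hp⟩ :=
      (@mem_nhds_iff _ Y.top p.2 N).1 hN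
    exact Filter.mem_map.2 <| Filter.mem_of_superset
      (eventually_nhds_prod (p := p) (@isOpen_univ _ X.top) hU trivial hp) fun q hq => hUN hq.2
  · obtain ⟨U, hU, hp, hf⟩ := exists_open_regularOn hφ
    exact mem_regularAt_prod (p := p) (@isOpen_univ _ X.top) hU trivial hp
      (Algebra.subset_adjoin (Or.inr ⟨φ, hf, rfl⟩))

theorem IsMorphismAt.prod_mk (hZ : Z.IsLocal) {f : Z.carrier → X.carrier × Y.carrier}
    {z : Z.carrier} (h1 : IsMorphismAt Z X (fun t => (f t).1) z)
    (h2 : IsMorphismAt Z Y (fun t => (f t).2) z) : IsMorphismAt Z (X.prod Y) f z := by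
  refine IsMorphismAt.to_ofLocalAlgebras hZ ?_ ?_
  · rintro ⟨⟨U, hU⟩, ⟨V, hV⟩⟩ ⟨hzU, hzV⟩
    exact Filter.inter_mem (h1.tendsto (@IsOpen.mem_nhds _ X.top (f z).1 U hU hzU))
      (h2.tendsto (@IsOpen.mem_nhds _ Y.top (f z).2 V hV hzV))
  · rintro ⟨⟨U, hU⟩, ⟨V, hV⟩⟩ ⟨hzU, hzV⟩ a ha
    refine Algebra.adjoin_induction (p := fun a _ => a ∘ f ∈ Z.regularAt z) ?_ ?_ ?_ ?_ ha
    · rintro _ (⟨g, hg, rfl⟩ | ⟨g, hg, rfl⟩)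
      · exact h1.comp_mem g (mem_regularOn.1 hg _ hzU)
      · exact h2.comp_mem g (mem_regularOn.1 hg _ hzV)
    · exact fun r => algebraMap_mem _ r
    · exact fun _ _ _ _ h h' => add_mem h h'
    · exact fun _ _ _ _ h h' => mul_mem h h'

/-- The set where `f` does not vanish is, near `(x, y)`, a neighbourhood disjoint from the diagonal.
-/
theorem isClosed_diagonal_of_separating
    (h : ∀ x y : X.carrier, x ≠ y → ∃ f : X.carrier × X.carrier → k,
      f ∈ (X.prod X).regularAt (x, y) ∧ f (x, y) ≠ 0 ∧
        ∀ᶠ p in @nhds _ (X.prod X).top (x, y), p.1 = p.2 → f p = 0) :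
    IsClosed[(X.prod X).top] (Set.diagonal X.carrier) := by
  let _ := (X.prod X).top
  rw [← isOpen_compl_iff, isOpen_iff_mem_nhds]
  rintro ⟨x, y⟩ hxy
  obtain ⟨f, hf, hne, hd⟩ := h x y hxy
  filter_upwards [hd, (isLocal_prod _ f hf hne).1] with p h1 h2 h3
  exact h2 (h1 h3)

end Prod

section Quotient

variable {Y : Type w} {q : X.carrier → Y}

theorem IsMorphismAt.quotient_map (x : X.carrier) : IsMorphismAt X (X.quotient q) q x := by
  let _ := X.top
  let _ : TopologicalSpace Y := TopologicalSpace.coinduced q X.top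
  have hq : Continuous q := continuous_coinduced_rng
  refine ⟨hq.tendsto x, fun φ hφ => ?_⟩
  exact (show ∀ᶠ z in 𝓝 (q x), ∀ x', q x' = z → φ ∘ q ∈ X.regularAt x' from hφ).self_of_nhds x rfl

/-- Regularity at one point of a quotient involves all points over a neighbourhood, so the
hypothesis is made over a whole open set `W` and not just over `y`. -/
theorem IsMorphismAt.of_quotient {Z : SpaceWithFunctions.{u'} k} {g : Y → Z.carrier} {W : Set Y}
    (hW : IsOpen[(X.quotient q).top] W)
    (h : ∀ x, q x ∈ W → IsMorphismAt X Z (fun x => g (q x)) x) {y : Y} (hy : y ∈ W) :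
    IsMorphismAt (X.quotient q) Z g y := by
  let _ := X.top
  let _ := Z.top
  let _ : TopologicalSpace Y := TopologicalSpace.coinduced q X.top
  have hq : Continuous q := continuous_coinduced_rng
  have key : ∀ N : Set Z.carrier, IsOpen N → g y ∈ N → W ∩ g ⁻¹' N ∈ 𝓝 y := by
    intro N hN hyN
    refine IsOpen.mem_nhds (isOpen_coinduced.2 (isOpen_iff_mem_nhds.2 fun x hx => ?_)) ⟨hy, hyN⟩
    exact Filter.inter_mem ((hW.preimage hq).mem_nhds hx.1)
      ((h x hx.1).tendsto (hN.mem_nhds hx.2))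
  refine ⟨fun N hN => ?_, fun φ hφ => ?_⟩
  · obtain ⟨U, hUN, hU, hp⟩ := mem_nhds_iff.1 hN
    exact Filter.mem_map.2 (Filter.mem_of_superset (key U hU hp) fun z hz => hUN hz.2)
  · obtain ⟨U, hU, hyU, hf⟩ := exists_open_regularOn hφ
    change ∀ᶠ z in 𝓝 y, ∀ x, q x = z → (φ ∘ g) ∘ q ∈ X.regularAt x
    filter_upwards [key U hU hyU] with z hz x hx
    subst hx
    exact (h x hz.1).comp_mem φ (mem_regularOn.1 hf _ hz.2)

end Quotient

end SpaceWithFunctions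

/-! ### Affine spaces and vector-valued regular functions. -/

namespace SpaceWithFunctions

variable {k : Type v} [Field k] {X : SpaceWithFunctions.{u} k}

section Affine

variable {M : Type w} [AddCommGroup M] [Module k M]

/-- The polynomial functions on a vector space. -/
abbrev polynomialFunctions (k : Type v) [Field k] (M : Type w) [AddCommGroup M] [Module k M] :
    Subalgebra k (M → k) :=
  Algebra.adjoin k (Set.range fun φ : Module.Dual k M => (φ : M → k))

theorem isLocal_affineSpace : (affineSpace k M).IsLocal := isLocal_ofLocalAlgebras

theorem isOpen_polynomial_ne_zero {a : M → k} (ha : a ∈ polynomialFunctions k M) :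
    IsOpen[(affineSpace k M).top] {x | a x ≠ 0} :=
  TopologicalSpace.isOpen_generateFrom_of_mem ⟨(), a, ha, by simp⟩

/-- The nonvanishing loci of polynomials, so far only a subbasis, form a basis: a product of
polynomials handles intersections. -/
theorem exists_polynomial_of_isOpen {U : Set M} (hU : IsOpen[(affineSpace k M).top] U) {x : M}
    (hx : x ∈ U) : ∃ a ∈ polynomialFunctions k M, a x ≠ 0 ∧ ∀ y, a y ≠ 0 → y ∈ U := by
  induction hU with
  | basic s hs =>
    obtain ⟨i, a, ha, rfl⟩ := hs
    exact ⟨a, ha, hx.2, fun y hy => ⟨trivial, hy⟩⟩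
  | univ => exact ⟨1, one_mem _, one_ne_zero, fun y _ => trivial⟩
  | inter s t _ _ hs ht =>
    obtain ⟨a, ha, hax, has⟩ := hs hx.1
    obtain ⟨b, hb, hbx, hbt⟩ := ht hx.2
    exact ⟨a * b, mul_mem ha hb, mul_ne_zero hax hbx,
      fun y hy => ⟨has y (left_ne_zero_of_mul hy), hbt y (right_ne_zero_of_mul hy)⟩⟩
  | sUnion S _ ih =>
    obtain ⟨s, hs, hxs⟩ := hx
    obtain ⟨a, ha, hax, has⟩ := ih s hs hxs
    exact ⟨a, ha, hax, fun y hy => ⟨s, hs, has y hy⟩⟩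

theorem exists_polynomial_of_isClosed {S : Set M} (hS : IsClosed[(affineSpace k M).top] S) {x : M}
    (hx : x ∉ S) : ∃ a ∈ polynomialFunctions k M, a x ≠ 0 ∧ ∀ y ∈ S, a y = 0 := by
  obtain ⟨a, ha, hax, h⟩ := exists_polynomial_of_isOpen
    (@IsClosed.isOpen_compl _ (affineSpace k M).top S hS) hx
  exact ⟨a, ha, hax, fun y hy => by_contra fun h' => h y h' hy⟩

theorem polynomial_mem_regularAt {a : M → k} (ha : a ∈ polynomialFunctions k M) (x : M) :
    a ∈ (affineSpace k M).regularAt x :=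
  ⟨(), trivial, a, ha, 1, one_mem _, one_ne_zero, Eventually.of_forall fun y => by simp⟩

end Affine

/-- A map to a vector space is regular at `x` if its coordinates are. -/
def IsRegularAt (X : SpaceWithFunctions.{u} k) {M : Type w} [AddCommGroup M] [Module k M]
    (f : X.carrier → M) (x : X.carrier) : Prop :=
  ∀ φ : Module.Dual k M, (fun y => φ (f y)) ∈ X.regularAt x

namespace IsRegularAt

universe u₁ u₂ u₃

variable {M : Type u₁} [AddCommGroup M] [Module k M] {N : Type u₂} [AddCommGroup N] [Module k N]
  {P : Type u₃} [AddCommGroup P] [Module k P] {x : X.carrier}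

theorem iff_mem {f : X.carrier → k} : IsRegularAt X f x ↔ f ∈ X.regularAt x := by
  refine ⟨fun h => h LinearMap.id, fun h φ => ?_⟩
  have : (fun y => φ (f y)) = φ 1 • f := by
    ext y
    rw [Pi.smul_apply, smul_eq_mul, mul_comm, ← smul_eq_mul, ← map_smul, smul_eq_mul, mul_one]
  exact this ▸ Subalgebra.smul_mem _ h _

theorem const (c : M) : IsRegularAt X (fun _ => c) x := fun φ => algebraMap_mem (X.regularAt x) (φ c)

theorem linear {f : X.carrier → M} (hf : IsRegularAt X f x) (ℓ : M →ₗ[k] N) :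
    IsRegularAt X (fun y => ℓ (f y)) x := fun φ => hf (φ ∘ₗ ℓ)

theorem add {f g : X.carrier → M} (hf : IsRegularAt X f x) (hg : IsRegularAt X g x) :
    IsRegularAt X (fun y => f y + g y) x := fun φ => by
  simp only [map_add]
  exact add_mem (hf φ) (hg φ)

theorem sub {f g : X.carrier → M} (hf : IsRegularAt X f x) (hg : IsRegularAt X g x) :
    IsRegularAt X (fun y => f y - g y) x := fun φ => by
  simp only [map_sub]
  exact sub_mem (hf φ) (hg φ)

theorem sum {ι : Type*} {s : Finset ι} {f : ι → X.carrier → M}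
    (hf : ∀ i ∈ s, IsRegularAt X (f i) x) : IsRegularAt X (fun y => ∑ i ∈ s, f i y) x := fun φ => by
  have := sum_mem fun i hi => hf i hi φ
  convert this using 1
  ext y
  simp

theorem smul {c : X.carrier → k} {f : X.carrier → M} (hc : IsRegularAt X c x)
    (hf : IsRegularAt X f x) : IsRegularAt X (fun y => c y • f y) x := fun φ => by
  simp only [map_smul]
  exact mul_mem (iff_mem.1 hc) (hf φ)

theorem mul {c f : X.carrier → k} (hc : IsRegularAt X c x)
    (hf : IsRegularAt X f x) : IsRegularAt X (fun y => c y * f y) x := hc.smul hf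

theorem finset_prod {ι : Type*} {s : Finset ι} {f : ι → X.carrier → k}
    (hf : ∀ i ∈ s, IsRegularAt X (f i) x) : IsRegularAt X (fun y => ∏ i ∈ s, f i y) x := by
  have := prod_mem fun i hi => iff_mem.1 (hf i hi)
  rw [iff_mem]
  convert this using 1
  ext y
  simp

theorem bilin [FiniteDimensional k M] (β : M →ₗ[k] N →ₗ[k] P) {f : X.carrier → M}
    {g : X.carrier → N} (hf : IsRegularAt X f x) (hg : IsRegularAt X g x) :
    IsRegularAt X (fun y => β (f y) (g y)) x := by
  let b := Module.finBasis k M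
  have : (fun y => β (f y) (g y)) = fun y => ∑ i, b.coord i (f y) • β (b i) (g y) := by
    ext y
    conv_lhs => rw [← b.sum_repr (f y)]
    simp only [map_sum, map_smul, LinearMap.sum_apply, LinearMap.smul_apply, b.coord_apply]
  rw [this]
  exact sum fun i _ => (hf.linear _).smul (hg.linear _)

theorem pi {ι : Type*} [Finite ι] {f : X.carrier → ι → M}
    (hf : ∀ i, IsRegularAt X (fun y => f y i) x) : IsRegularAt X f x := fun φ => by
  classical
  have := Fintype.ofFinite ι
  have h : (fun y => φ (f y)) = fun y => ∑ i, (φ ∘ₗ LinearMap.single k (fun _ => M) i) (f y i) := by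
    ext y
    conv_lhs => rw [← LinearMap.sum_single_apply (fun _ => M) (f y), map_sum]
    rfl
  rw [h, ← iff_mem]
  exact sum fun i _ => (hf i).linear _

theorem apply {ι : Type*} {f : X.carrier → ι → M} (hf : IsRegularAt X f x) (i : ι) :
    IsRegularAt X (fun y => f y i) x := hf.linear (LinearMap.proj i)

theorem prod_mk {f : X.carrier → M} {g : X.carrier → N} (hf : IsRegularAt X f x)
    (hg : IsRegularAt X g x) : IsRegularAt X (fun y => (f y, g y)) x := by
  have := (hf.linear (LinearMap.inl k M N)).add (hg.linear (LinearMap.inr k M N))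
  simpa using this

/-- A linear map is a linear function of its values on a finite basis, so regularity can be tested
on vectors. -/
theorem hom [FiniteDimensional k M] {f : X.carrier → M →ₗ[k] N}
    (hf : ∀ v, IsRegularAt X (fun y => f y v) x) : IsRegularAt X f x := by
  let b := Module.finBasis k M
  have : f = fun y => ∑ i, LinearMap.smulRightₗ (b.coord i) (f y (b i)) := by
    ext y v
    conv_lhs => rw [← b.sum_repr v]
    simp only [map_sum, map_smul, LinearMap.sum_apply, LinearMap.smulRightₗ_apply,
      LinearMap.smulRight_apply, b.coord_apply]
  rw [this]
  exact sum fun i _ => (hf (b i)).linear (LinearMap.smulRightₗ (b.coord i))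

theorem apply_hom {f : X.carrier → M →ₗ[k] N} (hf : IsRegularAt X f x) (v : M) :
    IsRegularAt X (fun y => f y v) x := hf.linear (LinearMap.applyₗ v)

theorem det {n : Type*} [Fintype n] [DecidableEq n] {A : X.carrier → Matrix n n k}
    (hA : ∀ i j, IsRegularAt X (fun y => A y i j) x) : IsRegularAt X (fun y => (A y).det) x := by
  simp only [Matrix.det_apply]
  refine sum fun σ _ => ?_
  simp only [Units.smul_def, zsmul_eq_mul]
  exact (const _).mul (finset_prod fun i _ => hA _ _)

theorem inv (hX : X.IsLocal) {f : X.carrier → k} (hf : IsRegularAt X f x) (h : f x ≠ 0) :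
    IsRegularAt X (fun y => (f y)⁻¹) x := iff_mem.2 (hX x f (iff_mem.1 hf) h).2

theorem matrix_inv (hX : X.IsLocal) {n : Type*} [Fintype n] [DecidableEq n]
    {A : X.carrier → Matrix n n k} (hA : ∀ i j, IsRegularAt X (fun y => A y i j) x)
    (h : (A x).det ≠ 0) (i j : n) : IsRegularAt X (fun y => (A y)⁻¹ i j) x := by
  simp only [Matrix.inv_def, Ring.inverse_eq_inv', Matrix.smul_apply]
  refine ((det hA).inv hX h).smul ?_
  simp only [Matrix.adjugate_apply]
  refine det fun i' j' => ?_
  simp only [Matrix.updateRow_apply]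
  split_ifs
  · exact const _
  · exact hA i' j'

theorem congr {f g : X.carrier → M} (hf : IsRegularAt X f x) (h : f =ᶠ[@nhds _ X.top x] g) :
    IsRegularAt X g x := fun φ => X.regularAt_congr x _ _ (hf φ) (h.fun_comp φ)

theorem comp {Y : SpaceWithFunctions.{u'} k} {f : Y.carrier → M} {g : X.carrier → Y.carrier}
    (hf : IsRegularAt Y f (g x)) (hg : IsMorphismAt X Y g x) :
    IsRegularAt X (fun y => f (g y)) x := fun φ => hg.comp_mem _ (hf φ)

theorem affine (f : M →ₗ[k] N) (x : M) : IsRegularAt (affineSpace k M) (fun y => f y) x := fun φ =>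
  polynomial_mem_regularAt (Algebra.subset_adjoin ⟨φ ∘ₗ f, rfl⟩) x

theorem affine_id (x : M) : IsRegularAt (affineSpace k M) (fun y => y) x := affine LinearMap.id x

theorem isMorphismAt (hX : X.IsLocal) {f : X.carrier → M} (hf : IsRegularAt X f x) :
    IsMorphismAt X (affineSpace k M) f x := by
  refine IsMorphismAt.to_ofLocalAlgebras hX (fun i _ => Eventually.of_forall fun _ => trivial) ?_
  intro i _ a ha
  refine Algebra.adjoin_induction (p := fun a _ => a ∘ f ∈ X.regularAt x) ?_ ?_ ?_ ?_ ha
  · rintro _ ⟨φ, rfl⟩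
    exact hf φ
  · exact fun r => algebraMap_mem _ r
  · exact fun _ _ _ _ h h' => add_mem h h'
  · exact fun _ _ _ _ h h' => mul_mem h h'

theorem eventually_ne_zero (hX : X.IsLocal) {f : X.carrier → M} (hf : IsRegularAt X f x)
    (h : f x ≠ 0) : ∀ᶠ y in @nhds _ X.top x, f y ≠ 0 := by
  obtain ⟨φ, hφ⟩ : ∃ φ : Module.Dual k M, φ (f x) ≠ 0 := by
    by_contra! h'
    exact h ((Module.forall_dual_apply_eq_zero_iff k _).1 h')
  exact (hX x _ (hf φ) hφ).1.mono fun y hy h0 => hy (by rw [h0, map_zero])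

end IsRegularAt

theorem IsMorphismAt.isRegularAt {M : Type w} [AddCommGroup M] [Module k M] {f : X.carrier → M}
    {x : X.carrier} (hf : IsMorphismAt X (affineSpace k M) f x) : IsRegularAt X f x :=
  (IsRegularAt.affine_id (f x)).comp hf

theorem isOpen_ne_zero {M : Type w} [AddCommGroup M] [Module k M] (hX : X.IsLocal)
    {f : X.carrier → M} (hf : ∀ x, IsRegularAt X f x) : IsOpen[X.top] {x | f x ≠ 0} := by
  let _ := X.top
  exact isOpen_iff_mem_nhds.2 fun x hx => (hf x).eventually_ne_zero hX hx

theorem isClosed_eq_zero {M : Type w} [AddCommGroup M] [Module k M] (hX : X.IsLocal)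
    {f : X.carrier → M} (hf : ∀ x, IsRegularAt X f x) : IsClosed[X.top] {x | f x = 0} := by
  let _ := X.top
  exact isOpen_compl_iff.1 (isOpen_ne_zero hX hf)

theorem IsIsomorphism.of_isMorphismAt {Y : SpaceWithFunctions.{w} k} {e : X.carrier ≃ Y.carrier}
    (h : ∀ x, IsMorphismAt X Y e x) (h' : ∀ y, IsMorphismAt Y X e.symm y) :
    IsIsomorphism X Y e := ⟨isMorphism_iff.2 h, isMorphism_iff.2 h'⟩

theorem IsIsomorphism.trans {Y : SpaceWithFunctions.{w} k} {Z : SpaceWithFunctions.{u'} k}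
    {e : X.carrier ≃ Y.carrier} {e' : Y.carrier ≃ Z.carrier} (h : IsIsomorphism X Y e)
    (h' : IsIsomorphism Y Z e') : IsIsomorphism X Z (e.trans e') :=
  .of_isMorphismAt (fun x => (h'.toFun.at _).comp (h.toFun.at x))
    fun z => (h.invFun.at _).comp (h'.invFun.at z)

theorem IsAffineVariety.of_isIsomorphism {Y : SpaceWithFunctions.{w} k}
    {e : X.carrier ≃ Y.carrier} (h : IsIsomorphism X Y e) (hY : IsAffineVariety Y) :
    IsAffineVariety X := by
  obtain ⟨n, S, hS, e', he'⟩ := hY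
  exact ⟨n, S, hS, e.trans e', h.trans he'⟩

theorem isAffineVariety_of_isClosed {M : Type w} [AddCommGroup M] [Module k M]
    [FiniteDimensional k M] {S : Set M} (hS : IsClosed[(affineSpace k M).top] S) :
    IsAffineVariety ((affineSpace k M).sub S) := by
  let e : M ≃ₗ[k] (Fin (Module.finrank k M) → k) := (Module.finBasis k M).equivFun
  have h1 : IsMorphism (affineSpace k _) (affineSpace k M) e.symm := isMorphism_iff.2 fun x =>
    (IsRegularAt.affine e.symm.toLinearMap x).isMorphismAt isLocal_affineSpace
  have h2 : IsMorphism (affineSpace k M) (affineSpace k _) e := isMorphism_iff.2 fun x =>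
    (IsRegularAt.affine e.toLinearMap x).isMorphismAt isLocal_affineSpace
  refine ⟨_, e.symm ⁻¹' S, ?_, ?_, ?_⟩
  · exact @IsClosed.preimage _ _ (affineSpace k _).top (affineSpace k M).top _ h1.continuous _ hS
  · exact e.toEquiv.subtypeEquiv fun x => by simp
  · exact .of_isMorphismAt (fun x => .sub_mk (h2.at x.1).comp_val)
      fun x => .sub_mk (h1.at x.1).comp_val

section Line

theorem polynomialFunctions_self {a : k → k} (ha : a ∈ polynomialFunctions k k) :
    ∃ p : Polynomial k, ∀ t, a t = p.eval t := by
  refine Algebra.adjoin_induction (p := fun a _ => ∃ p : Polynomial k, ∀ t, a t = p.eval t)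
    ?_ ?_ ?_ ?_ ha
  · rintro _ ⟨φ, rfl⟩
    refine ⟨Polynomial.C (φ 1) * Polynomial.X, fun t => ?_⟩
    simp only [Polynomial.eval_mul, Polynomial.eval_C, Polynomial.eval_X]
    rw [mul_comm, ← smul_eq_mul, ← map_smul, smul_eq_mul, mul_one]
  · exact fun r => ⟨Polynomial.C r, fun t => by simp⟩
  · rintro f g _ _ ⟨p, hp⟩ ⟨q, hq⟩
    exact ⟨p + q, fun t => by simp [hp, hq]⟩
  · rintro f g _ _ ⟨p, hp⟩ ⟨q, hq⟩
    exact ⟨p * q, fun t => by simp [hp, hq]⟩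

/-- Two nonempty open subsets of the line over an infinite field meet, because a product of nonzero
polynomials has a nonzero value. All density statements below come from this. -/
theorem mem_closure_of_line [Infinite k] {γ : k → X.carrier} (hγ : IsMorphism (affineSpace k k) X γ)
    {O : Set X.carrier} (hO : IsOpen[X.top] O) (h : γ 1 ∈ O) : γ 0 ∈ closure[X.top] O := by
  let _ := X.top
  refine mem_closure_iff.2 fun U hU hU0 => ?_
  obtain ⟨a, ha, ha0, haU⟩ := exists_polynomial_of_isOpen
    (@Continuous.isOpen_preimage _ _ (affineSpace k k).top _ _ hγ.continuous U hU) hU0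
  obtain ⟨b, hb, hb0, hbU⟩ := exists_polynomial_of_isOpen
    (@Continuous.isOpen_preimage _ _ (affineSpace k k).top _ _ hγ.continuous O hO) h
  obtain ⟨p, hp⟩ := polynomialFunctions_self ha
  obtain ⟨q, hq⟩ := polynomialFunctions_self hb
  have hp0 : p ≠ 0 := by
    rintro rfl
    simp [hp] at ha0
  have hq0 : q ≠ 0 := by
    rintro rfl
    simp [hq] at hb0
  obtain ⟨t, ht⟩ : ∃ t, (p * q).eval t ≠ 0 := by
    by_contra! h0
    exact mul_ne_zero hp0 hq0 (Polynomial.funext fun t => by simpa using h0 t)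
  rw [Polynomial.eval_mul, ← hp, ← hq] at ht
  exact ⟨γ t, haU t (left_ne_zero_of_mul ht), hbU t (right_ne_zero_of_mul ht)⟩

end Line

end SpaceWithFunctions

/-! ### Local rings and their regularity. -/

namespace SpaceWithFunctions

variable {k : Type v} [Field k] {X : SpaceWithFunctions.{u} k}

section Stalk

/-- The germ at `x` of a function that is regular at `x`. -/
def germ (X : SpaceWithFunctions.{u} k) (x : X.carrier) : X.regularAt x →+* X.stalk x :=
  ((Filter.Germ.coeRingHom (@nhds X.carrier X.top x)).comp
    (X.regularAt x).toSubring.subtype).codRestrict (X.stalk x) fun f => ⟨f.1, f.2, rfl⟩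

theorem germ_surjective (x : X.carrier) : Function.Surjective (X.germ x) := by
  rintro ⟨_, f, hf, rfl⟩
  exact ⟨⟨f, hf⟩, rfl⟩

theorem germ_eq_zero_iff {x : X.carrier} {f : X.regularAt x} :
    X.germ x f = 0 ↔ ∀ᶠ y in @nhds _ X.top x, f.1 y = 0 := by
  rw [Subtype.ext_iff]
  exact Filter.Germ.coe_eq

/-- Spaces with functions that are isomorphic near two points have isomorphic local rings
there. -/
theorem exists_stalk_equiv {Y : SpaceWithFunctions.{w} k} {f : X.carrier → Y.carrier}
    {g : Y.carrier → X.carrier} {x : X.carrier} (hf : IsMorphismAt X Y f x)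
    (hg : IsMorphismAt Y X g (f x)) (hgf : ∀ᶠ y in @nhds _ X.top x, g (f y) = y)
    (hfg : ∀ᶠ y in @nhds _ Y.top (f x), f (g y) = y) :
    Nonempty (Y.stalk (f x) ≃+* X.stalk x) := by
  let _ := X.top
  let _ := Y.top
  have hx : g (f x) = x := hgf.self_of_nhds
  let c : Y.regularAt (f x) →+* X.regularAt x :=
    { toFun := fun φ => ⟨φ.1 ∘ f, hf.comp_mem _ φ.2⟩
      map_one' := rfl
      map_mul' := fun _ _ => rfl
      map_zero' := rfl
      map_add' := fun _ _ => rfl }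
  have h1 : Function.Surjective ((X.germ x).comp c) := by
    intro s
    obtain ⟨⟨ψ, hψ⟩, rfl⟩ := germ_surjective x s
    refine ⟨⟨ψ ∘ g, hg.comp_mem ψ (hx.symm ▸ hψ)⟩, ?_⟩
    rw [← sub_eq_zero, RingHom.comp_apply, ← map_sub, germ_eq_zero_iff]
    filter_upwards [hgf] with y hy
    simp [c, hy]
  -- A germ on `Y` that vanishes after composition with `f` is carried back by continuity of `g`,
  -- since `f (g y) = y` near `f x`.
  have h2 : RingHom.ker (Y.germ (f x)) = RingHom.ker ((X.germ x).comp c) := by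
    ext φ
    rw [RingHom.mem_ker, RingHom.mem_ker, RingHom.comp_apply, germ_eq_zero_iff, germ_eq_zero_iff]
    refine ⟨fun h => hf.tendsto.eventually h, fun h => ?_⟩
    have h' : ∀ᶠ y in 𝓝 x, φ.1 (f y) = 0 := h
    filter_upwards [(hx ▸ hg.tendsto).eventually h', hfg] with y hy hy'
    rwa [hy'] at hy
  exact ⟨((RingHom.quotientKerEquivOfSurjective (germ_surjective (f x))).symm.trans
    (Ideal.quotEquivOfEq h2)).trans (RingHom.quotientKerEquivOfSurjective h1)⟩

theorem exists_mvPolynomial_eval {n : ℕ} {a : (Fin n → k) → k}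
    (ha : a ∈ polynomialFunctions k (Fin n → k)) :
    ∃ p : MvPolynomial (Fin n) k, ∀ t, a t = p.eval t := by
  refine Algebra.adjoin_induction
    (p := fun a _ => ∃ p : MvPolynomial (Fin n) k, ∀ t, a t = p.eval t) ?_ ?_ ?_ ?_ ha
  · rintro _ ⟨φ, rfl⟩
    refine ⟨∑ i, MvPolynomial.C (φ (Pi.single i 1)) * MvPolynomial.X i, fun t => ?_⟩
    have : t = ∑ i, t i • Pi.single i (1 : k) := by
      simpa using (pi_eq_sum_univ' t)
    conv_lhs => rw [this]
    simp [mul_comm]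
  · exact fun r => ⟨MvPolynomial.C r, fun t => by simp⟩
  · rintro f g _ _ ⟨p, hp⟩ ⟨q, hq⟩
    exact ⟨p + q, fun t => by simp [hp, hq]⟩
  · rintro f g _ _ ⟨p, hp⟩ ⟨q, hq⟩
    exact ⟨p * q, fun t => by simp [hp, hq]⟩

theorem mvPolynomial_eval_mem {n : ℕ} (p : MvPolynomial (Fin n) k) :
    (fun t => p.eval t) ∈ polynomialFunctions k (Fin n → k) := by
  induction p using MvPolynomial.induction_on with
  | C a =>
    simp only [MvPolynomial.eval_C]
    exact algebraMap_mem (polynomialFunctions k (Fin n → k)) a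
  | add p q hp hq =>
    simp only [map_add]
    exact add_mem hp hq
  | mul_X p i hp =>
    simp only [map_mul, MvPolynomial.eval_X]
    exact mul_mem hp (Algebra.subset_adjoin ⟨LinearMap.proj i, rfl⟩)

/-- The local ring is the localization of the polynomial ring at the maximal ideal of `x`, and
polynomial rings over a field are regular. An infinite field is needed for polynomials to be
determined by their values. -/
theorem isRegularLocalRing_stalk_pi [Infinite k] (n : ℕ) (x : Fin n → k) :
    IsRegularLocalRing ((affineSpace k (Fin n → k)).stalk x) := by
  let A := affineSpace k (Fin n → k)
  let ev : MvPolynomial (Fin n) k →+* A.regularAt x :=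
    { toFun := fun p => ⟨fun t => p.eval t, polynomial_mem_regularAt (mvPolynomial_eval_mem p) x⟩
      map_one' := by ext; simp
      map_mul' := fun _ _ => by ext; simp
      map_zero' := by ext; simp
      map_add' := fun _ _ => by ext; simp }
  let P : Ideal (MvPolynomial (Fin n) k) := RingHom.ker (MvPolynomial.eval x)
  have hP : P.IsPrime := RingHom.ker_isPrime _
  let _ : Algebra (MvPolynomial (Fin n) k) (A.stalk x) := ((A.germ x).comp ev).toAlgebra
  have hmap : ∀ p, algebraMap (MvPolynomial (Fin n) k) (A.stalk x) p = A.germ x (ev p) :=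
    fun _ => rfl
  have hne : ∀ p : MvPolynomial (Fin n) k, p ∈ P.primeCompl ↔ p.eval x ≠ 0 := fun p => Iff.rfl
  have : IsLocalization.AtPrime (A.stalk x) P := by
    constructor
    constructor
    · rintro ⟨p, hp⟩
      obtain ⟨h1, h2⟩ := isLocal_affineSpace (k := k) x _ (ev p).2 ((hne p).1 hp)
      refine IsUnit.of_mul_eq_one (A.germ x ⟨_, h2⟩) ?_
      rw [hmap, ← map_mul, ← sub_eq_zero, ← (A.germ x).map_one, ← map_sub, germ_eq_zero_iff]
      exact h1.mono fun y hy => sub_eq_zero.2 (mul_inv_cancel₀ hy)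
    · intro s
      obtain ⟨⟨f, hf⟩, rfl⟩ := germ_surjective (X := A) x s
      obtain ⟨_, _, a, ha, b, hb, hbx, hfab⟩ := id hf
      obtain ⟨p, hp⟩ := exists_mvPolynomial_eval ha
      obtain ⟨q, hq⟩ := exists_mvPolynomial_eval hb
      refine ⟨(p, ⟨q, (hne q).2 (hq x ▸ hbx)⟩), ?_⟩
      rw [hmap, hmap, ← map_mul, ← sub_eq_zero, ← map_sub, germ_eq_zero_iff]
      filter_upwards [hfab, @IsOpen.mem_nhds _ A.top x _ (isOpen_polynomial_ne_zero hb) hbx] with y h1 h2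
      refine sub_eq_zero.2 ?_
      change f y * q.eval y = p.eval y
      rw [h1, ← hp, ← hq]
      exact div_mul_cancel₀ _ h2
    · intro p q hpq
      refine ⟨1, ?_⟩
      rw [hmap, hmap, ← sub_eq_zero, ← map_sub, ← map_sub, germ_eq_zero_iff] at hpq
      obtain ⟨U, hU, hUo, hxU⟩ := (@eventually_nhds_iff _ A.top _ _).1 hpq
      obtain ⟨b, hb, hbx, hbU⟩ := exists_polynomial_of_isOpen hUo hxU
      obtain ⟨r, hr⟩ := exists_mvPolynomial_eval hb
      -- The factor `r` vanishes outside the neighbourhood on which `p = q`, so local equality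
      -- becomes an identity of polynomials.
      have h0 : (p - q) * r = 0 := MvPolynomial.funext fun y => by
        by_cases hy : b y = 0
        · simp [← hr, hy]
        · have : (p - q).eval y = 0 := hU y (hbU y hy)
          simp only [map_mul, this, zero_mul, map_zero]
      have hr0 : r ≠ 0 := by
        rintro rfl
        simp [hr] at hbx
      rw [sub_eq_zero.1 ((mul_eq_zero.1 h0).resolve_right hr0)]
  exact IsRegularLocalRing.of_ringEquiv
    (IsLocalization.algEquiv P.primeCompl (Localization.AtPrime P) (A.stalk x)).toRingEquiv

/-- A space with functions that is isomorphic to an affine space near `x` is regular at `x`. -/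
theorem isRegularLocalRing_stalk [Infinite k] {M : Type w} [AddCommGroup M] [Module k M]
    [FiniteDimensional k M] {f : X.carrier → M} {g : M → X.carrier} {x : X.carrier}
    (hf : IsMorphismAt X (affineSpace k M) f x) (hg : IsMorphism (affineSpace k M) X g)
    (hgf : ∀ᶠ y in @nhds _ X.top x, g (f y) = y) (hfg : ∀ y, f (g y) = y) :
    IsRegularLocalRing (X.stalk x) := by
  let e : M ≃ₗ[k] (Fin (Module.finrank k M) → k) := (Module.finBasis k M).equivFun
  have h1 : IsMorphism (affineSpace k _) (affineSpace k M) e.symm := isMorphism_iff.2 fun x =>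
    (IsRegularAt.affine e.symm.toLinearMap x).isMorphismAt isLocal_affineSpace
  have h2 : IsMorphism (affineSpace k M) (affineSpace k _) e := isMorphism_iff.2 fun x =>
    (IsRegularAt.affine e.toLinearMap x).isMorphismAt isLocal_affineSpace
  obtain ⟨E⟩ := exists_stalk_equiv (X := X) (Y := affineSpace k (Fin (Module.finrank k M) → k))
    (f := fun y => e (f y)) (g := fun y => g (e.symm y)) (x := x) ((h2.at _).comp hf)
    ((hg.at _).comp (h1.at _)) (hgf.mono fun y hy => by simpa using hy)
    (Eventually.of_forall fun y => by simp [hfg])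
  have := isRegularLocalRing_stalk_pi (k := k) _ (e (f x))
  exact IsRegularLocalRing.of_ringEquiv E

end Stalk

end SpaceWithFunctions

/-! ### Elimination theory. -/

section Elimination

open MvPolynomial

variable {k : Type v} [Field k]

/-- Restricting `p` to the line spanned by `c` sorts its monomials by total degree: the coefficient
of degree `D` is the homogeneous component of degree `D`, evaluated at `c`. -/
theorem MvPolynomial.coeff_aeval_C_mul_X {σ : Type*} [Fintype σ] [DecidableEq σ] (c : σ → k)
    (D : ℕ) (p : MvPolynomial σ k) :
    (aeval (fun i => Polynomial.C (c i) * Polynomial.X) p).coeff D =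
      ∑ ν ∈ Finset.univ.finsuppAntidiag D, p.coeff ν * ∏ i, c i ^ ν i := by
  induction p using MvPolynomial.induction_on' with
  | add p q hp hq => simp [hp, hq, add_mul, Finset.sum_add_distrib]
  | monomial ν r =>
    have h1 : (∏ i, (Polynomial.C (c i) * Polynomial.X) ^ ν i) =
        Polynomial.C (∏ i, c i ^ ν i) * Polynomial.X ^ (∑ i, ν i) := by
      simp [mul_pow, Finset.prod_mul_distrib, Finset.prod_pow_eq_pow_sum]
    rw [aeval_monomial, Finsupp.prod_fintype _ _ fun i => pow_zero _, h1,
      Polynomial.algebraMap_apply, Algebra.algebraMap_self_apply, ← mul_assoc, ← Polynomial.C_mul,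
      Polynomial.coeff_C_mul_X_pow]
    simp only [coeff_monomial, ite_mul, zero_mul]
    by_cases h : D = ∑ i, ν i
    · rw [if_pos h, Finset.sum_ite_eq, if_pos (by simp [h])]
    · rw [if_neg h, Finset.sum_ite_eq, if_neg]
      simpa using fun h' => h h'.symm

/-- The homogeneous components of a polynomial that vanishes on a punctured line vanish on this
line. -/
theorem MvPolynomial.sum_coeff_eq_zero_of_eval_smul [Infinite k] {σ : Type*} [Fintype σ]
    [DecidableEq σ] {c : σ → k} {p : MvPolynomial σ k}
    (h : ∀ a : k, a ≠ 0 → eval (a • c) p = 0) (D : ℕ) :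
    ∑ ν ∈ Finset.univ.finsuppAntidiag D, p.coeff ν * ∏ i, c i ^ ν i = 0 := by
  rw [← coeff_aeval_C_mul_X]
  have heval : ∀ a, (aeval (fun i => Polynomial.C (c i) * Polynomial.X) p).eval a =
      eval (a • c) p := by
    intro a
    suffices (Polynomial.evalRingHom a).comp
        (aeval fun i => Polynomial.C (c i) * Polynomial.X : MvPolynomial σ k →ₐ[k] _).toRingHom =
        eval (a • c) from RingHom.congr_fun this p
    refine MvPolynomial.ringHom_ext (fun r => ?_) fun i => ?_
    · simp
    · change Polynomial.eval a (aeval _ (X i)) = eval (a • c) (X i)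
      rw [aeval_X, eval_X, Polynomial.eval_mul, Polynomial.eval_C, Polynomial.eval_X, mul_comm]
      rfl
  have : aeval (fun i => Polynomial.C (c i) * Polynomial.X) p = 0 := by
    -- The factor `X` takes care of the origin of the line, where nothing is assumed.
    refine (mul_eq_zero.1 (Polynomial.funext (p := Polynomial.X * _) (q := 0) fun a => ?_)).resolve_left
      Polynomial.X_ne_zero
    by_cases ha : a = 0
    · simp [ha]
    · rw [Polynomial.eval_mul, heval, h a ha, mul_zero, Polynomial.eval_zero]
  rw [this, Polynomial.coeff_zero]

/-- Evaluation of a polynomial with coefficients in an algebra of functions on `T`. -/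
noncomputable def MvPolynomial.evalAt {T : Type*} {σ : Type*} (A : Subalgebra k (T → k)) (t : T)
    (c : σ → k) : MvPolynomial σ A →+* k :=
  eval₂Hom ((Pi.evalRingHom (fun _ => k) t).comp A.toSubring.subtype) c

theorem MvPolynomial.evalAt_eq {T : Type*} {σ : Type*} (A : Subalgebra k (T → k)) (t : T)
    (c : σ → k) (p : MvPolynomial σ A) :
    evalAt A t c p = eval c (map ((Pi.evalRingHom (fun _ => k) t).comp A.toSubring.subtype) p) := by
  rw [eval_map]
  rfl

/-- Elimination theory: if the polynomials in `F` have no common zero except possibly the origin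
over the point `t₀`, then this is true for all points near `t₀`, provided that the sets of common
zeros are cones. -/
theorem exists_ne_zero_of_no_common_zero [IsAlgClosed k] {T : Type*} {σ : Type*} [Fintype σ]
    (A : Subalgebra k (T → k)) (F : Set (MvPolynomial σ A)) (S : Set T)
    (cone : ∀ t ∈ S, ∀ c : σ → k, c ≠ 0 → (∀ f ∈ F, evalAt A t c f = 0) →
      ∀ a : k, a ≠ 0 → ∀ f ∈ F, evalAt A t (a • c) f = 0)
    {t₀ : T} (h : ∀ c : σ → k, c ≠ 0 → ∃ f ∈ F, evalAt A t₀ c f ≠ 0) :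
    ∃ a ∈ A, a t₀ ≠ 0 ∧
      ∀ t ∈ S, a t ≠ 0 → ∀ c : σ → k, c ≠ 0 → ∃ f ∈ F, evalAt A t c f ≠ 0 := by
  classical
  have : Infinite k := IsAlgClosed.instInfinite
  let ev : T → A →+* k := fun t => (Pi.evalRingHom (fun _ => k) t).comp A.toSubring.subtype
  have hsurj : Function.Surjective (MvPolynomial.map (σ := σ) (ev t₀)) :=
    map_surjective _ fun r => ⟨algebraMap k A r, rfl⟩
  let I : Ideal (MvPolynomial σ k) := (Ideal.span F).map (MvPolynomial.map (ev t₀))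
  -- Nullstellensatz: over `t₀` the only possible common zero is the origin, so a power of the ideal
  -- of the variables lies in the specialized ideal `I`.
  have hI : idealOfVars σ k ≤ I.radical := by
    rw [← vanishingIdeal_zeroLocus_eq_radical (K := k) I, Ideal.span_le]
    rintro _ ⟨i, rfl⟩
    refine mem_vanishingIdeal_iff.2 fun c hc => ?_
    by_cases hc0 : c = 0
    · simp [hc0]
    · obtain ⟨f, hf, hfc⟩ := h c hc0
      refine absurd ?_ hfc
      rw [evalAt_eq]
      have := mem_zeroLocus_iff.1 hc _ (Ideal.mem_map_of_mem (MvPolynomial.map (ev t₀)) (Ideal.subset_span hf))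
      rwa [aeval_eq_eval] at this
  obtain ⟨D, hD⟩ := Ideal.exists_pow_le_of_le_radical_of_fg hI (idealOfVars_fg σ k)
  let s : Finset (σ →₀ ℕ) := Finset.univ.finsuppAntidiag D
  -- Each monomial of degree `D` is thus the specialization at `t₀` of an element of the ideal
  -- spanned by `F`.
  have key : ∀ μ : s, ∃ H ∈ Ideal.span F, map (ev t₀) H = monomial μ.1 1 := by
    intro μ
    refine (Ideal.mem_map_iff_of_surjective _ hsurj).1 (hD ?_)
    rw [monomial_mem_pow_idealOfVars_iff D _ one_ne_zero, Finsupp.degree_eq_sum]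
    have := μ.2
    simp only [s, Finset.mem_finsuppAntidiag] at this
    exact this.1.ge
  choose H hH hH0 using key
  -- The coefficients of degree `D` of these elements form a square matrix, which is the identity at
  -- `t₀`; its determinant is the function sought.
  let Δ : Matrix s s A := fun μ ν => (H μ).coeff ν.1
  have hdet : ∀ t, Δ.det.1 t = (Matrix.of fun μ ν : s => (map (ev t) (H μ)).coeff ν.1).det := by
    intro t
    change ev t Δ.det = _
    rw [RingHom.map_det]
    refine congrArg Matrix.det (Matrix.ext fun μ ν => ?_)
    exact (coeff_map (ev t) (H μ) ν.1).symm
  refine ⟨Δ.det.1, Δ.det.2, ?_, ?_⟩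
  · rw [hdet]
    have : (Matrix.of fun μ ν : s => (map (ev t₀) (H μ)).coeff ν.1) = 1 := by
      ext μ ν
      rw [Matrix.of_apply, hH0, coeff_monomial, Matrix.one_apply]
      simp only [Subtype.ext_iff]
    rw [this, Matrix.det_one]
    exact one_ne_zero
  · intro t ht hta c hc
    by_contra! hF
    have hspan : ∀ a : k, a ≠ 0 → ∀ μ, eval (a • c) (map (ev t) (H μ)) = 0 := by
      intro a ha μ
      have : Ideal.span F ≤ RingHom.ker (evalAt A t (a • c)) :=
        Ideal.span_le.2 fun f hf => cone t ht c hc hF a ha f hf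
      exact (evalAt_eq A t _ _).symm.trans (this (hH μ))
    -- The elements `H μ` need not be homogeneous. They vanish on the punctured line through `c` by
    -- the cone hypothesis, so their components of degree `D` vanish at `c`: the vector of all
    -- monomials of degree `D` at `c` is in the kernel of the matrix at `t`.
    have hzero := Matrix.eq_zero_of_mulVec_eq_zero (hdet t ▸ hta)
      (v := fun ν : s => ∏ i, c i ^ ν.1 i) (by
        ext μ
        have := sum_coeff_eq_zero_of_eval_smul (fun a ha => hspan a ha μ) D
        rw [← Finset.sum_coe_sort] at this
        exact this)
    refine hc (funext fun i => ?_)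
    have hi := congrFun hzero ⟨Finsupp.single i D, by simp [s]⟩
    have : ∏ j, c j ^ (Finsupp.single i D j) = c i ^ D := by
      rw [Finset.prod_eq_single i]
      · simp
      · intro j _ hj
        simp [hj.symm]
      · simp
    -- For `D = 0` the equality reads `1 = 0`, so this case needs no separate treatment.
    exact eq_zero_of_pow_eq_zero (this.symm.trans hi)

end Elimination

/-! ### Completeness of the Grassmannian. -/

section GrassmannianComplete

open SpaceWithFunctions

variable {k : Type v} [Field k]

/-- A polynomial in two groups of variables is a polynomial in `c` whose coefficients are polynomial
functions of `t`, the form required by elimination theory. -/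
theorem exists_mvPolynomial_of_polynomialFunctions {σ : Type*} [Fintype σ] {T : Type*}
    [AddCommGroup T] [Module k T] {N : Type*} [AddCommGroup N] [Module k N]
    (ψ : (σ → k) × T →ₗ[k] N) {a : N → k} (ha : a ∈ polynomialFunctions k N) :
    ∃ f : MvPolynomial σ (polynomialFunctions k T),
      ∀ t c, MvPolynomial.evalAt (polynomialFunctions k T) t c f = a (ψ (c, t)) := by
  classical
  have hC : ∀ (t : T) (c : σ → k) (b : polynomialFunctions k T),
      MvPolynomial.evalAt (polynomialFunctions k T) t c (MvPolynomial.C b) = b.1 t :=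
    fun t c b => MvPolynomial.eval₂Hom_C _ _ _
  refine Algebra.adjoin_induction (p := fun a _ => ∃ f : MvPolynomial σ (polynomialFunctions k T),
      ∀ t c, MvPolynomial.evalAt (polynomialFunctions k T) t c f = a (ψ (c, t))) ?_ ?_ ?_ ?_ ha
  · rintro _ ⟨φ, rfl⟩
    refine ⟨∑ i, MvPolynomial.C (algebraMap k _ (φ (ψ (Pi.single i 1, 0)))) * MvPolynomial.X i +
      MvPolynomial.C ⟨fun t => φ (ψ (0, t)), Algebra.subset_adjoin
        ⟨φ ∘ₗ ψ ∘ₗ LinearMap.inr k _ _, rfl⟩⟩, fun t c => ?_⟩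
    have h1 : ((c, t) : (σ → k) × T) = ∑ i, c i • ((Pi.single i 1 : σ → k), (0 : T)) + (0, t) := by
      have : c = ∑ i, c i • Pi.single i (1 : k) := by simpa using (pi_eq_sum_univ' c)
      ext i
      · conv_lhs => rw [this]
        simp [Prod.fst_sum]
      · simp [Prod.snd_sum]
    rw [h1]
    simp only [map_add, map_sum, map_mul, hC, map_smul, smul_eq_mul]
    congr 1
    refine Finset.sum_congr rfl fun i _ => ?_
    rw [mul_comm]
    congr 1
    exact MvPolynomial.eval₂Hom_X' _ _ _
  · exact fun r => ⟨MvPolynomial.C (algebraMap k _ r), fun t c => hC t c _⟩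
  · rintro f g _ _ ⟨p, hp⟩ ⟨q, hq⟩
    exact ⟨p + q, fun t c => by simp [hp, hq]⟩
  · rintro f g _ _ ⟨p, hp⟩ ⟨q, hq⟩
    exact ⟨p * q, fun t c => by simp [hp, hq]⟩

variable {V : Type u} [AddCommGroup V] [Module k V]

theorem Submodule.span_insert_sub_of_mem {S : Set V} {v s : V} (hs : s ∈ Submodule.span k S) :
    Submodule.span k (insert (v - s) S) = Submodule.span k (insert v S) := by
  have hS : ∀ w, Submodule.span k S ≤ Submodule.span k (insert w S) := fun w =>
    Submodule.span_mono (Set.subset_insert _ _)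
  have hw : ∀ w, w ∈ Submodule.span k (insert w S) := fun w =>
    Submodule.subset_span (Set.mem_insert _ _)
  refine le_antisymm ?_ ?_ <;>
    refine Submodule.span_le.2 (Set.insert_subset ?_ ((Submodule.subset_span).trans (hS _)))
  · exact sub_mem (hw v) (hS _ hs)
  · simpa using add_mem (hw (v - s)) (hS _ hs)

/-- A linear map to `k ^ m` that takes given linearly independent vectors to the standard basis. -/
theorem LinearIndependent.exists_linearMap {m : ℕ} {b : Fin m → V} (hb : LinearIndependent k b) :
    ∃ π : V →ₗ[k] (Fin m → k), ∀ i, π (b i) = Pi.single i 1 := by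
  classical
  obtain ⟨C, hC⟩ := Submodule.exists_isCompl (Submodule.span k (Set.range b))
  refine ⟨(Module.Basis.span hb).equivFun.toLinearMap ∘ₗ Submodule.projectionOnto _ C hC,
    fun i => ?_⟩
  have : b i = ((Module.Basis.span hb i : Submodule.span k (Set.range b)) : V) := by
    rw [Module.Basis.span_apply]
  rw [LinearMap.comp_apply, this, Submodule.projectionOnto_apply_left]
  ext j
  simp [Finsupp.single_apply, Pi.single_apply, eq_comm]

theorem eq_zero_of_det_ne_zero {m : ℕ} {π : V →ₗ[k] (Fin m → k)} {b : Fin m → V}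
    (hdet : (Matrix.of fun i => π (b i)).det ≠ 0) {v : V} (hv : v ∈ Submodule.span k (Set.range b))
    (hπ : π v = 0) : v = 0 := by
  obtain ⟨a, rfl⟩ := (Submodule.mem_span_range_iff_exists_fun k).1 hv
  have : a = 0 := Matrix.eq_zero_of_vecMul_eq_zero hdet (by
    ext j
    have := congrFun hπ j
    simpa [Matrix.vecMul, dotProduct] using this)
  simp [this]

theorem linearIndependent_of_det_ne_zero {m : ℕ} {π : V →ₗ[k] (Fin m → k)} {b : Fin m → V}
    (hdet : (Matrix.of fun i => π (b i)).det ≠ 0) : LinearIndependent k b := by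
  refine Fintype.linearIndependent_iff.2 fun a ha => ?_
  have : a = 0 := Matrix.eq_zero_of_vecMul_eq_zero hdet (by
    ext j
    have := congrFun (congrArg π ha) j
    simpa [Matrix.vecMul, dotProduct] using this)
  simp [this]

theorem exists_sub_mem_ker {m : ℕ} {π : V →ₗ[k] (Fin m → k)} {b : Fin m → V}
    (hdet : (Matrix.of fun i => π (b i)).det ≠ 0) (v : V) :
    ∃ s ∈ Submodule.span k (Set.range b), π (v - s) = 0 := by
  obtain ⟨a, ha⟩ := (Matrix.vecMul_surjective_iff_isUnit.2
    ((Matrix.isUnit_iff_isUnit_det _).2 hdet.isUnit)) (π v)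
  refine ⟨∑ i, a i • b i, Submodule.sum_mem _ fun i _ => Submodule.smul_mem _ _
    (Submodule.subset_span ⟨i, rfl⟩), ?_⟩
  rw [map_sub, ← ha, sub_eq_zero]
  ext j
  simp [Matrix.vecMul, dotProduct]

/-- The linear map `(c, (b, p)) ↦ ((∑ i, c i • e i) :: b, p)`. -/
def consLinearMap {d m : ℕ} (e : Fin d → V) (P : Type w) [AddCommGroup P] [Module k P] :
    (Fin d → k) × ((Fin m → V) × P) →ₗ[k] (Fin (m + 1) → V) × P where
  toFun x := (Fin.cons (∑ i, x.1 i • e i) x.2.1, x.2.2)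
  map_add' x y := by
    refine Prod.ext (funext fun i => ?_) rfl
    refine Fin.cases ?_ (fun j => ?_) i
    · simp [add_smul, Finset.sum_add_distrib]
    · simp
  map_smul' a x := by
    refine Prod.ext (funext fun i => ?_) rfl
    refine Fin.cases ?_ (fun j => ?_) i
    · simp [mul_smul, Finset.smul_sum]
    · simp

variable [FiniteDimensional k V] {P : Type w} [AddCommGroup P] [Module k P]

/-- The elimination of the first vector of a linearly independent tuple. -/
theorem mem_of_mem_closure_image_tail [IsAlgClosed k] {m : ℕ} {Z : Set ((Fin (m + 1) → V) × P)}
    (hZ : IsClosed[(affineSpace k ((Fin (m + 1) → V) × P)).top] Z)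
    (hspan : ∀ b b' p, LinearIndependent k b → LinearIndependent k b' →
      Submodule.span k (Set.range b) = Submodule.span k (Set.range b') → (b, p) ∈ Z → (b', p) ∈ Z)
    {b₀ : Fin m → V} (hb₀ : LinearIndependent k b₀) {p₀ : P}
    (hcl : (b₀, p₀) ∈ closure[(affineSpace k ((Fin m → V) × P)).top]
      {t | ∃ v, LinearIndependent k (Fin.cons v t.1 : Fin (m + 1) → V) ∧
        ((Fin.cons v t.1 : Fin (m + 1) → V), t.2) ∈ Z}) :
    ∃ v, LinearIndependent k (Fin.cons v b₀ : Fin (m + 1) → V) ∧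
      ((Fin.cons v b₀ : Fin (m + 1) → V), p₀) ∈ Z := by
  by_contra! hno
  -- The kernel of `π` is a complement of the span of `b₀`, and of the span of `b` for all `b` near
  -- `b₀`. Hence the first vector may be taken in this fixed space, with coordinates `c` in the
  -- basis `e`.
  obtain ⟨π, hπ⟩ := hb₀.exists_linearMap
  let e : Fin (Module.finrank k (LinearMap.ker π)) → V :=
    fun i => (Module.finBasis k (LinearMap.ker π) i : V)
  have hlin : ∀ c : Fin (Module.finrank k (LinearMap.ker π)) → k,
      ∑ i, c i • e i = (((Module.finBasis k (LinearMap.ker π)).equivFun.symm c :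
        LinearMap.ker π) : V) := by
    intro c
    rw [Module.Basis.equivFun_symm_apply]
    simp [e]
  have heker : ∀ c : Fin _ → k, π (∑ i, c i • e i) = 0 := fun c => by
    rw [hlin]
    exact LinearMap.mem_ker.1 (Subtype.prop _)
  have he0 : ∀ c : Fin _ → k, c ≠ 0 → ∑ i, c i • e i ≠ 0 := fun c hc h0 => by
    rw [hlin, Submodule.coe_eq_zero, LinearEquiv.map_eq_zero_iff] at h0
    exact hc h0
  have hesurj : ∀ v, π v = 0 → ∃ c : Fin _ → k, ∑ i, c i • e i = v := fun v hv => by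
    refine ⟨(Module.finBasis k (LinearMap.ker π)).equivFun ⟨v, hv⟩, ?_⟩
    rw [hlin, LinearEquiv.symm_apply_apply]
  let ψ := consLinearMap (k := k) (m := m) e P
  let S : Set ((Fin m → V) × P) := {t | (Matrix.of fun i => π (t.1 i)).det ≠ 0}
  have hindep : ∀ t ∈ S, ∀ c, c ≠ 0 → LinearIndependent k (ψ (c, t)).1 := by
    intro t ht c hc
    refine linearIndependent_finCons.2 ⟨linearIndependent_of_det_ne_zero ht, fun hmem => ?_⟩
    exact he0 c hc (eq_zero_of_det_ne_zero ht hmem (heker c))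
  -- All equations in `(c, t)` that hold on the preimage of `Z`; as `Z` is closed, they cut out
  -- exactly this preimage.
  let F : Set (MvPolynomial (Fin (Module.finrank k (LinearMap.ker π)))
      (polynomialFunctions k ((Fin m → V) × P))) :=
    {f | ∀ t c, ψ (c, t) ∈ Z → MvPolynomial.evalAt _ t c f = 0}
  have hF : ∀ t c, (∀ f ∈ F, MvPolynomial.evalAt _ t c f = 0) ↔ ψ (c, t) ∈ Z := by
    refine fun t c => ⟨fun h => by_contra fun hnot => ?_, fun h f hf => hf t c h⟩
    obtain ⟨a, ha, hax, haZ⟩ := exists_polynomial_of_isClosed hZ hnot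
    obtain ⟨f, hf⟩ := exists_mvPolynomial_of_polynomialFunctions ψ ha
    refine hax ?_
    rw [← hf]
    exact h f fun t' c' h' => (hf t' c').trans (haZ _ h')
  -- Scaling the first vector does not change the span, on which membership in `Z` depends. This is
  -- valid only for linearly independent tuples, hence the restriction to `S` and `c ≠ 0`.
  have hcone : ∀ t ∈ S, ∀ c, c ≠ 0 → (∀ f ∈ F, MvPolynomial.evalAt _ t c f = 0) →
      ∀ a : k, a ≠ 0 → ∀ f ∈ F, MvPolynomial.evalAt _ t (a • c) f = 0 := by
    intro t ht c hc h a ha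
    rw [hF] at h ⊢
    have hac : a • c ≠ 0 := smul_ne_zero ha hc
    refine hspan _ _ _ (hindep t ht c hc) (hindep t ht _ hac) ?_ h
    change Submodule.span k (Set.range (Fin.cons (∑ i, c i • e i) t.1 : Fin (m + 1) → V)) =
      Submodule.span k (Set.range (Fin.cons (∑ i, (a • c) i • e i) t.1 : Fin (m + 1) → V))
    have : ∑ i, (a • c) i • e i = a • ∑ i, c i • e i := by
      simp [Finset.smul_sum, mul_smul]
    rw [this, Fin.range_cons, Fin.range_cons, Submodule.span_insert, Submodule.span_insert,
      Submodule.span_singleton_smul_eq (IsUnit.mk0 a ha)]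
  have hempty : ∀ c, c ≠ 0 → ∃ f ∈ F, MvPolynomial.evalAt _ (b₀, p₀) c f ≠ 0 := by
    intro c hc
    by_contra! h
    refine hno (∑ i, c i • e i) ?_ ((hF _ _).1 h)
    refine linearIndependent_finCons.2 ⟨hb₀, fun hmem => he0 c hc ?_⟩
    refine eq_zero_of_det_ne_zero ?_ hmem (heker c)
    have : (Matrix.of fun i => π (b₀ i)) = 1 := by
      ext i j
      simp [hπ, Matrix.one_apply, Pi.single_apply, eq_comm]
    simp [this]
  obtain ⟨a, ha, ha0, haS⟩ := exists_ne_zero_of_no_common_zero _ F S hcone hempty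
  have hSo : IsOpen[(affineSpace k ((Fin m → V) × P)).top] S :=
    isOpen_ne_zero isLocal_affineSpace fun t => IsRegularAt.det fun i j =>
      IsRegularAt.affine (LinearMap.proj j ∘ₗ π ∘ₗ LinearMap.proj i ∘ₗ LinearMap.fst k _ P) t
  have hbS : (b₀, p₀) ∈ S := by
    have : (Matrix.of fun i => π (b₀ i)) = 1 := by
      ext i j
      simp [hπ, Matrix.one_apply, Pi.single_apply, eq_comm]
    simp [S, this]
  obtain ⟨t, ⟨hta, htS⟩, v, hv, hvZ⟩ := (@mem_closure_iff _ (affineSpace k _).top _ _).1 hcl _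
    (@IsOpen.inter _ (affineSpace k ((Fin m → V) × P)).top _ _ (isOpen_polynomial_ne_zero ha) hSo)
    ⟨ha0, hbS⟩
  -- Subtracting from `v` an element of the span of the other vectors moves it into the kernel of
  -- `π` without changing the total span.
  obtain ⟨s, hs, hvs⟩ := exists_sub_mem_ker htS v
  obtain ⟨c, hc⟩ := hesurj _ hvs
  have hc0 : c ≠ 0 := by
    rintro rfl
    refine (linearIndependent_finCons.1 hv).2 ?_
    have : v = s := by simpa [eq_comm, sub_eq_zero] using hc
    rwa [this]
  obtain ⟨f, hf, hfc⟩ := haS t htS hta c hc0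
  refine hfc ((hF t c).2 ?_ f hf)
  refine hspan _ _ _ hv (hindep t htS c hc0) ?_ hvZ
  change _ = Submodule.span k (Set.range (Fin.cons (∑ i, c i • e i) t.1 : Fin (m + 1) → V))
  rw [hc, Fin.range_cons, Fin.range_cons, Submodule.span_insert_sub_of_mem hs]

/-- The Grassmannian is complete: a closed condition on tuples `b` of linearly independent vectors
and points `p` that depends on the span of `b` only defines a closed set of points `p`. -/
theorem isClosed_exists_linearIndependent [IsAlgClosed k] {m : ℕ} {Z : Set ((Fin m → V) × P)}
    (hZ : IsClosed[(affineSpace k ((Fin m → V) × P)).top] Z)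
    (hspan : ∀ b b' p, LinearIndependent k b → LinearIndependent k b' →
      Submodule.span k (Set.range b) = Submodule.span k (Set.range b') → (b, p) ∈ Z →
        (b', p) ∈ Z) :
    IsClosed[(affineSpace k P).top] {p | ∃ b, LinearIndependent k b ∧ (b, p) ∈ Z} := by
  induction m with
  | zero =>
    have h : {p | ∃ b : Fin 0 → V, LinearIndependent k b ∧ (b, p) ∈ Z} =
        (fun p => (0, p)) ⁻¹' Z := by
      ext p
      refine ⟨fun ⟨b, _, hb⟩ => ?_, fun h => ⟨0, linearIndependent_empty_type, h⟩⟩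
      rwa [Subsingleton.elim b 0] at hb
    rw [h]
    have hmor : IsMorphism (affineSpace k P) (affineSpace k ((Fin 0 → V) × P))
        (LinearMap.inr k (Fin 0 → V) P) := isMorphism_iff.2 fun p =>
      (IsRegularAt.affine (LinearMap.inr k (Fin 0 → V) P) p).isMorphismAt isLocal_affineSpace
    exact @IsClosed.preimage _ _ (affineSpace k P).top (affineSpace k _).top _ hmor.continuous _ hZ
  | succ m ih =>
    let Z' : Set ((Fin m → V) × P) :=
      {t | ∃ v, LinearIndependent k (Fin.cons v t.1 : Fin (m + 1) → V) ∧
        ((Fin.cons v t.1 : Fin (m + 1) → V), t.2) ∈ Z}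
    -- The set `Z'` need not be closed, but its closure adds only tuples that are linearly
    -- dependent, so the induction hypothesis can be applied to the closure.
    have hZ' : ∀ b p, LinearIndependent k b →
        ((b, p) ∈ closure[(affineSpace k ((Fin m → V) × P)).top] Z' ↔ (b, p) ∈ Z') := fun b p hb =>
      ⟨mem_of_mem_closure_image_tail hZ hspan hb, fun h => @subset_closure _ (affineSpace k _).top _ _ h⟩
    have := ih (@isClosed_closure _ (affineSpace k ((Fin m → V) × P)).top Z') ?_
    · convert this using 1
      ext p
      constructor
      · rintro ⟨b, hb, hbZ⟩
        rw [← Fin.cons_self_tail b] at hb hbZ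
        have h := (linearIndependent_finCons.1 hb).1
        exact ⟨Fin.tail b, h, (hZ' _ _ h).2 ⟨b 0, hb, hbZ⟩⟩
      · rintro ⟨b, hb, hbZ⟩
        obtain ⟨v, hv, hvZ⟩ := (hZ' _ _ hb).1 hbZ
        exact ⟨_, hv, hvZ⟩
    · intro b b' p hb hb' hs h
      rw [hZ' _ _ hb] at h
      rw [hZ' _ _ hb']
      obtain ⟨v, hv, hvZ⟩ := h
      have hv' : LinearIndependent k (Fin.cons v b' : Fin (m + 1) → V) :=
        linearIndependent_finCons.2 ⟨hb', hs ▸ (linearIndependent_finCons.1 hv).2⟩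
      refine ⟨v, hv', hspan _ _ _ hv hv' ?_ hvZ⟩
      rw [Fin.range_cons, Fin.range_cons, Submodule.span_insert, Submodule.span_insert, hs]

end GrassmannianComplete

/-! ### Linear algebra of the form and of its Lie algebra. -/

section LinearAlgebra

variable {k : Type v} [Field k] {V : Type u} [AddCommGroup V] [Module k V]

/-- The vectors `f j` depend on `π` only, so one tuple is dual to the normalized bases of all
subspaces in the cell of `π`. -/
theorem exists_dual_tuple [FiniteDimensional k V] (B : LinearMap.BilinForm k V)
    (hB : B.Nondegenerate) {m : ℕ} (π : V →ₗ[k] (Fin m → k)) :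
    ∃ f : Fin m → V, ∀ v j, B v (f j) = π v j := by
  have h : B.flip.Nondegenerate := hB.flip
  refine ⟨fun j => (LinearMap.BilinForm.toDual B.flip h).symm (LinearMap.proj j ∘ₗ π),
    fun v j => ?_⟩
  exact LinearMap.BilinForm.apply_toDual_symm_apply (hB := h) (LinearMap.proj j ∘ₗ π) v

/-- Dual vectors of isotropic vectors can be made isotropic. -/
theorem exists_isotropic_dual (h2 : (2 : k) ≠ 0) {B : LinearMap.BilinForm k V} {ε : k}
    (hε : ∀ x y, B x y = ε * B y x) {m : ℕ} {b f : Fin m → V}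
    (h : ∀ i j, B (b i) (f j) = if i = j then 1 else 0) (hb : ∀ i j, B (b i) (b j) = 0) :
    ∃ f' : Fin m → V, (∀ i j, B (b i) (f' j) = if i = j then 1 else 0) ∧
      ∀ i j, B (f' i) (f' j) = 0 := by
  have h' : ∀ i j, B (f j) (b i) = if i = j then ε else 0 := fun i j => by
    rw [hε, h]
    split_ifs <;> simp
  -- In `B (f' i) (f' j)` each of the two cross terms cancels one half of `B (f i) (f j)`, and the
  -- quadratic term vanishes because `b` is isotropic.
  refine ⟨fun j => f j - (2 : k)⁻¹ • ∑ i, B (f j) (f i) • b i, fun i j => ?_, fun i j => ?_⟩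
  · simp [h, hb]
  · have h3 : ε * B (f j) (f i) = B (f i) (f j) := (hε _ _).symm
    simp only [map_sub, map_smul, map_sum, LinearMap.sub_apply, LinearMap.smul_apply,
      LinearMap.sum_apply, h, h', hb, smul_eq_mul, mul_ite, mul_one, mul_zero, Finset.sum_const_zero,
      sub_zero, Finset.sum_ite_eq', Finset.mem_univ, if_true]
    rw [mul_comm _ ε, h3]
    field_simp
    ring

theorem mem_skewAdjointLieSubalgebra {B : LinearMap.BilinForm k V} {g : Module.End k V} :
    g ∈ skewAdjointLieSubalgebra B ↔ ∀ x y, B (g x) y = -B x (g y) := by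
  refine (LinearMap.mem_skewAdjointSubmodule g).trans (forall₂_congr fun x y => ?_)
  simp

/-- The endomorphism `x ↦ ∑ i j, s i j * B (b j) x • b i`. -/
def gramEnd (B : LinearMap.BilinForm k V) {m : ℕ} (b : Fin m → V) (s : Matrix (Fin m) (Fin m) k) :
    Module.End k V :=
  ∑ i, ∑ j, s i j • (B (b j)).smulRight (b i)

theorem gramEnd_apply (B : LinearMap.BilinForm k V) {m : ℕ} (b : Fin m → V)
    (s : Matrix (Fin m) (Fin m) k) (x : V) :
    gramEnd B b s x = ∑ i, (∑ j, s i j * B (b j) x) • b i := by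
  simp [gramEnd, LinearMap.sum_apply, Finset.sum_smul, mul_smul]

theorem gramEnd_apply_mem (B : LinearMap.BilinForm k V) {m : ℕ} (b : Fin m → V)
    (s : Matrix (Fin m) (Fin m) k) (x : V) :
    gramEnd B b s x ∈ Submodule.span k (Set.range b) := by
  rw [gramEnd_apply]
  exact Submodule.sum_mem _ fun i _ => Submodule.smul_mem _ _ (Submodule.subset_span ⟨i, rfl⟩)

theorem gramEnd_mem_skewAdjoint {B : LinearMap.BilinForm k V} {ε : k}
    (hε : ∀ x y, B x y = ε * B y x) {m : ℕ} (b : Fin m → V)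
    {s : Matrix (Fin m) (Fin m) k} (hs : ∀ i j, s i j = -ε * s j i) :
    gramEnd B b s ∈ skewAdjointLieSubalgebra B := by
  refine mem_skewAdjointLieSubalgebra.2 fun x y => ?_
  simp only [gramEnd_apply, map_sum, map_smul, LinearMap.sum_apply, LinearMap.smul_apply,
    smul_eq_mul, Finset.sum_mul]
  rw [Finset.sum_comm, ← Finset.sum_neg_distrib]
  refine Finset.sum_congr rfl fun i _ => ?_
  rw [← Finset.sum_neg_distrib]
  refine Finset.sum_congr rfl fun j _ => ?_
  rw [hs j i, hε x]
  ring

theorem gramEnd_dual {B : LinearMap.BilinForm k V} {m : ℕ} {b f : Fin m → V}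
    (h : ∀ i j, B (b i) (f j) = if i = j then 1 else 0) (s : Matrix (Fin m) (Fin m) k)
    (i j : Fin m) : B (gramEnd B b s (f j)) (f i) = s i j := by
  simp [gramEnd_apply, h]

theorem eq_sum_of_mem_span_dual {B : LinearMap.BilinForm k V} {m : ℕ} {b f : Fin m → V}
    (h : ∀ i j, B (b i) (f j) = if i = j then 1 else 0) {v : V}
    (hv : v ∈ Submodule.span k (Set.range b)) : v = ∑ i, B v (f i) • b i := by
  obtain ⟨a, rfl⟩ := (Submodule.mem_span_range_iff_exists_fun k).1 hv
  simp [h]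

theorem skewAdjoint_gram_symm {B : LinearMap.BilinForm k V} {ε : k}
    (hε : ∀ x y, B x y = ε * B y x) {g : Module.End k V} (hg : g ∈ skewAdjointLieSubalgebra B)
    (x y : V) : B (g y) x = -ε * B (g x) y := by
  rw [mem_skewAdjointLieSubalgebra.1 hg, hε y]
  ring

/-- Skewness gives `B (g x) (f i) = -ε * B (g (f i)) x`, so `g` is determined by the vectors `g (f
i)`. These lie in the span of `b`, where the coordinates are the pairings with `f`. -/
theorem eq_gramEnd {B : LinearMap.BilinForm k V} {ε : k}
    (hε : ∀ x y, B x y = ε * B y x) {m : ℕ} {b f : Fin m → V}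
    (h : ∀ i j, B (b i) (f j) = if i = j then 1 else 0) {g : Module.End k V}
    (hg : g ∈ skewAdjointLieSubalgebra B) (hgU : ∀ x, g x ∈ Submodule.span k (Set.range b)) :
    gramEnd B b (Matrix.of fun i j => B (g (f j)) (f i)) = g := by
  ext x
  rw [gramEnd_apply]
  conv_rhs => rw [eq_sum_of_mem_span_dual h (hgU x)]
  refine Finset.sum_congr rfl fun i _ => ?_
  congr 1
  have h1 : B (g x) (f i) = -ε * B (g (f i)) x := skewAdjoint_gram_symm hε hg _ _
  conv_rhs => rw [h1, eq_sum_of_mem_span_dual h (hgU (f i))]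
  simp only [map_sum, map_smul, LinearMap.sum_apply, LinearMap.smul_apply, smul_eq_mul,
    Finset.mul_sum]
  refine Finset.sum_congr rfl fun j _ => ?_
  rw [Matrix.of_apply, skewAdjoint_gram_symm hε hg]
  ring

/-- By skewness `B (g (g x)) y = -B (g x) (g y)`, and this is zero on an isotropic image. -/
theorem skewAdjoint_sq_eq_zero {B : LinearMap.BilinForm k V} (hB : B.Nondegenerate)
    {g : Module.End k V} (hg : g ∈ skewAdjointLieSubalgebra B)
    (h : ∀ x y, B (g x) (g y) = 0) (x : V) : g (g x) = 0 := by
  refine hB.1 _ fun y => ?_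
  rw [mem_skewAdjointLieSubalgebra.1 hg, h, neg_zero]

/-- This shows that the rank condition is open, and the vectors `x i` give a basis `g (x i)` of the
image that varies regularly with `g` where the rank is exactly `m`. -/
theorem le_finrank_range_iff [FiniteDimensional k V] {g : Module.End k V} {m : ℕ} :
    m ≤ Module.finrank k (LinearMap.range g) ↔ ∃ (x : Fin m → V) (π : V →ₗ[k] (Fin m → k)),
      (Matrix.of fun i => π (g (x i))).det ≠ 0 := by
  constructor
  · intro h
    let y := Module.finBasis k (LinearMap.range g)
    choose x hx using fun i : Fin m => (y (Fin.castLE h i)).2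
    have hy : LinearIndependent k fun i : Fin m => g (x i) := by
      simp only [hx]
      exact (y.linearIndependent.comp _ (Fin.castLE_injective h)).map'
        (LinearMap.range g).subtype (Submodule.ker_subtype _)
    obtain ⟨π, hπ⟩ := hy.exists_linearMap
    refine ⟨x, π, ?_⟩
    have : (Matrix.of fun i => π (g (x i))) = 1 := by
      ext i j
      simp [hπ, Matrix.one_apply, Pi.single_apply, eq_comm]
    simp [this]
  · rintro ⟨x, π, hdet⟩
    have h1 : LinearIndependent k fun i => g (x i) := linearIndependent_of_det_ne_zero hdet
    have h2 : LinearIndependent k fun i => (⟨g (x i), x i, rfl⟩ : LinearMap.range g) :=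
      LinearIndependent.of_comp (LinearMap.range g).subtype h1
    simpa using h2.fintype_card_le_finrank

/-- A nondegenerate matrix of the right symmetry. -/
theorem exists_matrix_symm_det_ne_zero {m : ℕ} {ε : k} (h : (ε = 1 ∧ Even m) ∨ ε = -1) :
    ∃ s : Matrix (Fin m) (Fin m) k, (∀ i j, s i j = -ε * s j i) ∧ s.det ≠ 0 := by
  -- For `ε = 1` the matrix must be skew-symmetric and invertible, which is where the parity of `m`
  -- enters; for `ε = -1` the identity matrix will do.
  rcases h with ⟨rfl, r, rfl⟩ | rfl
  · refine ⟨Matrix.reindex finSumFinEquiv finSumFinEquiv (Matrix.J (Fin r) k), fun i j => ?_, ?_⟩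
    · have := congrFun (congrFun (Matrix.J_transpose (Fin r) k) (finSumFinEquiv.symm j))
        (finSumFinEquiv.symm i)
      simpa using this
    · rw [Matrix.det_reindex_self]
      exact (Matrix.isUnit_det_J (Fin r) k).ne_zero
  · exact ⟨1, fun i j => by simp [Matrix.one_apply, eq_comm], by simp⟩

end LinearAlgebra

/-! ### Jordan type of the endomorphisms of square zero. -/

section JordanType

variable {k : Type v} [Field k] {V : Type u} [AddCommGroup V] [Module k V] [FiniteDimensional k V]

/-- The blocks of size two are the pairs `g x, x` with `g x` running through a basis of the image;
the blocks of size one are a basis of a complement of the image in the kernel. -/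
theorem hasNilpotentJordanType_two_one {m : ℕ} (hm : 2 * m ≤ Module.finrank k V)
    {g : Module.End k V} : HasNilpotentJordanType g
      (List.replicate m 2 ++ List.replicate (Module.finrank k V - 2 * m) 1) ↔
      (∀ x, g (g x) = 0) ∧ Module.finrank k (LinearMap.range g) = m := by
  set r := Module.finrank k V - 2 * m with hr
  set l := List.replicate m 2 ++ List.replicate r 1 with hl
  have hlen : l.length = m + r := by simp [hl]
  have hget : ∀ i : Fin l.length, l.get i = if i.1 < m then 2 else 1 := by
    intro i
    simp only [List.get_eq_getElem, hl, List.getElem_append, List.length_replicate,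
      List.getElem_replicate]
    split_ifs <;> rfl
  have hget1 : ∀ i : Fin l.length, i.1 < m → l.get i = 2 := fun i hi => by rw [hget, if_pos hi]
  have hpos : ∀ i : Fin l.length, 0 < l.get i := fun i => by rw [hget]; split_ifs <;> norm_num
  have hlt : ∀ i : Fin m, i.1 < l.length := fun i => by have := i.2; omega
  constructor
  · rintro ⟨b, hb⟩
    -- A basis vector that is not the first of its block is the second vector of one of the `m`
    -- blocks of size two.
    have hcase : ∀ (i : Fin l.length) (j : Fin (l.get i)), g (b ⟨i, j⟩) = 0 ∨
        (i.1 < m ∧ g (b ⟨i, j⟩) = b ⟨i, ⟨0, hpos i⟩⟩) := by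
      intro i j
      by_cases hj : j.1 = 0
      · exact Or.inl ((hb i j).1 hj)
      · have h2 := hget i
        have h3 := j.2
        by_cases hi : i.1 < m
        · refine Or.inr ⟨hi, (hb i j).2 _ ?_⟩
          rw [if_pos hi] at h2
          simp only
          omega
        · rw [if_neg hi] at h2
          omega
    constructor
    · intro x
      have : g ∘ₗ g = 0 := by
        refine b.ext fun ⟨i, j⟩ => ?_
        rcases hcase i j with h | ⟨-, h⟩
        · simp [h]
        · simp only [LinearMap.comp_apply, h, LinearMap.zero_apply]
          exact (hb i _).1 rfl
      exact LinearMap.congr_fun this x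
    · have hrange : LinearMap.range g = Submodule.span k
          (Set.range fun i : Fin m => b ⟨⟨i.1, hlt i⟩, ⟨0, hpos _⟩⟩) := by
        refine le_antisymm ?_ ?_
        · rw [LinearMap.range_eq_map, ← b.span_eq, Submodule.map_span, Submodule.span_le]
          rintro _ ⟨_, ⟨⟨i, j⟩, rfl⟩, rfl⟩
          rcases hcase i j with h | ⟨hi, h⟩
          · rw [h]
            exact zero_mem _
          · rw [h]
            exact Submodule.subset_span ⟨⟨i.1, hi⟩, rfl⟩
        · rw [Submodule.span_le]
          rintro _ ⟨i, rfl⟩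
          have h2 := hget1 ⟨i.1, hlt i⟩ i.2
          exact ⟨b ⟨⟨i.1, hlt i⟩, ⟨1, by omega⟩⟩, (hb _ _).2 _ rfl⟩
      rw [hrange, finrank_span_eq_card, Fintype.card_fin]
      refine b.linearIndependent.comp _ fun i j hij => ?_
      have := congrArg (fun q => q.1.1) hij
      exact Fin.ext this
  · rintro ⟨hg2, hrank⟩
    let y : Module.Basis (Fin m) k (LinearMap.range g) := Module.finBasisOfFinrankEq k _ hrank
    choose x hx using fun i => (y i).2
    obtain ⟨C, hC⟩ := Submodule.exists_isCompl (LinearMap.range g)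
    have hle : LinearMap.range g ≤ LinearMap.ker g := by
      rintro _ ⟨v, rfl⟩
      exact hg2 v
    -- By the modular law this is a complement of the image inside the kernel, of dimension `n - 2 *
    -- m`.
    let W := C ⊓ LinearMap.ker g
    have hsup : LinearMap.range g ⊔ W = LinearMap.ker g := by
      rw [← sup_inf_assoc_of_le C hle, hC.sup_eq_top, top_inf_eq]
    have hinf : LinearMap.range g ⊓ W = ⊥ := by
      rw [← inf_assoc, hC.inf_eq_bot, bot_inf_eq]
    have hW : Module.finrank k W = r := by
      have h1 := Submodule.finrank_sup_add_finrank_inf_eq (LinearMap.range g) W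
      have h2 := LinearMap.finrank_range_add_finrank_ker g
      rw [hsup, hinf, finrank_bot] at h1
      omega
    let z : Module.Basis (Fin r) k W := Module.finBasisOfFinrankEq k _ hW
    let c : (Σ i : Fin l.length, Fin (l.get i)) → V := fun q =>
      if h : q.1.1 < m then if q.2.1 = 0 then g (x ⟨q.1.1, h⟩) else x ⟨q.1.1, h⟩
      else z ⟨q.1.1 - m, by have := q.1.2; omega⟩
    have hspan : ⊤ ≤ Submodule.span k (Set.range c) := by
      have hgx : ∀ i, g (x i) ∈ Submodule.span k (Set.range c) := fun i =>
        Submodule.subset_span ⟨⟨⟨i.1, hlt i⟩, ⟨0, hpos _⟩⟩, by simp [c]⟩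
      have hxm : ∀ i, x i ∈ Submodule.span k (Set.range c) := fun i => by
        have h2 := hget1 ⟨i.1, hlt i⟩ i.2
        exact Submodule.subset_span ⟨⟨⟨i.1, hlt i⟩, ⟨1, by omega⟩⟩, by simp [c]⟩
      have hz : ∀ i, (z i : V) ∈ Submodule.span k (Set.range c) := fun i => by
        refine Submodule.subset_span ⟨⟨⟨m + i.1, by have := i.2; omega⟩, ⟨0, hpos _⟩⟩, ?_⟩
        simp [c]
      have hran : LinearMap.range g ≤ Submodule.span k (Set.range c) := by
        intro v hv
        rw [← Submodule.coe_mk v hv, ← y.sum_repr ⟨v, hv⟩]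
        simp only [Submodule.coe_sum, Submodule.coe_smul, ← hx]
        exact Submodule.sum_mem _ fun i _ => Submodule.smul_mem _ _ (hgx i)
      have hWle : W ≤ Submodule.span k (Set.range c) := by
        intro v hv
        rw [← Submodule.coe_mk v hv, ← z.sum_repr ⟨v, hv⟩]
        simp only [Submodule.coe_sum, Submodule.coe_smul]
        exact Submodule.sum_mem _ fun i _ => Submodule.smul_mem _ _ (hz i)
      intro v _
      -- Subtracting the combination of the `x i` with the same image as `v` leaves an element of
      -- the kernel.
      have hker : v - ∑ i, y.repr ⟨g v, v, rfl⟩ i • x i ∈ LinearMap.ker g := by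
        have := congrArg Subtype.val (y.sum_repr ⟨g v, v, rfl⟩)
        simp only [Submodule.coe_sum, Submodule.coe_smul, ← hx] at this
        rw [LinearMap.mem_ker, map_sub, map_sum, sub_eq_zero]
        simp only [map_smul, this]
      rw [← hsup] at hker
      have := add_mem (sup_le hran hWle hker)
        (Submodule.sum_mem _ fun i (_ : i ∈ Finset.univ) =>
          Submodule.smul_mem _ (y.repr ⟨g v, v, rfl⟩ i) (hxm i))
      simpa using this
    have hcard : Fintype.card (Σ i : Fin l.length, Fin (l.get i)) = Module.finrank k V := by
      rw [Fintype.card_sigma]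
      simp only [Fintype.card_fin, List.get_eq_getElem]
      rw [Fin.sum_univ_getElem, hl]
      simp
      omega
    let b := basisOfTopLeSpanOfCardEqFinrank c hspan hcard
    have hbc : ∀ q, b q = c q := fun q => by simp [b]
    refine ⟨b, fun i j => ?_⟩
    rw [hbc]
    refine ⟨fun hj => ?_, fun j' hj' => ?_⟩
    · by_cases hi : i.1 < m
      · simp [c, hi, hj, hg2]
      · simp only [c, hi, dif_neg, not_false_eq_true]
        exact (z _).2.2
    · have h2 := hget i
      have h3 := j.2
      by_cases hi : i.1 < m
      · rw [if_pos hi] at h2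
        have h4 : j'.1 = 0 := by omega
        have h5 : j.1 ≠ 0 := by omega
        rw [hbc]
        simp [c, hi, h4, h5]
      · rw [if_neg hi] at h2
        omega

end JordanType

/-! ### Affine cells of the Grassmannian and morphisms to it. -/

section Grassmannian

open SpaceWithFunctions

variable {k : Type v} [Field k] {V : Type u} [AddCommGroup V] [Module k V]

variable {m : ℕ}

/-- The `m`-dimensional subspaces which are mapped isomorphically onto `k ^ m` by `π`. -/
def grassmannianCell (π : V →ₗ[k] (Fin m → k)) : Set (grassmannianVariety k V m).carrier :=
  {U | ∃ b : Fin m → V, Submodule.span k (Set.range b) = U.1 ∧ ∀ i, π (b i) = Pi.single i 1}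

open Classical in
/-- The basis of a subspace in `grassmannianCell π` which is mapped to the standard basis by `π`. -/
noncomputable def cellBasis (π : V →ₗ[k] (Fin m → k)) (U : (grassmannianVariety k V m).carrier) :
    Fin m → V :=
  if h : U ∈ grassmannianCell π then h.choose else 0

variable {π : V →ₗ[k] (Fin m → k)} {U : (grassmannianVariety k V m).carrier}

theorem span_cellBasis (h : U ∈ grassmannianCell π) :
    Submodule.span k (Set.range (cellBasis π U)) = U.1 := by
  rw [cellBasis, dif_pos h]
  exact h.choose_spec.1

theorem map_cellBasis (h : U ∈ grassmannianCell π) (i : Fin m) :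
    π (cellBasis π U i) = Pi.single i 1 := by
  rw [cellBasis, dif_pos h]
  exact h.choose_spec.2 i

theorem det_ne_zero_of_map_eq_single {b : Fin m → V} (h : ∀ i, π (b i) = Pi.single i 1) :
    (Matrix.of fun i => π (b i)).det ≠ 0 := by
  have : (Matrix.of fun i => π (b i)) = 1 := by
    ext i j
    simp [h, Matrix.one_apply, Pi.single_apply, eq_comm]
  simp [this]

theorem linearIndependent_of_map_eq_single {b : Fin m → V} (h : ∀ i, π (b i) = Pi.single i 1) :
    LinearIndependent k b :=
  linearIndependent_of_det_ne_zero (det_ne_zero_of_map_eq_single h)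

theorem cellBasis_eq {b : Fin m → V} (hb : Submodule.span k (Set.range b) = U.1)
    (h : ∀ i, π (b i) = Pi.single i 1) : cellBasis π U = b := by
  have hU : U ∈ grassmannianCell π := ⟨b, hb, h⟩
  funext i
  refine sub_eq_zero.1 (eq_zero_of_det_ne_zero (det_ne_zero_of_map_eq_single h)
    (sub_mem ?_ (Submodule.subset_span ⟨i, rfl⟩)) ?_)
  · rw [hb, ← span_cellBasis hU]
    exact Submodule.subset_span ⟨i, rfl⟩
  · rw [map_sub, map_cellBasis hU, h, sub_self]

theorem cellBasis_mem (h : U ∈ grassmannianCell π) (i : Fin m) : cellBasis π U i ∈ U.1 := by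
  rw [← span_cellBasis h]
  exact Submodule.subset_span ⟨i, rfl⟩

/-- Inside a cell, membership in `U` becomes the vanishing of a vector that depends regularly on `U`
and `v`. -/
theorem mem_iff_eq_sum_cellBasis (h : U ∈ grassmannianCell π) {v : V} :
    v ∈ U.1 ↔ v - ∑ i, π v i • cellBasis π U i = 0 := by
  constructor
  · intro hv
    refine eq_zero_of_det_ne_zero (det_ne_zero_of_map_eq_single (map_cellBasis h)) ?_ ?_
    · rw [span_cellBasis h]
      exact sub_mem hv (Submodule.sum_mem _ fun i _ => Submodule.smul_mem _ _ (cellBasis_mem h i))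
    · rw [map_sub, map_sum, sub_eq_zero]
      ext j
      simp [map_cellBasis h, Pi.single_apply]
  · intro hv
    rw [sub_eq_zero.1 hv]
    exact Submodule.sum_mem _ fun i _ => Submodule.smul_mem _ _ (cellBasis_mem h i)

/-- The normalization of a basis of a subspace in the cell of `π`. -/
theorem map_inv_matrix_smul {b : Fin m → V} (hdet : (Matrix.of fun i => π (b i)).det ≠ 0)
    (i : Fin m) :
    π (∑ j, (Matrix.of fun i => π (b i))⁻¹ i j • b j) = Pi.single i 1 := by
  ext l
  have := congrFun (congrFun (Matrix.nonsing_inv_mul (Matrix.of fun i => π (b i)) hdet.isUnit) i) l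
  rw [Matrix.mul_apply] at this
  simpa [Matrix.one_apply, Pi.single_apply, eq_comm] using this

theorem span_inv_matrix_smul [FiniteDimensional k V] {b : Fin m → V}
    (hdet : (Matrix.of fun i => π (b i)).det ≠ 0) :
    Submodule.span k (Set.range fun i => ∑ j, (Matrix.of fun i => π (b i))⁻¹ i j • b j) =
      Submodule.span k (Set.range b) := by
  refine Submodule.eq_of_le_of_finrank_eq (Submodule.span_le.2 ?_) ?_
  · rintro _ ⟨i, rfl⟩
    exact Submodule.sum_mem _ fun j _ => Submodule.smul_mem _ _ (Submodule.subset_span ⟨j, rfl⟩)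
  · rw [finrank_span_eq_card (linearIndependent_of_map_eq_single (map_inv_matrix_smul hdet)),
      finrank_span_eq_card (linearIndependent_of_det_ne_zero hdet)]

/-- Any basis of `U` can serve: if the determinant is nonzero, multiplying by the inverse matrix
normalizes the basis. -/
theorem mem_grassmannianCell_iff [FiniteDimensional k V] {b : Fin m → V}
    (hb : Submodule.span k (Set.range b) = U.1) :
    U ∈ grassmannianCell π ↔ (Matrix.of fun i => π (b i)).det ≠ 0 := by
  constructor
  · intro hU
    have hle : ∀ i, cellBasis π U i ∈ Submodule.span k (Set.range b) := fun i =>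
      hb ▸ cellBasis_mem hU i
    choose a ha using fun i => (Submodule.mem_span_range_iff_exists_fun k).1 (hle i)
    have : Matrix.of a * (Matrix.of fun i => π (b i)) = 1 := by
      ext i j
      rw [Matrix.mul_apply]
      have := congrFun (congrArg π (ha i)) j
      simpa [map_cellBasis hU, Matrix.one_apply, Pi.single_apply, eq_comm] using this
    exact right_ne_zero_of_mul (a := (Matrix.of a).det) (by rw [← Matrix.det_mul, this]; simp)
  · exact fun h => ⟨_, (span_inv_matrix_smul h).trans hb, map_inv_matrix_smul h⟩

/-- A map to the Grassmannian is a morphism as soon as the subspace has a basis that varies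
regularly: it lifts locally to the space of linearly independent tuples. -/
theorem isMorphismAt_grassmannian {T : SpaceWithFunctions.{w} k} (hT : T.IsLocal)
    {f : T.carrier → (grassmannianVariety k V m).carrier} {c : T.carrier → Fin m → V}
    {t : T.carrier} (hc : IsRegularAt T c t)
    (h : ∀ᶠ s in @nhds _ T.top t, LinearIndependent k (c s) ∧
      (f s).1 = Submodule.span k (Set.range (c s))) :
    IsMorphismAt T (grassmannianVariety k V m) f t := by
  classical
  have ht : LinearIndependent k (c t) := (@Eventually.self_of_nhds _ T.top t _ h).1
  -- The lift must be defined everywhere; where `c s` is dependent, the constant value `c t` is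
  -- used, which does not affect the germ at `t`.
  let c' : T.carrier → {b : Fin m → V | LinearIndependent k b} := fun s =>
    if h : LinearIndependent k (c s) then ⟨c s, h⟩ else ⟨c t, ht⟩
  have hc' : IsMorphismAt T (affineSpace k (Fin m → V)) (fun s => (c' s).1) t := by
    refine IsRegularAt.isMorphismAt hT (hc.congr ?_)
    filter_upwards [h] with s hs
    simp [c', hs.1]
  refine ((IsMorphismAt.quotient_map _).comp (IsMorphismAt.sub_mk hc')).congr ?_
  filter_upwards [h] with s hs
  refine Subtype.ext ?_
  simp [c', hs.1, hs.2]

variable [FiniteDimensional k V]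

theorem isOpen_grassmannianCell (π : V →ₗ[k] (Fin m → k)) :
    IsOpen[(grassmannianVariety k V m).top] (grassmannianCell π) := by
  refine isOpen_coinduced.2 ?_
  have h : IsOpen[((affineSpace k (Fin m → V)).sub {b | LinearIndependent k b}).top]
      {b | (Matrix.of fun i => π (b.1 i)).det ≠ 0} :=
    isOpen_ne_zero (isLocal_affineSpace.sub _) fun b => IsRegularAt.det fun i j =>
      (IsRegularAt.affine (LinearMap.proj j ∘ₗ π ∘ₗ LinearMap.proj i) b.1).comp (.val _ b)
  convert h using 1
  ext b
  exact mem_grassmannianCell_iff rfl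

/-- On tuples `b` the normalized basis is the inverse of the matrix of the `π (b i)` applied to `b`,
which is regular by Cramer's rule; being a function of the span, it descends to the quotient. -/
theorem isRegularAt_cellBasis (hU : U ∈ grassmannianCell π) :
    IsRegularAt (grassmannianVariety k V m) (cellBasis π) U := by
  refine IsMorphismAt.isRegularAt (IsMorphismAt.of_quotient (isOpen_grassmannianCell π) ?_ hU)
  intro b hb
  have hloc : ((affineSpace k (Fin m → V)).sub {b | LinearIndependent k b}).IsLocal :=
    isLocal_affineSpace.sub _
  refine IsRegularAt.isMorphismAt hloc ?_
  have hdet := (mem_grassmannianCell_iff rfl).1 hb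
  have hb' : ∀ i, IsRegularAt ((affineSpace k (Fin m → V)).sub {b | LinearIndependent k b})
      (fun b => b.1 i) b := fun i =>
    (IsRegularAt.affine (LinearMap.proj i) b.1).comp (.val _ b)
  have hM : ∀ i j, IsRegularAt ((affineSpace k (Fin m → V)).sub {b | LinearIndependent k b})
      (fun b => (Matrix.of fun i => π (b.1 i)) i j) b := fun i j =>
    ((hb' i).linear (LinearMap.proj j ∘ₗ π))
  have hreg : IsRegularAt ((affineSpace k (Fin m → V)).sub {b | LinearIndependent k b})
      (fun b => fun i => ∑ j, (Matrix.of fun i => π (b.1 i))⁻¹ i j • b.1 j) b :=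
    IsRegularAt.pi fun i => IsRegularAt.sum fun j _ =>
      (IsRegularAt.matrix_inv hloc hM hdet i j).smul (hb' j)
  refine hreg.congr ?_
  filter_upwards [(IsRegularAt.det hM).eventually_ne_zero hloc hdet] with c hc
  exact (cellBasis_eq (span_inv_matrix_smul hc) (map_inv_matrix_smul hc)).symm

theorem exists_mem_grassmannianCell (U : (grassmannianVariety k V m).carrier) :
    ∃ π : V →ₗ[k] (Fin m → k), U ∈ grassmannianCell π := by
  let b : Module.Basis (Fin m) k U.1 := Module.finBasisOfFinrankEq k _ U.2
  have hb : LinearIndependent k fun i => (b i : V) :=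
    b.linearIndependent.map' U.1.subtype (Submodule.ker_subtype _)
  obtain ⟨π, hπ⟩ := hb.exists_linearMap
  refine ⟨π, _, ?_, hπ⟩
  have := congrArg (Submodule.map U.1.subtype) b.span_eq
  rw [Submodule.map_span, ← Set.range_comp, Submodule.map_subtype_top] at this
  exact this

/-- The linear maps to `k ^ m` which choose `m` of the coordinates. -/
noncomputable def coordinateMap {n : ℕ} (v : Module.Basis (Fin n) k V) (φ : Fin m → Fin n) :
    V →ₗ[k] (Fin m → k) :=
  LinearMap.pi fun i => v.coord (φ i)

/-- Row rank equals column rank, so the columns span and contain a basis. -/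
theorem exists_submatrix_det_ne_zero {n : ℕ} {N : Matrix (Fin m) (Fin n) k}
    (hN : LinearIndependent k N.row) : ∃ φ : Fin m → Fin n, (N.submatrix id φ).det ≠ 0 := by
  have hspan : Submodule.span k (Set.range N.col) = ⊤ := by
    refine Submodule.eq_top_of_finrank_eq ?_
    rw [← Matrix.rank_eq_finrank_span_cols, hN.rank_matrix]
    simp
  obtain ⟨t, ht, hst, hti⟩ := exists_linearIndependent k (Set.range N.col)
  rw [hspan] at hst
  let β : Module.Basis t k (Fin m → k) := Module.Basis.mk hti (by simp [hst])
  let e : Fin m ≃ t := (Pi.basisFun k (Fin m)).indexEquiv β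
  choose φ hφ using fun i => ht (e i).2
  refine ⟨φ, IsUnit.ne_zero ((Matrix.isUnit_iff_isUnit_det _).1
    (Matrix.linearIndependent_cols_iff_isUnit.1 ?_))⟩
  have : (N.submatrix id φ).col = fun i => (e i : Fin m → k) := funext fun i => hφ i
  rw [this]
  exact hti.comp e e.injective

/-- There are only finitely many coordinate maps, so these cells yield a finite cover. -/
theorem exists_mem_coordinateCell {n : ℕ} (v : Module.Basis (Fin n) k V)
    (U : (grassmannianVariety k V m).carrier) :
    ∃ φ : Fin m → Fin n, U ∈ grassmannianCell (coordinateMap v φ) := by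
  obtain ⟨π, hU⟩ := exists_mem_grassmannianCell U
  have hb := linearIndependent_of_map_eq_single (map_cellBasis hU)
  obtain ⟨φ, hφ⟩ := exists_submatrix_det_ne_zero
    (N := Matrix.of fun i => v.equivFun (cellBasis π U i))
    (hb.map' v.equivFun.toLinearMap v.equivFun.ker)
  exact ⟨φ, (mem_grassmannianCell_iff (span_cellBasis hU)).2 hφ⟩

theorem isClosed_mem_grassmannian {T : SpaceWithFunctions.{w} k} (hT : T.IsLocal)
    {f : T.carrier → (grassmannianVariety k V m).carrier}
    (hf : ∀ t, IsMorphismAt T (grassmannianVariety k V m) f t) {g : T.carrier → V}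
    (hg : ∀ t, IsRegularAt T g t) : IsClosed[T.top] {t | g t ∈ (f t).1} := by
  let _ := T.top
  rw [← isOpen_compl_iff, isOpen_iff_mem_nhds]
  intro t ht
  obtain ⟨π, hπ⟩ := exists_mem_grassmannianCell (f t)
  have hreg : IsRegularAt T (fun s => g s - ∑ i, π (g s) i • cellBasis π (f s) i) t :=
    (hg t).sub (IsRegularAt.sum fun i _ => ((hg t).linear (LinearMap.proj i ∘ₗ π)).smul
      (((isRegularAt_cellBasis hπ).comp (hf t)).apply i))
  have hne : g t - ∑ i, π (g t) i • cellBasis π (f t) i ≠ 0 := fun h =>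
    ht ((mem_iff_eq_sum_cellBasis hπ).2 h)
  filter_upwards [hreg.eventually_ne_zero hT hne,
    (hf t).tendsto.eventually (@IsOpen.mem_nhds _ (grassmannianVariety k V m).top _ _
      (isOpen_grassmannianCell π) hπ)] with s hs hs' hmem
  exact hs ((mem_iff_eq_sum_cellBasis hs').1 hmem)

theorem isClosed_range_le_grassmannian {T : SpaceWithFunctions.{w} k} (hT : T.IsLocal)
    {f : T.carrier → (grassmannianVariety k V m).carrier}
    (hf : ∀ t, IsMorphismAt T (grassmannianVariety k V m) f t) {g : T.carrier → Module.End k V}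
    (hg : ∀ t, IsRegularAt T g t) :
    IsClosed[T.top] {t | LinearMap.range (g t) ≤ (f t).1} := by
  have : {t | LinearMap.range (g t) ≤ (f t).1} = ⋂ v, {t | g t v ∈ (f t).1} := by
    ext t
    simp only [Set.mem_ofPred_eq, Set.mem_iInter]
    exact ⟨fun h v => h ⟨v, rfl⟩, by rintro h _ ⟨v, rfl⟩; exact h v⟩
  rw [this]
  exact @isClosed_iInter _ _ T.top _ fun v =>
    isClosed_mem_grassmannian hT hf fun t => (hg t).apply_hom v

theorem isClosed_isotropic (B : LinearMap.BilinForm k V) {T : SpaceWithFunctions.{w} k}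
    (hT : T.IsLocal) {f : T.carrier → (grassmannianVariety k V m).carrier}
    (hf : ∀ t, IsMorphismAt T (grassmannianVariety k V m) f t) :
    IsClosed[T.top] {t | ∀ x ∈ (f t).1, ∀ y ∈ (f t).1, B x y = 0} := by
  let _ := T.top
  rw [← isOpen_compl_iff, isOpen_iff_mem_nhds]
  intro t ht
  obtain ⟨π, hπ⟩ := exists_mem_grassmannianCell (f t)
  have hreg : ∀ i j, IsRegularAt T
      (fun s => B (cellBasis π (f s) i) (cellBasis π (f s) j)) t := fun i j =>
    IsRegularAt.bilin B (((isRegularAt_cellBasis hπ).comp (hf t)).apply i)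
      (((isRegularAt_cellBasis hπ).comp (hf t)).apply j)
  obtain ⟨i, j, hij⟩ : ∃ i j, B (cellBasis π (f t) i) (cellBasis π (f t) j) ≠ 0 := by
    by_contra! h
    refine ht fun x hx y hy => ?_
    rw [sub_eq_zero.1 ((mem_iff_eq_sum_cellBasis hπ).1 hx),
      sub_eq_zero.1 ((mem_iff_eq_sum_cellBasis hπ).1 hy)]
    simp [h]
  filter_upwards [(hreg i j).eventually_ne_zero hT hij,
    (hf t).tendsto.eventually (@IsOpen.mem_nhds _ (grassmannianVariety k V m).top _ _
      (isOpen_grassmannianCell π) hπ)] with s hs hs' hmem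
  exact hs (hmem _ (cellBasis_mem hs' i) _ (cellBasis_mem hs' j))

end Grassmannian

/-! ### The space of pairs and the closure of the class. -/

section Pairs

open SpaceWithFunctions

variable {k : Type v} [Field k] {V : Type u} [AddCommGroup V] [Module k V]

theorem SpaceWithFunctions.IsMorphismAt.const {X : SpaceWithFunctions.{w} k}
    {Y : SpaceWithFunctions.{u} k} (c : Y.carrier) (x : X.carrier) :
    IsMorphismAt X Y (fun _ => c) x :=
  let _ := Y.top
  ⟨tendsto_const_nhds, fun φ _ => algebraMap_mem (X.regularAt x) (φ c)⟩

variable (B : LinearMap.BilinForm k V) (m : ℕ)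

theorem isLocal_twoColumnPairs : (twoColumnPairs B m).IsLocal := isLocal_prod.sub _

theorem isLocal_twoColumnClosure : (twoColumnClosure B m).IsLocal := isLocal_affineSpace.sub _

variable {B m}

theorem isMorphismAt_pairs_closure (p : (twoColumnPairs B m).carrier) :
    IsMorphismAt (twoColumnPairs B m) (twoColumnClosure B m) (fun q => q.1.1) p :=
  (IsMorphismAt.fst p.1).comp (.val _ p)

theorem isMorphismAt_pairs_isotropic (p : (twoColumnPairs B m).carrier) :
    IsMorphismAt (twoColumnPairs B m) (isotropicGrassmannian B m) (fun q => q.1.2) p :=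
  (IsMorphismAt.snd p.1).comp (.val _ p)

theorem isMorphismAt_pairs_grassmannian (p : (twoColumnPairs B m).carrier) :
    IsMorphismAt (twoColumnPairs B m) (grassmannianVariety k V m) (fun q => q.1.2.1) p :=
  IsMorphismAt.comp (X := twoColumnPairs B m) (f := fun q => q.1.2) (IsMorphismAt.val _ p.1.2)
    (isMorphismAt_pairs_isotropic p)

theorem isRegularAt_closure (p : (twoColumnClosure B m).carrier) :
    IsRegularAt (twoColumnClosure B m) (fun q => q.1) p :=
  (IsMorphismAt.val _ p).isRegularAt

theorem isRegularAt_pairs (p : (twoColumnPairs B m).carrier) :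
    IsRegularAt (twoColumnPairs B m) (fun q => q.1.1.1) p :=
  IsRegularAt.comp (X := twoColumnPairs B m) (g := fun q => q.1.1) (isRegularAt_closure p.1.1)
    (isMorphismAt_pairs_closure p)

theorem isMorphismAt_pairs {T : SpaceWithFunctions.{w} k} (hT : T.IsLocal)
    {f : T.carrier → (twoColumnPairs B m).carrier} {t : T.carrier}
    (h1 : IsRegularAt T (fun s => (f s).1.1.1) t)
    (h2 : IsMorphismAt T (grassmannianVariety k V m) (fun s => (f s).1.2.1) t) :
    IsMorphismAt T (twoColumnPairs B m) f t :=
  .sub_mk (.prod_mk hT (.sub_mk (h1.isMorphismAt hT)) (.sub_mk h2))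

theorem isotropic_sq_eq_zero (hB : B.Nondegenerate) {U : Submodule k V}
    (hU : ∀ x ∈ U, ∀ y ∈ U, B x y = 0) {g : Module.End k V} (hg : g ∈ skewAdjointInto B U) (x : V) :
    g (g x) = 0 :=
  skewAdjoint_sq_eq_zero hB hg.1 (fun x y => hU _ (hg.2 x) _ (hg.2 y)) x

variable [FiniteDimensional k V]

theorem isOpen_le_finrank_range (r : ℕ) :
    IsOpen[(affineSpace k (Module.End k V)).top]
      {g | r ≤ Module.finrank k (LinearMap.range g)} := by
  have : {g : Module.End k V | r ≤ Module.finrank k (LinearMap.range g)} =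
      ⋃ (x : Fin r → V) (π : V →ₗ[k] (Fin r → k)),
        {g | (Matrix.of fun i => π (g (x i))).det ≠ 0} := by
    ext g
    simp only [Set.mem_ofPred_eq, Set.mem_iUnion, le_finrank_range_iff]
  rw [this]
  refine @isOpen_iUnion _ _ (affineSpace k _).top _ fun x =>
    @isOpen_iUnion _ _ (affineSpace k _).top _ fun π => ?_
  exact isOpen_ne_zero isLocal_affineSpace fun g => IsRegularAt.det fun i j =>
    ((IsRegularAt.affine_id g).apply_hom (x i)).linear (LinearMap.proj j ∘ₗ π)

/-- All three conditions are closed and hold on the class; the last is the complement of the open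
condition of rank at least `m + 1`. -/
theorem closure_twoColumnClass_subset (hm : 2 * m ≤ Module.finrank k V) {g : Module.End k V}
    (hg : g ∈ closure[(affineSpace k (Module.End k V)).top] (twoColumnClass B m)) :
    g ∈ skewAdjointLieSubalgebra B ∧ (∀ x, g (g x) = 0) ∧
      Module.finrank k (LinearMap.range g) ≤ m := by
  have hmem : ∀ {S : Set (Module.End k V)}, IsClosed[(affineSpace k (Module.End k V)).top] S →
      twoColumnClass B m ⊆ S → g ∈ S := fun hS hsub =>
    @closure_minimal _ (affineSpace k (Module.End k V)).top _ _ hsub hS g hg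
  have hclass : ∀ g' ∈ twoColumnClass B m, g' ∈ skewAdjointLieSubalgebra B ∧
      (∀ x, g' (g' x) = 0) ∧ Module.finrank k (LinearMap.range g') = m := fun g' hg' =>
    ⟨hg'.1, (hasNilpotentJordanType_two_one hm).1 hg'.2⟩
  have hap : ∀ (g' : Module.End k V) {f : Module.End k V → V},
      IsRegularAt (affineSpace k (Module.End k V)) f g' →
      IsRegularAt (affineSpace k (Module.End k V)) (fun h => h (f h)) g' := fun g' f hf =>
    IsRegularAt.bilin (LinearMap.id : Module.End k V →ₗ[k] V →ₗ[k] V)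
      (IsRegularAt.affine_id g') hf
  refine ⟨mem_skewAdjointLieSubalgebra.2 fun x y => ?_, fun x => ?_, ?_⟩
  · rw [eq_neg_iff_add_eq_zero]
    refine hmem (S := {g | B (g x) y + B x (g y) = 0})
      (isClosed_eq_zero isLocal_affineSpace fun g' => ?_) fun g' hg' => ?_
    · exact ((hap g' (.const x)).linear (B.flip y)).add ((hap g' (.const y)).linear (B x))
    · rw [Set.mem_ofPred_eq, mem_skewAdjointLieSubalgebra.1 (hclass g' hg').1, neg_add_cancel]
  · exact hmem (S := {g | g (g x) = 0})
      (isClosed_eq_zero isLocal_affineSpace fun g' => hap g' (hap g' (.const x)))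
      fun g' hg' => (hclass g' hg').2.1 x
  · refine not_lt.1 (hmem (S := {g | m + 1 ≤ Module.finrank k (LinearMap.range g)}ᶜ) ?_ ?_)
    · exact @IsOpen.isClosed_compl _ (affineSpace k _).top _ (isOpen_le_finrank_range _)
    · intro g' hg' h
      have := (hclass g' hg').2.2
      simp only [Set.mem_ofPred_eq] at h
      omega

theorem mem_twoColumnClass_of_le (hB : B.Nondegenerate) (hm : 2 * m ≤ Module.finrank k V)
    {U : Submodule k V} (hdim : Module.finrank k U = m) (hU : ∀ x ∈ U, ∀ y ∈ U, B x y = 0)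
    {g : Module.End k V} (hg : g ∈ skewAdjointInto B U)
    (hr : m ≤ Module.finrank k (LinearMap.range g)) : g ∈ twoColumnClass B m := by
  refine ⟨hg.1, (hasNilpotentJordanType_two_one hm).2 ⟨isotropic_sq_eq_zero hB hU hg, ?_⟩⟩
  refine le_antisymm (hdim ▸ Submodule.finrank_mono ?_) hr
  rintro _ ⟨x, rfl⟩
  exact hg.2 x

/-- The elements of rank `m` exist in the fibres. -/
theorem exists_mem_skewAdjointInto (hB : B.Nondegenerate) {ε : k}
    (hε : ∀ x y, B x y = ε * B y x) (hε1 : (ε = 1 ∧ Even m) ∨ ε = -1) {U : Submodule k V}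
    (hdim : Module.finrank k U = m) :
    ∃ g ∈ skewAdjointInto B U, m ≤ Module.finrank k (LinearMap.range g) := by
  obtain ⟨π, hπ⟩ := exists_mem_grassmannianCell (⟨U, hdim⟩ : (grassmannianVariety k V m).carrier)
  obtain ⟨f, hf⟩ := exists_dual_tuple B hB π
  obtain ⟨s, hs, hdet⟩ := exists_matrix_symm_det_ne_zero hε1
  have hε2 : ε * ε = 1 := by
    rcases hε1 with ⟨rfl, -⟩ | rfl <;> simp
  have hdual : ∀ i j, B (cellBasis π ⟨U, hdim⟩ i) (f j) = if i = j then 1 else 0 := fun i j => by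
    rw [hf, map_cellBasis hπ, Pi.single_apply]
    simp only [eq_comm]
  refine ⟨gramEnd B (cellBasis π ⟨U, hdim⟩) s, ⟨gramEnd_mem_skewAdjoint hε _ hs, fun x => ?_⟩, ?_⟩
  · have := gramEnd_apply_mem B (cellBasis π ⟨U, hdim⟩) s x
    rwa [span_cellBasis hπ] at this
  · refine le_finrank_range_iff.2 ⟨f, π, ?_⟩
    -- The pairings with `f` are the coordinates of `π`, so the rank of the endomorphism is
    -- witnessed by the invertible matrix `s` itself, up to transposition.
    have : (Matrix.of fun i => π (gramEnd B (cellBasis π ⟨U, hdim⟩) s (f i))) = s.transpose := by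
      ext i j
      rw [Matrix.of_apply, ← hf, gramEnd_dual hdual, Matrix.transpose_apply]
    rwa [this, Matrix.det_transpose]

theorem isRegularAt_line {M : Type*} [AddCommGroup M] [Module k M] (x y : M) (t : k) :
    IsRegularAt (affineSpace k k) (fun t => x + t • (y - x)) t :=
  (IsRegularAt.const x).add ((IsRegularAt.affine_id t).smul (.const _))

/-- The line from `g` to an element `g₀` of rank `m` stays in the fibre, and rank at least `m` is an
open condition, so `g` is in the closure of the elements of rank `m` of this fibre, all of which
belong to the class. -/
theorem skewAdjointInto_subset_closure [Infinite k] (hB : B.Nondegenerate)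
    (hm : 2 * m ≤ Module.finrank k V) {ε : k}
    (hε : ∀ x y, B x y = ε * B y x) (hε1 : (ε = 1 ∧ Even m) ∨ ε = -1) {U : Submodule k V}
    (hdim : Module.finrank k U = m) (hU : ∀ x ∈ U, ∀ y ∈ U, B x y = 0)
    {g : Module.End k V} (hg : g ∈ skewAdjointInto B U) :
    g ∈ closure[(affineSpace k (Module.End k V)).top] (twoColumnClass B m) := by
  obtain ⟨g₀, hg₀, hr⟩ := exists_mem_skewAdjointInto hB hε hε1 hdim
  let A := (affineSpace k (Module.End k V)).sub (skewAdjointInto B U : Set (Module.End k V))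
  have hA : A.IsLocal := isLocal_affineSpace.sub _
  let γ : k → A.carrier := fun t =>
    ⟨g + t • (g₀ - g), add_mem hg (Submodule.smul_mem _ _ (sub_mem hg₀ hg))⟩
  have hγ : IsMorphism (affineSpace k k) A γ := isMorphism_iff.2 fun t =>
    .sub_mk ((isRegularAt_line g g₀ t).isMorphismAt isLocal_affineSpace)
  have hval : Continuous[A.top, (affineSpace k (Module.End k V)).top] (fun x : A.carrier => x.1) :=
    (isMorphism_iff.2 fun x => IsMorphismAt.val _ x : IsMorphism A _ _).continuous
  have hO : IsOpen[A.top] {x | m ≤ Module.finrank k (LinearMap.range x.1)} :=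
    @IsOpen.preimage _ _ A.top (affineSpace k _).top _ hval _ (isOpen_le_finrank_range m)
  have h0 := mem_closure_of_line hγ hO (by simpa [γ] using hr)
  have h1 := @map_mem_closure _ _ A.top (affineSpace k _).top _ _ _
    (twoColumnClass B m) hval h0 fun x hx => mem_twoColumnClass_of_le hB hm hdim hU x.2 hx
  simpa [γ] using h1

end Pairs

/-! ### The vector bundle structure. -/

section Bundle

open SpaceWithFunctions

variable {k : Type v} [Field k] {V : Type u} [AddCommGroup V] [Module k V]
  {B : LinearMap.BilinForm k V} {m : ℕ}

theorem twoColumnPairs_ext {p q : (twoColumnPairs B m).carrier} (h1 : p.1.1.1 = q.1.1.1)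
    (h2 : p.1.2.1.1 = q.1.2.1.1) : p = q :=
  Subtype.ext (Prod.ext (Subtype.ext h1) (Subtype.ext (Subtype.ext h2)))

/-- The pair `(g, U)`. -/
def twoColumnPair (hcl : ∀ U : (isotropicGrassmannian B m).carrier, ∀ g ∈ skewAdjointInto B U.1.1,
      g ∈ closure[(affineSpace k (Module.End k V)).top] (twoColumnClass B m))
    (U : (isotropicGrassmannian B m).carrier) (g : Module.End k V)
    (hg : g ∈ skewAdjointInto B U.1.1) : (twoColumnPairs B m).carrier :=
  ⟨(⟨g, hcl U g hg⟩, U), by rintro _ ⟨x, rfl⟩; exact hg.2 x⟩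

/-- The matrices with `s i j = -ε * s j i`. -/
def signedMatrices (ε : k) (m : ℕ) : Submodule k (Matrix (Fin m) (Fin m) k) where
  carrier := {s | ∀ i j, s i j = -ε * s j i}
  add_mem' := fun {s t} hs ht i j => by
    rw [Matrix.add_apply, Matrix.add_apply, hs, ht, mul_add]
  zero_mem' := fun i j => by simp
  smul_mem' := fun c s hs i j => by
    rw [Matrix.smul_apply, Matrix.smul_apply, hs i j, smul_eq_mul, smul_eq_mul]
    ring

/-- The matrix of the form `B (g ·) ·`. -/
def gramMatrix (B : LinearMap.BilinForm k V) (f : Fin m → V) :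
    Module.End k V →ₗ[k] Matrix (Fin m) (Fin m) k where
  toFun g := Matrix.of fun i j => B (g (f j)) (f i)
  map_add' g h := by ext; simp
  map_smul' c g := by ext; simp

theorem gramMatrix_mem {ε : k} (hε : ∀ x y, B x y = ε * B y x) {g : Module.End k V}
    (hg : g ∈ skewAdjointLieSubalgebra B) (f : Fin m → V) :
    gramMatrix B f g ∈ signedMatrices ε m := fun _ _ => skewAdjoint_gram_symm hε hg _ _

theorem gramEnd_mem_skewAdjointInto {ε : k} (hε : ∀ x y, B x y = ε * B y x)
    {b : Fin m → V} {U : Submodule k V} (hb : Submodule.span k (Set.range b) = U)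
    {s : Matrix (Fin m) (Fin m) k} (hs : s ∈ signedMatrices ε m) :
    gramEnd B b s ∈ skewAdjointInto B U :=
  ⟨gramEnd_mem_skewAdjoint hε b hs, fun x => hb ▸ gramEnd_apply_mem B b s x⟩

theorem dual_cellBasis {π : V →ₗ[k] (Fin m → k)} {f : Fin m → V} (hf : ∀ v j, B v (f j) = π v j)
    {U : (grassmannianVariety k V m).carrier} (hU : U ∈ grassmannianCell π) (i j : Fin m) :
    B (cellBasis π U i) (f j) = if i = j then 1 else 0 := by
  rw [hf, map_cellBasis hU, Pi.single_apply]
  simp only [eq_comm]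

variable [FiniteDimensional k V]

theorem isRegularAt_gramEnd {T : SpaceWithFunctions.{w} k} {b : T.carrier → Fin m → V}
    {s : T.carrier → Matrix (Fin m) (Fin m) k} {t : T.carrier} (hb : IsRegularAt T b t)
    (hs : ∀ i j, IsRegularAt T (fun t => s t i j) t) :
    IsRegularAt T (fun t => gramEnd B (b t) (s t)) t := by
  refine .hom fun x => ?_
  simp only [gramEnd_apply]
  exact .sum fun i _ => IsRegularAt.smul (.sum fun j _ => (hs i j).mul ((hb.apply j).linear (B.flip x)))
    (hb.apply i)

theorem isOpen_isotropicCell (π : V →ₗ[k] (Fin m → k)) :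
    IsOpen[(isotropicGrassmannian B m).top] {U | U.1 ∈ grassmannianCell π} :=
  @IsOpen.preimage _ _ (isotropicGrassmannian B m).top (grassmannianVariety k V m).top _
    (isMorphism_iff.2 fun U => IsMorphismAt.val _ U :
      IsMorphism (isotropicGrassmannian B m) (grassmannianVariety k V m) fun U => U.1).continuous _
    (isOpen_grassmannianCell π)

theorem isOpen_pairsCell (π : V →ₗ[k] (Fin m → k)) :
    IsOpen[(twoColumnPairs B m).top] {p | p.1.2.1 ∈ grassmannianCell π} :=
  @IsOpen.preimage _ _ (twoColumnPairs B m).top (isotropicGrassmannian B m).top _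
    (isMorphism_iff.2 isMorphismAt_pairs_isotropic).continuous _ (isOpen_isotropicCell π)

/-- Over the cell of `π` the Gram matrix with respect to the fixed tuple `f` trivializes the bundle;
the inverse rebuilds `g` from this matrix and the normalized basis of `U`. -/
theorem isVectorBundle_twoColumnPairs (hB : B.Nondegenerate) {ε : k}
    (hε : ∀ x y, B x y = ε * B y x)
    (hskew : ∀ p : (twoColumnPairs B m).carrier, p.1.1.1 ∈ skewAdjointInto B p.1.2.1.1)
    (hcl : ∀ U : (isotropicGrassmannian B m).carrier, ∀ g ∈ skewAdjointInto B U.1.1,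
      g ∈ closure[(affineSpace k (Module.End k V)).top] (twoColumnClass B m))
    (ι : ∀ U : (isotropicGrassmannian B m).carrier,
      {p : (twoColumnPairs B m).carrier // p.1.2 = U} ≃ skewAdjointInto B U.1.1)
    (hι : ∀ U p, (ι U p : Module.End k V) = p.1.1.1.1) :
    IsVectorBundle (twoColumnPairs B m) (isotropicGrassmannian B m)
      (fun p => p.1.2) (fun U => skewAdjointInto B U.1.1) ι := by
  refine ⟨isMorphism_iff.2 isMorphismAt_pairs_isotropic, fun U₀ => ?_⟩
  obtain ⟨π, hπ⟩ := exists_mem_grassmannianCell U₀.1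
  obtain ⟨f, hf⟩ := exists_dual_tuple B hB π
  let S := signedMatrices ε m
  let E : S ≃ₗ[k] (Fin (Module.finrank k S) → k) := (Module.finBasis k S).equivFun
  -- A linear retraction onto the matrices of the right symmetry makes the coordinates linear on all
  -- of `End V`, so that regularity and fibrewise linearity are immediate.
  obtain ⟨P, hP⟩ := S.subtype.exists_leftInverse_of_injective S.ker_subtype
  have hP : ∀ s (hs : s ∈ S), P s = ⟨s, hs⟩ := fun s hs => LinearMap.congr_fun hP ⟨s, hs⟩
  let W : Set (isotropicGrassmannian B m).carrier := {U | U.1 ∈ grassmannianCell π}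
  let ℓ : Module.End k V →ₗ[k] (Fin (Module.finrank k S) → k) :=
    E.toLinearMap ∘ₗ P ∘ₗ gramMatrix B f
  have hℓ : ∀ g (hg : g ∈ skewAdjointLieSubalgebra B), ℓ g = E ⟨_, gramMatrix_mem hε hg f⟩ :=
    fun g hg => congrArg E (hP _ _)
  let e : ↥((fun p : (twoColumnPairs B m).carrier => p.1.2) ⁻¹' W) ≃
      ↥W × (Fin (Module.finrank k S) → k) :=
    { toFun := fun q => (⟨q.1.1.2, q.2⟩, ℓ q.1.1.1.1)
      invFun := fun q => ⟨twoColumnPair hcl q.1.1 (gramEnd B (cellBasis π q.1.1.1) (E.symm q.2).1)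
        (gramEnd_mem_skewAdjointInto hε (span_cellBasis q.1.2) (E.symm q.2).2), q.1.2⟩
      left_inv := fun q => by
        refine Subtype.ext (twoColumnPairs_ext ?_ rfl)
        have h1 := hskew q.1
        change gramEnd B (cellBasis π q.1.1.2.1) (E.symm (ℓ q.1.1.1.1)).1 = q.1.1.1.1
        rw [hℓ _ h1.1, E.symm_apply_apply]
        refine eq_gramEnd hε (dual_cellBasis hf q.2) h1.1 fun x => ?_
        rw [span_cellBasis q.2]
        exact h1.2 x
      right_inv := fun q => by
        refine Prod.ext rfl ?_
        have h1 := gramEnd_mem_skewAdjointInto hε (span_cellBasis q.1.2) (E.symm q.2).2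
        change ℓ (gramEnd B (cellBasis π q.1.1.1) (E.symm q.2).1) = q.2
        rw [hℓ _ h1.1]
        refine E.eq_symm_apply.1 (Subtype.ext ?_)
        ext i j
        exact gramEnd_dual (dual_cellBasis hf q.1.2) _ i j }
  let T := ((isotropicGrassmannian B m).sub W).prod
    (affineSpace k (Fin (Module.finrank k S) → k))
  have hU : ∀ q, IsMorphismAt T (grassmannianVariety k V m) (fun q => q.1.1.1) q := fun q =>
    IsMorphismAt.comp (X := T) (Y := (isotropicGrassmannian B m).sub W) (f := fun q => q.1)
      (g := fun U => U.1.1) (IsMorphismAt.comp (X := (isotropicGrassmannian B m).sub W)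
        (Y := isotropicGrassmannian B m) (f := fun U => U.1) (g := fun U => U.1) (.val _ q.1.1)
        (.val _ q.1)) (.fst q)
  refine ⟨W, isOpen_isotropicCell π, hπ, _, e, .of_isMorphismAt (fun q => ?_) (fun q => ?_),
    fun p => rfl, fun U => ℓ ∘ₗ (skewAdjointInto B U.1.1).subtype, fun p => ?_⟩
  · have hloc : ((twoColumnPairs B m).sub ((fun p => p.1.2) ⁻¹' W)).IsLocal :=
      (isLocal_twoColumnPairs B m).sub _
    refine .prod_mk hloc (.sub_mk ?_) (IsRegularAt.isMorphismAt hloc ?_)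
    · exact (isMorphismAt_pairs_isotropic q.1).comp_val
    · exact ((isRegularAt_pairs q.1).comp (.val _ q)).linear ℓ
  · refine .sub_mk (isMorphismAt_pairs isLocal_prod (isRegularAt_gramEnd ?_ fun i j => ?_) ?_)
    · refine IsRegularAt.comp (X := T) (Y := grassmannianVariety k V m) (g := fun q => q.1.1.1)
        (isRegularAt_cellBasis q.1.2) ?_
      exact hU q
    · exact (IsMorphismAt.snd q).isRegularAt.linear
        (LinearMap.proj j ∘ₗ LinearMap.proj i ∘ₗ (Matrix.ofLinearEquiv k).symm.toLinearMap ∘ₗ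
          S.subtype ∘ₗ E.symm.toLinearMap)
    · exact hU q
  · exact congrArg ℓ (hι p.1.1.2 ⟨p.1, rfl⟩).symm

end Bundle

/-! ### Separatedness and affine covers. -/

section Variety

open SpaceWithFunctions

variable {k : Type v} [Field k]

theorem SpaceWithFunctions.isClosed_diagonal_of_injective {X : SpaceWithFunctions.{u} k}
    {M : Type w} [AddCommGroup M] [Module k M] {f : X.carrier → M} (hf : ∀ x, IsRegularAt X f x)
    (hinj : Function.Injective f) : IsClosed[(X.prod X).top] (Set.diagonal X.carrier) := by
  have h : ∀ p, IsRegularAt (X.prod X) (fun p => f p.1 - f p.2) p := fun p =>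
    ((hf p.1).comp (.fst p)).sub ((hf p.2).comp (.snd p))
  convert isClosed_eq_zero isLocal_prod h using 1
  ext p
  simp [sub_eq_zero, hinj.eq_iff]

theorem SpaceWithFunctions.isVariety_of_isClosed {M : Type w} [AddCommGroup M] [Module k M]
    [FiniteDimensional k M] {S : Set M} (hS : IsClosed[(affineSpace k M).top] S) :
    IsVariety ((affineSpace k M).sub S) := by
  refine ⟨⟨{Set.univ}, Set.finite_singleton _, by simp, ?_⟩, ?_⟩
  · rintro U rfl
    refine ⟨@isOpen_univ _ ((affineSpace k M).sub S).top, ?_⟩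
    refine (isAffineVariety_of_isClosed hS).of_isIsomorphism (e := Equiv.Set.univ _)
      (.of_isMorphismAt (fun x => .val _ x) fun x => .sub_mk (.id x))
  · exact isClosed_diagonal_of_injective (f := Subtype.val)
      (fun x => (IsMorphismAt.val S x).isRegularAt) Subtype.val_injective

variable {V : Type u} [AddCommGroup V] [Module k V] [FiniteDimensional k V]
  {B : LinearMap.BilinForm k V} {m : ℕ}

/-- Two different pairs are separated by the coordinates of `g`, or, if these agree, by a basis
vector of one subspace that is not in the other. -/
theorem isClosed_diagonal_pairs :
    IsClosed[((twoColumnPairs B m).prod (twoColumnPairs B m)).top]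
      (Set.diagonal (twoColumnPairs B m).carrier) := by
  let X := twoColumnPairs B m
  refine isClosed_diagonal_of_separating fun x y hxy => ?_
  suffices h : ∃ (M : Type u) (_ : AddCommGroup M) (_ : Module k M)
      (f : X.carrier × X.carrier → M), IsRegularAt (X.prod X) f (x, y) ∧ f (x, y) ≠ 0 ∧
        ∀ᶠ p in @nhds _ (X.prod X).top (x, y), p.1 = p.2 → f p = 0 by
    obtain ⟨M, _, _, f, hf, hne, hd⟩ := h
    obtain ⟨φ, hφ⟩ : ∃ φ : Module.Dual k M, φ (f (x, y)) ≠ 0 := by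
      by_contra! h'
      exact hne ((Module.forall_dual_apply_eq_zero_iff k _).1 h')
    exact ⟨_, hf φ, hφ, hd.mono fun p hp h => by rw [hp h, map_zero]⟩
  by_cases hg : x.1.1.1 = y.1.1.1
  · have hU : x.1.2.1.1 ≠ y.1.2.1.1 := fun h => hxy (twoColumnPairs_ext hg h)
    obtain ⟨π, hπ⟩ := exists_mem_grassmannianCell x.1.2.1
    obtain ⟨π', hπ'⟩ := exists_mem_grassmannianCell y.1.2.1
    obtain ⟨i, hi⟩ : ∃ i, cellBasis π x.1.2.1 i ∉ y.1.2.1.1 := by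
      by_contra! h
      refine hU (Submodule.eq_of_le_of_finrank_eq ?_ (x.1.2.1.2.trans y.1.2.1.2.symm))
      rw [← span_cellBasis hπ, Submodule.span_le]
      rintro _ ⟨i, rfl⟩
      exact h i
    have h1 : IsMorphismAt (X.prod X) (grassmannianVariety k V m) (fun p => p.1.1.2.1) (x, y) :=
      IsMorphismAt.comp (X := X.prod X) (Y := X) (f := fun p => p.1) (g := fun p => p.1.2.1)
        (isMorphismAt_pairs_grassmannian x) (.fst (x, y))
    have h2 : IsMorphismAt (X.prod X) (grassmannianVariety k V m) (fun p => p.2.1.2.1) (x, y) :=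
      IsMorphismAt.comp (X := X.prod X) (Y := X) (f := fun p => p.2) (g := fun p => p.1.2.1)
        (isMorphismAt_pairs_grassmannian y) (.snd (x, y))
    have hb : IsRegularAt (X.prod X) (fun p => cellBasis π p.1.1.2.1 i) (x, y) :=
      (IsRegularAt.comp (X := X.prod X) (g := fun p => p.1.1.2.1) (isRegularAt_cellBasis hπ) h1).apply i
    have hb' : ∀ j, IsRegularAt (X.prod X) (fun p => cellBasis π' p.2.1.2.1 j) (x, y) := fun j =>
      (IsRegularAt.comp (X := X.prod X) (g := fun p => p.2.1.2.1) (isRegularAt_cellBasis hπ') h2).apply j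
    -- This vector vanishes exactly when the `i`-th basis vector of the first subspace lies in the
    -- second one, as it does on the diagonal.
    refine ⟨V, inferInstance, inferInstance, fun p => cellBasis π p.1.1.2.1 i -
      ∑ j, π' (cellBasis π p.1.1.2.1 i) j • cellBasis π' p.2.1.2.1 j,
      hb.sub (.sum fun j _ => (hb.linear (LinearMap.proj j ∘ₗ π')).smul (hb' j)), ?_, ?_⟩
    · exact fun h => hi ((mem_iff_eq_sum_cellBasis hπ').2 h)
    · filter_upwards [h1.tendsto.eventually (@IsOpen.mem_nhds _ (grassmannianVariety k V m).top _ _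
          (isOpen_grassmannianCell π) hπ), h2.tendsto.eventually (@IsOpen.mem_nhds _
          (grassmannianVariety k V m).top _ _ (isOpen_grassmannianCell π') hπ')] with p h3 h4 h5
      refine (mem_iff_eq_sum_cellBasis h4).1 ?_
      rw [← h5]
      exact cellBasis_mem h3 i
  · refine ⟨Module.End k V, inferInstance, inferInstance, fun p => p.1.1.1.1 - p.2.1.1.1,
      ((isRegularAt_pairs x).comp (.fst (x, y))).sub ((isRegularAt_pairs y).comp (.snd (x, y))),
      sub_ne_zero.2 hg, Eventually.of_forall fun p hp => ?_⟩
    simp only [hp, sub_self]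

/-- A point of the cell amounts to `g` with the normalized basis of `U`; skewness, isotropy,
normalization and `g x = ∑ i, π (g x) i • b i` are polynomial equations in these. -/
theorem isAffineVariety_pairsCell
    (hskew : ∀ p : (twoColumnPairs B m).carrier, p.1.1.1 ∈ skewAdjointInto B p.1.2.1.1)
    (hcl : ∀ U : (isotropicGrassmannian B m).carrier, ∀ g ∈ skewAdjointInto B U.1.1,
      g ∈ closure[(affineSpace k (Module.End k V)).top] (twoColumnClass B m))
    (π : V →ₗ[k] (Fin m → k)) :
    IsAffineVariety ((twoColumnPairs B m).sub {p | p.1.2.1 ∈ grassmannianCell π}) := by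
  let A := affineSpace k (Module.End k V × (Fin m → V))
  let C : Set (Module.End k V × (Fin m → V)) :=
    (⋂ x, ⋂ y, {z | B (z.1 x) y + B x (z.1 y) = 0}) ∩
      (⋂ x, {z | z.1 x - ∑ i, π (z.1 x) i • z.2 i = 0}) ∩
      (⋂ i, {z | π (z.2 i) - Pi.single i 1 = 0}) ∩ ⋂ i, ⋂ j, {z | B (z.2 i) (z.2 j) = 0}
  have hg : ∀ x z, IsRegularAt A (fun z => z.1 x) z := fun x z =>
    (IsRegularAt.affine (LinearMap.fst k _ _) z).apply_hom x
  have hb : ∀ i z, IsRegularAt A (fun z => z.2 i) z := fun i z =>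
    (IsRegularAt.affine (LinearMap.snd k _ _) z).apply i
  have hC : IsClosed[A.top] C := by
    let _ := A.top
    refine IsClosed.inter (IsClosed.inter (IsClosed.inter ?_ ?_) ?_) ?_
    · exact isClosed_iInter fun x => isClosed_iInter fun y => isClosed_eq_zero isLocal_affineSpace
        fun z => ((hg x z).linear (B.flip y)).add ((hg y z).linear (B x))
    · exact isClosed_iInter fun x => isClosed_eq_zero isLocal_affineSpace
        fun z => (hg x z).sub (.sum fun i _ =>
          ((hg x z).linear (LinearMap.proj i ∘ₗ π)).smul (hb i z))
    · exact isClosed_iInter fun i => isClosed_eq_zero isLocal_affineSpace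
        fun z => ((hb i z).linear π).sub (.const _)
    · exact isClosed_iInter fun i => isClosed_iInter fun j => isClosed_eq_zero isLocal_affineSpace
        fun z => .bilin B (hb i z) (hb j z)
  have hmem : ∀ z : Module.End k V × (Fin m → V), z ∈ C ↔
      z.1 ∈ skewAdjointLieSubalgebra B ∧ (∀ x, z.1 x - ∑ i, π (z.1 x) i • z.2 i = 0) ∧
        (∀ i, π (z.2 i) = Pi.single i 1) ∧ ∀ i j, B (z.2 i) (z.2 j) = 0 := fun z => by
    simp only [C, Set.mem_inter_iff, Set.mem_iInter, Set.mem_ofPred_eq,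
      mem_skewAdjointLieSubalgebra, eq_neg_iff_add_eq_zero, sub_eq_zero, and_assoc]
  let span : C → (isotropicGrassmannian B m).carrier := fun z =>
    ⟨⟨Submodule.span k (Set.range z.1.2), by
      rw [finrank_span_eq_card (linearIndependent_of_map_eq_single ((hmem _).1 z.2).2.2.1),
        Fintype.card_fin]⟩, fun x hx y hy => by
      obtain ⟨a, rfl⟩ := (Submodule.mem_span_range_iff_exists_fun k).1 hx
      obtain ⟨c, rfl⟩ := (Submodule.mem_span_range_iff_exists_fun k).1 hy
      simp [((hmem _).1 z.2).2.2.2]⟩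
  have hspan : ∀ z : C, (span z).1 ∈ grassmannianCell π := fun z =>
    ⟨z.1.2, rfl, ((hmem _).1 z.2).2.2.1⟩
  have hbasis : ∀ z : C, cellBasis π (span z).1 = z.1.2 := fun z =>
    cellBasis_eq rfl ((hmem _).1 z.2).2.2.1
  have hinto : ∀ z : C, z.1.1 ∈ skewAdjointInto B (span z).1.1 := fun z =>
    ⟨((hmem _).1 z.2).1, fun x => (mem_iff_eq_sum_cellBasis (hspan z)).2 (by
      rw [hbasis]
      exact ((hmem _).1 z.2).2.1 x)⟩
  let e : ↥{p : (twoColumnPairs B m).carrier | p.1.2.1 ∈ grassmannianCell π} ≃ C :=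
    { toFun := fun p => ⟨(p.1.1.1.1, cellBasis π p.1.1.2.1), (hmem _).2 ⟨(hskew p.1).1,
        fun x => (mem_iff_eq_sum_cellBasis p.2).1 ((hskew p.1).2 x), map_cellBasis p.2,
        fun i j => p.1.1.2.2 _ (cellBasis_mem p.2 i) _ (cellBasis_mem p.2 j)⟩⟩
      invFun := fun z => ⟨twoColumnPair hcl (span z) z.1.1 (hinto z), hspan z⟩
      left_inv := fun p => Subtype.ext (twoColumnPairs_ext rfl (span_cellBasis p.2))
      right_inv := fun z => Subtype.ext (Prod.ext rfl (hbasis z)) }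
  let X := (twoColumnPairs B m).sub {p | p.1.2.1 ∈ grassmannianCell π}
  refine (isAffineVariety_of_isClosed hC).of_isIsomorphism (e := e)
    (.of_isMorphismAt (fun p => .sub_mk ?_) fun z => .sub_mk ?_)
  · refine IsRegularAt.isMorphismAt ((isLocal_twoColumnPairs B m).sub _) (.prod_mk ?_ ?_)
    · exact (isRegularAt_pairs p.1).comp (.val _ p)
    · exact IsRegularAt.comp (X := X) (Y := grassmannianVariety k V m) (g := fun p => p.1.1.2.1)
        (isRegularAt_cellBasis p.2) (IsMorphismAt.comp_val (isMorphismAt_pairs_grassmannian p.1))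
  · have hloc : (A.sub C).IsLocal := isLocal_affineSpace.sub _
    refine isMorphismAt_pairs hloc ?_ (isMorphismAt_grassmannian hloc (c := fun z => z.1.2) ?_
      (Eventually.of_forall fun z =>
        ⟨linearIndependent_of_map_eq_single ((hmem _).1 z.2).2.2.1, rfl⟩))
    · exact (IsMorphismAt.val C z).isRegularAt.linear (LinearMap.fst k (Module.End k V) (Fin m → V))
    · exact (IsMorphismAt.val C z).isRegularAt.linear (LinearMap.snd k (Module.End k V) (Fin m → V))

theorem isVariety_twoColumnPairs
    (hskew : ∀ p : (twoColumnPairs B m).carrier, p.1.1.1 ∈ skewAdjointInto B p.1.2.1.1)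
    (hcl : ∀ U : (isotropicGrassmannian B m).carrier, ∀ g ∈ skewAdjointInto B U.1.1,
      g ∈ closure[(affineSpace k (Module.End k V)).top] (twoColumnClass B m)) :
    IsVariety (twoColumnPairs B m) := by
  let v := Module.finBasis k V
  refine ⟨⟨Set.range fun φ : Fin m → Fin (Module.finrank k V) =>
    {p | p.1.2.1 ∈ grassmannianCell (coordinateMap v φ)}, Set.finite_range _, ?_, ?_⟩,
    isClosed_diagonal_pairs⟩
  · refine Set.eq_univ_of_forall fun p => ?_
    obtain ⟨φ, hφ⟩ := exists_mem_coordinateCell v p.1.2.1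
    exact ⟨_, ⟨φ, rfl⟩, hφ⟩
  · rintro _ ⟨φ, rfl⟩
    exact ⟨isOpen_pairsCell _, isAffineVariety_pairsCell hskew hcl _⟩

end Variety

/-! ### Charts of the isotropic Grassmannian and smoothness. -/

section Smooth

open SpaceWithFunctions

variable {k : Type v} [Field k] {V : Type u} [AddCommGroup V] [Module k V]

/-- The linear map with coordinates `B v (b j)`. -/
def pairing (B : LinearMap.BilinForm k V) {m : ℕ} (b : Fin m → V) : V →ₗ[k] (Fin m → k) :=
  LinearMap.pi fun j => B.flip (b j)

theorem pairing_apply (B : LinearMap.BilinForm k V) {m : ℕ} (b : Fin m → V) (v : V) (j : Fin m) :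
    pairing B b v j = B v (b j) := rfl

/-- The orthogonal complement of the span of `b` and `f`. -/
def orthogonalPair (B : LinearMap.BilinForm k V) {m : ℕ} (b f : Fin m → V) : Submodule k V :=
  LinearMap.ker (pairing B f) ⊓ LinearMap.ker (pairing B b)

variable {B : LinearMap.BilinForm k V} {m : ℕ} {b f : Fin m → V}

theorem mem_orthogonalPair {w : V} :
    w ∈ orthogonalPair B b f ↔ (∀ j, B w (f j) = 0) ∧ ∀ j, B w (b j) = 0 := by
  simp only [orthogonalPair, Submodule.mem_inf, LinearMap.mem_ker, funext_iff, pairing_apply,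
    Pi.zero_apply]

/-- The vectors `b i + w i + ∑ j, (c i j - B (w j) (w i) / 2) • f j`. -/
def isotropicChart (B : LinearMap.BilinForm k V) (b f : Fin m → V) (w : Fin m → V)
    (c : Matrix (Fin m) (Fin m) k) (i : Fin m) : V :=
  b i + w i + ∑ j, (c i j - (2 : k)⁻¹ * B (w j) (w i)) • f j

variable {ε : k}

theorem isotropicChart_pairing_right (hbf : ∀ i j, B (b i) (f j) = if i = j then 1 else 0)
    (hff : ∀ i j, B (f i) (f j) = 0) {w : Fin m → V} (hw : ∀ i, w i ∈ orthogonalPair B b f)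
    (c : Matrix (Fin m) (Fin m) k) (i j : Fin m) :
    B (isotropicChart B b f w c i) (f j) = if i = j then 1 else 0 := by
  simp [isotropicChart, LinearMap.sum_apply, hbf, hff, (mem_orthogonalPair.1 (hw i)).1]

/-- Pairing with `b` reads off the coefficients of `f`, since `b` is isotropic and orthogonal to
`w`. -/
theorem isotropicChart_pairing_left (hε : ∀ x y, B x y = ε * B y x) (hε2 : ε * ε = 1)
    (hbf : ∀ i j, B (b i) (f j) = if i = j then 1 else 0) (hbb : ∀ i j, B (b i) (b j) = 0)
    {w : Fin m → V} (hw : ∀ i, w i ∈ orthogonalPair B b f)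
    (c : Matrix (Fin m) (Fin m) k) (i j : Fin m) :
    ε * B (isotropicChart B b f w c i) (b j) = c i j - (2 : k)⁻¹ * B (w j) (w i) := by
  have hfb : ∀ i j, B (f i) (b j) = if j = i then ε else 0 := fun i j => by
    rw [hε, hbf]
    split_ifs <;> simp
  simp only [isotropicChart, map_add, LinearMap.add_apply, hbb, (mem_orthogonalPair.1 (hw i)).2,
    map_sum, LinearMap.sum_apply, map_smul, LinearMap.smul_apply, hfb, smul_eq_mul, mul_ite,
    mul_zero, Finset.sum_ite_eq, Finset.mem_univ, if_true, zero_add]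
  rw [mul_left_comm, hε2, mul_one]

/-- The two quadratic corrections add up to `-B (w i) (w j)`, which cancels the contribution of `w`.
What remains is `ε * c i j + c j i`, zero by the symmetry of `c`. -/
theorem isotropicChart_isotropic (h2 : (2 : k) ≠ 0) (hε : ∀ x y, B x y = ε * B y x)
    (hε2 : ε * ε = 1) (hbf : ∀ i j, B (b i) (f j) = if i = j then 1 else 0)
    (hbb : ∀ i j, B (b i) (b j) = 0) (hff : ∀ i j, B (f i) (f j) = 0)
    {w : Fin m → V} (hw : ∀ i, w i ∈ orthogonalPair B b f)
    {c : Matrix (Fin m) (Fin m) k} (hc : c ∈ signedMatrices ε m) (i j : Fin m) :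
    B (isotropicChart B b f w c i) (isotropicChart B b f w c j) = 0 := by
  have h1 := isotropicChart_pairing_left hε hε2 hbf hbb hw c i j
  have hfw : ∀ i j, B (f i) (w j) = 0 := fun i j => by
    rw [hε, (mem_orthogonalPair.1 (hw j)).1, mul_zero]
  have hbw : ∀ i j, B (b i) (w j) = 0 := fun i j => by
    rw [hε, (mem_orthogonalPair.1 (hw j)).2, mul_zero]
  have h2' : B (isotropicChart B b f w c i) (w j) = B (w i) (w j) := by
    simp [isotropicChart, LinearMap.sum_apply, hfw, hbw]
  have h3 : B (isotropicChart B b f w c i) (isotropicChart B b f w c j) =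
      B (isotropicChart B b f w c i) (b j) + B (isotropicChart B b f w c i) (w j) +
        ∑ l, (c j l - (2 : k)⁻¹ * B (w l) (w j)) * B (isotropicChart B b f w c i) (f l) := by
    conv_lhs => rw [isotropicChart.eq_def B b f w c j]
    simp only [map_add, map_sum, map_smul, smul_eq_mul]
  simp only [isotropicChart_pairing_right hbf hff hw] at h3
  simp only [mul_ite, mul_one, mul_zero, Finset.sum_ite_eq, Finset.mem_univ, if_true] at h3
  have h4 : B (isotropicChart B b f w c i) (b j) =
      ε * (c i j - (2 : k)⁻¹ * B (w j) (w i)) := by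
    rw [← h1, ← mul_assoc, hε2, one_mul]
  rw [h3, h4, h2', hc j i, mul_sub, mul_left_comm, ← hε (w i) (w j)]
  field_simp
  ring

/-- The component orthogonal to `b` and `f`. -/
def orthogonalPart (B : LinearMap.BilinForm k V) (ε : k) (b f : Fin m → V) : V →ₗ[k] V :=
  LinearMap.id - (∑ j, (B.flip (f j)).smulRight (b j)) - ε • ∑ j, (B.flip (b j)).smulRight (f j)

theorem orthogonalPart_apply (v : V) : orthogonalPart B ε b f v =
    v - ∑ j, B v (f j) • b j - ∑ j, (ε * B v (b j)) • f j := by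
  simp [orthogonalPart, LinearMap.sum_apply, Finset.smul_sum, mul_smul]

theorem orthogonalPart_mem (hε : ∀ x y, B x y = ε * B y x) (hε2 : ε * ε = 1)
    (hbf : ∀ i j, B (b i) (f j) = if i = j then 1 else 0) (hbb : ∀ i j, B (b i) (b j) = 0)
    (hff : ∀ i j, B (f i) (f j) = 0) (v : V) :
    orthogonalPart B ε b f v ∈ orthogonalPair B b f := by
  have hfb : ∀ i j, B (f i) (b j) = if j = i then ε else 0 := fun i j => by
    rw [hε, hbf]
    split_ifs <;> simp
  refine mem_orthogonalPair.2 ⟨fun l => ?_, fun l => ?_⟩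
  · simp [orthogonalPart_apply, LinearMap.sum_apply, hbf, hff]
  · simp only [orthogonalPart_apply, map_sub, map_sum, map_smul, LinearMap.sub_apply,
      LinearMap.sum_apply, LinearMap.smul_apply, hbb, hfb, smul_eq_mul, mul_zero,
      Finset.sum_const_zero, sub_zero, mul_ite, Finset.sum_ite_eq, Finset.mem_univ, if_true]
    rw [mul_right_comm, hε2, one_mul, sub_self]

theorem orthogonalPart_isotropicChart (hε : ∀ x y, B x y = ε * B y x) (hε2 : ε * ε = 1)
    (hbf : ∀ i j, B (b i) (f j) = if i = j then 1 else 0) (hbb : ∀ i j, B (b i) (b j) = 0)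
    (hff : ∀ i j, B (f i) (f j) = 0) {w : Fin m → V} (hw : ∀ i, w i ∈ orthogonalPair B b f)
    (c : Matrix (Fin m) (Fin m) k) (i : Fin m) :
    orthogonalPart B ε b f (isotropicChart B b f w c i) = w i := by
  rw [orthogonalPart_apply]
  simp only [isotropicChart_pairing_right hbf hff hw,
    isotropicChart_pairing_left hε hε2 hbf hbb hw]
  simp only [isotropicChart, ite_smul, one_smul, zero_smul, Finset.sum_ite_eq, Finset.mem_univ,
    if_true]
  abel

/-- The matrix `c` for which a normalized isotropic tuple `b'` is the value of the chart. -/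
def isotropicChartMatrix (B : LinearMap.BilinForm k V) (ε : k) (b f b' : Fin m → V) :
    Matrix (Fin m) (Fin m) k :=
  Matrix.of fun i j => ε * B (b' i) (b j) +
    (2 : k)⁻¹ * B (orthogonalPart B ε b f (b' j)) (orthogonalPart B ε b f (b' i))

theorem isotropicChart_eq {b' : Fin m → V}
    (hb' : ∀ i j, B (b' i) (f j) = if i = j then 1 else 0) (i : Fin m) :
    isotropicChart B b f (fun i => orthogonalPart B ε b f (b' i))
      (isotropicChartMatrix B ε b f b') i = b' i := by
  simp only [isotropicChart, isotropicChartMatrix, Matrix.of_apply, add_sub_cancel_right]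
  rw [orthogonalPart_apply]
  simp only [hb', ite_smul, one_smul, zero_smul, Finset.sum_ite_eq, Finset.mem_univ, if_true]
  abel

/-- The converse computation: expanding `B (b' j) (b' i) = 0` along the decomposition of `b' i` into
its components along `b`, orthogonal to both tuples, and along `f` gives the symmetry of `c`. -/
theorem isotropicChartMatrix_mem (h2 : (2 : k) ≠ 0) (hε : ∀ x y, B x y = ε * B y x)
    (hε2 : ε * ε = 1) (hbf : ∀ i j, B (b i) (f j) = if i = j then 1 else 0)
    (hbb : ∀ i j, B (b i) (b j) = 0) (hff : ∀ i j, B (f i) (f j) = 0) {b' : Fin m → V}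
    (hb' : ∀ i j, B (b' i) (f j) = if i = j then 1 else 0) (hb'' : ∀ i j, B (b' i) (b' j) = 0) :
    isotropicChartMatrix B ε b f b' ∈ signedMatrices ε m := by
  intro i j
  have hw := fun v => mem_orthogonalPair.1 (orthogonalPart_mem hε hε2 hbf hbb hff v)
  have hfw : ∀ i v, B (f i) (orthogonalPart B ε b f v) = 0 := fun i v => by
    rw [hε, (hw v).1, mul_zero]
  have hbw : ∀ i v, B (b i) (orthogonalPart B ε b f v) = 0 := fun i v => by
    rw [hε, (hw v).2, mul_zero]
  have hdec : ∀ i, b' i = b i + orthogonalPart B ε b f (b' i) + ∑ l, (ε * B (b' i) (b l)) • f l :=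
    fun i => by
      rw [orthogonalPart_apply]
      simp only [hb', ite_smul, one_smul, zero_smul, Finset.sum_ite_eq, Finset.mem_univ, if_true]
      abel
  have h3 : B (b' j) (orthogonalPart B ε b f (b' i)) =
      B (orthogonalPart B ε b f (b' j)) (orthogonalPart B ε b f (b' i)) := by
    conv_lhs => rw [hdec j]
    simp only [map_add, map_sum, map_smul, LinearMap.add_apply, LinearMap.sum_apply,
      LinearMap.smul_apply, hfw, hbw, smul_zero, Finset.sum_const_zero, add_zero, zero_add]
  have h4 : B (b' j) (b i) + B (b' j) (orthogonalPart B ε b f (b' i)) + ε * B (b' i) (b j) = 0 := by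
    rw [← hb'' j i]
    conv_rhs => rw [hdec i]
    simp [hb']
  rw [h3] at h4
  have h5 := hε (orthogonalPart B ε b f (b' j)) (orthogonalPart B ε b f (b' i))
  simp only [isotropicChartMatrix, Matrix.of_apply]
  have h6 : ε * B (b' i) (b j) = -(B (b' j) (b i) +
      B (orthogonalPart B ε b f (b' j)) (orthogonalPart B ε b f (b' i))) := by
    linear_combination h4
  rw [h6, mul_add, ← mul_assoc, neg_mul, hε2, mul_left_comm, neg_mul, neg_mul, ← h5]
  field_simp
  ring

variable [FiniteDimensional k V]

/-- The parameters `w`, `c` and the Gram matrix of `g` identify the cell around the given pair with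
the vector space `W ^ m × S × S`. -/
theorem isSmooth_twoColumnPairs [Infinite k] (h2 : (2 : k) ≠ 0) (hB : B.Nondegenerate)
    (hε : ∀ x y, B x y = ε * B y x) (hε2 : ε * ε = 1)
    (hskew : ∀ p : (twoColumnPairs B m).carrier, p.1.1.1 ∈ skewAdjointInto B p.1.2.1.1)
    (hcl : ∀ U : (isotropicGrassmannian B m).carrier, ∀ g ∈ skewAdjointInto B U.1.1,
      g ∈ closure[(affineSpace k (Module.End k V)).top] (twoColumnClass B m)) :
    IsSmooth (twoColumnPairs B m) := by
  intro x
  obtain ⟨π₀, hπ₀⟩ := exists_mem_grassmannianCell x.1.2.1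
  obtain ⟨f₀, hf₀⟩ := exists_dual_tuple B hB π₀
  obtain ⟨b, hbU, hbf₀, hbb⟩ : ∃ b : Fin m → V, Submodule.span k (Set.range b) = x.1.2.1.1 ∧
      (∀ i j, B (b i) (f₀ j) = if i = j then 1 else 0) ∧ ∀ i j, B (b i) (b j) = 0 :=
    ⟨_, span_cellBasis hπ₀, dual_cellBasis hf₀ hπ₀, fun i j =>
      x.1.2.2 _ (cellBasis_mem hπ₀ i) _ (cellBasis_mem hπ₀ j)⟩
  -- The chart requires `f` to be isotropic, so the cell first chosen is replaced by the cell of the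
  -- pairing with the corrected tuple.
  obtain ⟨f, hbf, hff⟩ := exists_isotropic_dual h2 hε hbf₀ hbb
  let π := pairing B f
  have hxπ : x.1.2.1 ∈ grassmannianCell π := ⟨b, hbU, fun i => by
    ext j
    simp only [π, pairing_apply, hbf, Pi.single_apply, eq_comm]⟩
  have hdual : ∀ {U : (grassmannianVariety k V m).carrier}, U ∈ grassmannianCell π → ∀ i j,
      B (cellBasis π U i) (f j) = if i = j then 1 else 0 := fun hU i j =>
    dual_cellBasis (fun _ _ => rfl) hU i j
  let S := signedMatrices ε m
  let W := orthogonalPair B b f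
  let PW : V →ₗ[k] W := (orthogonalPart B ε b f).codRestrict W
    (orthogonalPart_mem hε hε2 hbf hbb hff)
  obtain ⟨P, hP⟩ := S.subtype.exists_leftInverse_of_injective S.ker_subtype
  have hP : ∀ s (hs : s ∈ S), P s = ⟨s, hs⟩ := fun s hs => LinearMap.congr_fun hP ⟨s, hs⟩
  let M := (Fin m → W) × S × S
  let β : M → Fin m → V := fun z => isotropicChart B b f (fun i => z.1 i) z.2.1
  have hβ : ∀ z i j, B (β z i) (f j) = if i = j then 1 else 0 := fun z i j =>
    isotropicChart_pairing_right hbf hff (fun i => (z.1 i).2) z.2.1 i j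
  have hβπ : ∀ z i, π (β z i) = Pi.single i 1 := fun z i => by
    ext j
    rw [pairing_apply, hβ, Pi.single_apply]
    simp only [eq_comm]
  let Uβ : M → (isotropicGrassmannian B m).carrier := fun z =>
    ⟨⟨Submodule.span k (Set.range (β z)), by
      rw [finrank_span_eq_card (linearIndependent_of_map_eq_single (hβπ z)),
        Fintype.card_fin]⟩, fun x hx y hy => by
      obtain ⟨a, rfl⟩ := (Submodule.mem_span_range_iff_exists_fun k).1 hx
      obtain ⟨c, rfl⟩ := (Submodule.mem_span_range_iff_exists_fun k).1 hy
      have := isotropicChart_isotropic h2 hε hε2 hbf hbb hff (fun i => (z.1 i).2) z.2.1.2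
      simp only [map_sum, map_smul, LinearMap.sum_apply, LinearMap.smul_apply, β, this, smul_zero,
        Finset.sum_const_zero]⟩
  let G : M → (twoColumnPairs B m).carrier := fun z =>
    twoColumnPair hcl (Uβ z) (gramEnd B (β z) z.2.2.1)
      (gramEnd_mem_skewAdjointInto hε rfl z.2.2.2)
  have hcell : ∀ z, cellBasis π (Uβ z).1 = β z := fun z => cellBasis_eq rfl (hβπ z)
  -- Defined on all pairs thanks to the default value of `cellBasis` and the retractions `PW` and
  -- `P`; only on the cell is it inverse to `G`.
  let F : (twoColumnPairs B m).carrier → M := fun p =>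
    (fun i => PW (cellBasis π p.1.2.1 i),
      P (isotropicChartMatrix B ε b f (cellBasis π p.1.2.1)), P (gramMatrix B f p.1.1.1))
  have hβreg : ∀ z, IsRegularAt (affineSpace k M) β z := by
    intro z
    have hw : ∀ i, IsRegularAt (affineSpace k M) (fun z => (z.1 i : V)) z := fun i =>
      IsRegularAt.affine (W.subtype ∘ₗ LinearMap.proj (φ := fun _ : Fin m => W) i ∘ₗ
        LinearMap.fst k (Fin m → W) (S × S)) z
    have hc : ∀ i j, IsRegularAt (affineSpace k M) (fun z => z.2.1.1 i j) z := fun i j =>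
      IsRegularAt.affine (LinearMap.proj j ∘ₗ LinearMap.proj i ∘ₗ
        (Matrix.ofLinearEquiv k).symm.toLinearMap ∘ₗ S.subtype ∘ₗ LinearMap.fst k _ _ ∘ₗ
        LinearMap.snd k (Fin m → W) (S × S)) z
    exact .pi fun i => ((IsRegularAt.const _).add (hw i)).add (.sum fun j _ =>
      ((hc i j).sub ((IsRegularAt.const _).mul (.bilin B (hw j) (hw i)))).smul (.const _))
  have hG : IsMorphism (affineSpace k M) (twoColumnPairs B m) G := by
    refine isMorphism_iff.2 fun z => isMorphismAt_pairs isLocal_affineSpace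
      (isRegularAt_gramEnd (hβreg z) fun i j => ?_)
      (isMorphismAt_grassmannian isLocal_affineSpace (hβreg z) (Eventually.of_forall fun z =>
        ⟨linearIndependent_of_map_eq_single (hβπ z), rfl⟩))
    exact IsRegularAt.affine (LinearMap.proj j ∘ₗ LinearMap.proj i ∘ₗ
      (Matrix.ofLinearEquiv k).symm.toLinearMap ∘ₗ S.subtype ∘ₗ LinearMap.snd k _ _ ∘ₗ
      LinearMap.snd k (Fin m → W) (S × S)) z
  have hF : IsMorphismAt (twoColumnPairs B m) (affineSpace k M) F x := by
    have hcb : ∀ i, IsRegularAt (twoColumnPairs B m) (fun p => cellBasis π p.1.2.1 i) x := fun i =>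
      (IsRegularAt.comp (X := twoColumnPairs B m) (g := fun p => p.1.2.1)
        (isRegularAt_cellBasis hxπ) (isMorphismAt_pairs_grassmannian x)).apply i
    refine IsRegularAt.isMorphismAt (isLocal_twoColumnPairs B m)
      (.prod_mk (.pi fun i => (hcb i).linear PW) (.prod_mk (.linear ?_ P) ?_))
    · refine .pi fun i => .pi fun j => ((IsRegularAt.const _).mul ((hcb i).linear (B.flip (b j)))).add
        ((IsRegularAt.const _).mul (.bilin B ((hcb j).linear _) ((hcb i).linear _)))
    · exact (isRegularAt_pairs x).linear (P ∘ₗ gramMatrix B f)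
  refine isRegularLocalRing_stalk hF hG ?_ fun z => ?_
  · have hopen := @IsOpen.mem_nhds _ (twoColumnPairs B m).top _ _ (isOpen_pairsCell π) hxπ
    filter_upwards [hopen] with p hp
    have hp : p.1.2.1 ∈ grassmannianCell π := hp
    have hmat := isotropicChartMatrix_mem h2 hε hε2 hbf hbb hff (hdual hp)
      fun i j => p.1.2.2 _ (cellBasis_mem hp i) _ (cellBasis_mem hp j)
    have hβF : β (F p) = cellBasis π p.1.2.1 := by
      funext i
      simp only [β, F, hP _ hmat]
      exact isotropicChart_eq (hdual hp) i
    refine twoColumnPairs_ext ?_ ?_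
    · change gramEnd B (β (F p)) (P (gramMatrix B f p.1.1.1)).1 = p.1.1.1
      rw [hβF, hP _ (gramMatrix_mem hε (hskew p).1 f)]
      refine eq_gramEnd hε (hdual hp) (hskew p).1 fun x => ?_
      rw [span_cellBasis hp]
      exact (hskew p).2 x
    · change Submodule.span k (Set.range (β (F p))) = _
      rw [hβF, span_cellBasis hp]
  · have hw := fun i => (z.1 i).2
    have horth : ∀ i, orthogonalPart B ε b f (β z i) = z.1 i :=
      orthogonalPart_isotropicChart hε hε2 hbf hbb hff hw z.2.1.1
    have hmat : isotropicChartMatrix B ε b f (β z) = z.2.1 := by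
      ext i j
      simp only [isotropicChartMatrix, Matrix.of_apply, horth]
      rw [isotropicChart_pairing_left hε hε2 hbf hbb hw, sub_add_cancel]
    have hgram : gramMatrix B f (gramEnd B (β z) z.2.2.1) = z.2.2 := by
      ext i j
      exact gramEnd_dual (hβ z) _ i j
    refine Prod.ext (funext fun i => Subtype.ext ?_) (Prod.ext ?_ ?_)
    · change orthogonalPart B ε b f (cellBasis π (Uβ z).1 i) = z.1 i
      rw [hcell, horth]
    · change P (isotropicChartMatrix B ε b f (cellBasis π (Uβ z).1)) = z.2.1
      rw [hcell, hmat, hP _ z.2.1.2]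
    · change P (gramMatrix B f (gramEnd B (β z) z.2.2.1)) = z.2.2
      rw [hgram, hP _ z.2.2.2]

end Smooth

open SpaceWithFunctions

/-! ### Properness, birationality and the conclusion. -/

section Resolution

variable {k : Type v} [Field k] {V : Type u} [AddCommGroup V] [Module k V] [FiniteDimensional k V]
  {B : LinearMap.BilinForm k V} {m : ℕ}

theorem exists_linearIndependent_span_eq (U : (grassmannianVariety k V m).carrier) :
    ∃ b : Fin m → V, LinearIndependent k b ∧ Submodule.span k (Set.range b) = U.1 := by
  obtain ⟨π, hπ⟩ := exists_mem_grassmannianCell U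
  exact ⟨_, linearIndependent_of_map_eq_single (map_cellBasis hπ), span_cellBasis hπ⟩

/-- The part over an affine variety `S` of the image of a closed subset of a base change of the
projection to the closure of the class is closed. -/
theorem isClosed_image_of_affine [IsAlgClosed k] {T : SpaceWithFunctions.{u} k}
    {h : T.carrier → (twoColumnClosure B m).carrier} (hh : IsMorphism T (twoColumnClosure B m) h)
    {Z : Set {p : (twoColumnPairs B m).carrier × T.carrier | p.1.1.1 = h p.2}}
    (hZ : IsClosed[(((twoColumnPairs B m).prod T).sub {p | p.1.1.1 = h p.2}).top] Z)
    {n : ℕ} {S : Set (Fin n → k)} (hS : IsClosed[(affineSpace k (Fin n → k)).top] S)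
    {τ : S → T.carrier} (hτ : IsMorphism ((affineSpace k (Fin n → k)).sub S) T τ) :
    IsClosed[((affineSpace k (Fin n → k)).sub S).top]
      (τ ⁻¹' ((fun p => p.1.2) '' Z)) := by
  let N := (Fin m → V) × (Fin n → k)
  -- Subspaces are replaced by linearly independent tuples, so that the fibre product can be studied
  -- inside an affine space.
  let A := (affineSpace k N).sub {z | LinearIndependent k z.1 ∧ z.2 ∈ S}
  have hA : A.IsLocal := isLocal_affineSpace.sub _
  let σ : A.carrier → (grassmannianVariety k V m).carrier := fun z =>
    ⟨Submodule.span k (Set.range z.1.1), by rw [finrank_span_eq_card z.2.1, Fintype.card_fin]⟩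
  let ρ : A.carrier → T.carrier := fun z => τ ⟨z.1.2, z.2.2⟩
  have hval : ∀ z, IsRegularAt A (fun z => z.1) z := fun z =>
    (IsMorphismAt.val (X := affineSpace k N) _ z).isRegularAt
  have hσ : ∀ z, IsMorphismAt A (grassmannianVariety k V m) σ z := fun z =>
    isMorphismAt_grassmannian hA ((hval z).linear (LinearMap.fst k (Fin m → V) (Fin n → k)))
      (Eventually.of_forall fun z => ⟨z.2.1, rfl⟩)
  have hρ : ∀ z, IsMorphismAt A T ρ z := fun z =>
    IsMorphismAt.comp (X := A) (Y := (affineSpace k (Fin n → k)).sub S) (Z := T) (g := τ)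
      (f := fun z => ⟨z.1.2, z.2.2⟩) (hτ.at _)
      (.sub_mk (((hval z).linear (LinearMap.snd k (Fin m → V) (Fin n → k))).isMorphismAt hA))
  have hγ : ∀ z, IsRegularAt A (fun z => (h (ρ z)).1) z := fun z =>
    IsRegularAt.comp (X := A) (Y := twoColumnClosure B m) (f := fun q => q.1)
      (g := fun z => h (ρ z)) (isRegularAt_closure _)
      (IsMorphismAt.comp (X := A) (Y := T) (g := h) (f := ρ) (hh.at _) (hρ z))
  -- The tuples over `S` whose span completes `h (ρ z)` to a point of the space of pairs; on them
  -- `Ψ` is the map to the fibre product.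
  let K : Set A.carrier := {z | ∀ x ∈ (σ z).1, ∀ y ∈ (σ z).1, B x y = 0} ∩
    {z | LinearMap.range (h (ρ z)).1 ≤ (σ z).1}
  have hK : IsClosed[A.top] K := @IsClosed.inter _ _ _ A.top (isClosed_isotropic B hA hσ)
    (isClosed_range_le_grassmannian hA hσ hγ)
  let Ψ : K → {p : (twoColumnPairs B m).carrier × T.carrier | p.1.1.1 = h p.2} := fun z =>
    ⟨(⟨(h (ρ z.1), ⟨σ z.1, z.2.1⟩), z.2.2⟩, ρ z.1), rfl⟩
  have hΨ : IsMorphism (A.sub K) (((twoColumnPairs B m).prod T).sub {p | p.1.1.1 = h p.2}) Ψ :=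
    isMorphism_iff.2 fun z => .sub_mk (.prod_mk (hA.sub K)
      (isMorphismAt_pairs (hA.sub K)
        (IsRegularAt.comp (X := A.sub K) (Y := A) (f := fun z => (h (ρ z)).1) (hγ z.1)
          (IsMorphismAt.val K z)) ((hσ z.1).comp_val))
      ((hρ z.1).comp_val))
  -- The preimage of `Z` is closed in `K`, which is closed in `A`; it is therefore cut out in `A` by
  -- a closed subset of the affine space.
  obtain ⟨C₁, hC₁, hC₁Z⟩ := (@isClosed_induced_iff _ _ A.top _ Subtype.val).1
    (@IsClosed.preimage _ _ (A.sub K).top (((twoColumnPairs B m).prod T).sub _).top _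
      hΨ.continuous _ hZ)
  obtain ⟨C, hC, hCC₁⟩ := (@isClosed_induced_iff _ _ (affineSpace k N).top _ Subtype.val).1
    (@IsClosed.inter _ _ _ A.top hC₁ hK)
  have hmem : ∀ z : A.carrier, z.1 ∈ C ↔ ∃ p ∈ Z, p.1.1.1.2.1 = σ z ∧ p.1.2 = ρ z := by
    intro z
    change z ∈ Subtype.val ⁻¹' C ↔ _
    rw [hCC₁]
    constructor
    · rintro ⟨h1, h2⟩
      have h3 : (⟨z, h2⟩ : K) ∈ Subtype.val ⁻¹' C₁ := h1
      rw [hC₁Z] at h3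
      exact ⟨_, h3, rfl, rfl⟩
    · rintro ⟨p, hp, h1, h2⟩
      have hzK : z ∈ K := by
        refine ⟨?_, ?_⟩
        · change ∀ x ∈ (σ z).1, ∀ y ∈ (σ z).1, B x y = 0
          rw [← h1]
          exact p.1.1.1.2.2
        · change LinearMap.range (h (ρ z)).1 ≤ (σ z).1
          rw [← h1, ← h2, ← show p.1.1.1.1 = h p.1.2 from p.2]
          exact p.1.1.2
      refine ⟨?_, hzK⟩
      change (⟨z, hzK⟩ : K) ∈ Subtype.val ⁻¹' C₁
      rw [hC₁Z]
      have : Ψ ⟨z, hzK⟩ = p := by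
        refine Subtype.ext (Prod.ext (twoColumnPairs_ext ?_ ?_) h2.symm)
        · change (h (ρ z)).1 = p.1.1.1.1.1
          rw [← h2, ← show p.1.1.1.1 = h p.1.2 from p.2]
        · exact congrArg Subtype.val h1.symm
      change Ψ _ ∈ Z
      rwa [this]
  -- The set `C` is controlled only over `S`. Its dependent tuples are arbitrary, but completeness
  -- of the Grassmannian ignores them.
  let Z₁ : Set N := C ∩ {z | z.2 ∈ S}
  have hZ₁ : IsClosed[(affineSpace k N).top] Z₁ := by
    have hsnd : IsMorphism (affineSpace k N) (affineSpace k (Fin n → k)) (fun z => z.2) :=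
      isMorphism_iff.2 fun z => (IsRegularAt.affine (LinearMap.snd k (Fin m → V) (Fin n → k))
        z).isMorphismAt isLocal_affineSpace
    exact @IsClosed.inter _ _ _ (affineSpace k N).top hC
      (@IsClosed.preimage _ _ (affineSpace k N).top (affineSpace k (Fin n → k)).top _
        hsnd.continuous _ hS)
  have hR := isClosed_exists_linearIndependent hZ₁ (by
    rintro b b' s hb hb' hbb ⟨h1, h2⟩
    refine ⟨?_, h2⟩
    have hσσ : σ ⟨(b, s), hb, h2⟩ = σ ⟨(b', s), hb', h2⟩ := Subtype.ext hbb
    obtain ⟨p, hp, h3, h4⟩ := (hmem ⟨(b, s), hb, h2⟩).1 h1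
    exact (hmem ⟨(b', s), hb', h2⟩).2 ⟨p, hp, h3.trans hσσ, h4⟩)
  refine (@isClosed_induced_iff _ _ (affineSpace k (Fin n → k)).top _ Subtype.val).2 ⟨_, hR, ?_⟩
  ext s
  constructor
  · rintro ⟨b, hb, h1, h2⟩
    obtain ⟨p, hp, h3, h4⟩ := (hmem ⟨(b, s.1), hb, h2⟩).1 h1
    exact ⟨p, hp, h4⟩
  · rintro ⟨p, hp, h1⟩
    obtain ⟨b, hb, hbU⟩ := exists_linearIndependent_span_eq p.1.1.1.2.1
    exact ⟨b, hb, (hmem ⟨(b, s.1), hb, s.2⟩).2 ⟨p, hp, Subtype.ext hbU.symm, h1⟩, s.2⟩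

/-- Closedness can be tested on the affine open sets that cover the base. -/
theorem isProperMorphism_twoColumnPairs [IsAlgClosed k] :
    IsProperMorphism (twoColumnPairs B m) (twoColumnClosure B m) (fun p => p.1.1) := by
  refine ⟨isMorphism_iff.2 isMorphismAt_pairs_closure, fun T hT h hh Z hZ => ?_⟩
  obtain ⟨𝒰, -, h𝒰, haff⟩ := hT.exists_affine_cover
  let _ := T.top
  refine isOpen_compl_iff.1 (isOpen_iff_mem_nhds.2 fun t ht => ?_)
  obtain ⟨U, hU, htU⟩ := Set.mem_sUnion.1 (h𝒰 ▸ Set.mem_univ t)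
  obtain ⟨hUo, n, S, hS, e, he⟩ := haff U hU
  have hcl := isClosed_image_of_affine hh hZ hS (τ := fun s => (e.symm s).1)
    (isMorphism_iff.2 fun s => IsMorphismAt.comp
      (X := (affineSpace k (Fin n → k)).sub S) (Y := T.sub U) (Z := T) (g := Subtype.val)
      (f := e.symm) (IsMorphismAt.val U _) (he.invFun.at s))
  obtain ⟨C, hC, hCU⟩ := isClosed_induced_iff.1
    (@IsClosed.preimage _ _ (T.sub U).top ((affineSpace k (Fin n → k)).sub S).top _
      he.toFun.continuous _ hcl)
  have hCU : ∀ u : U, u.1 ∈ C ↔ u.1 ∈ (fun p => p.1.2) '' Z := fun u => by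
    change u ∈ Subtype.val ⁻¹' C ↔ _
    rw [hCU]
    change (e.symm (e u)).1 ∈ (fun p => p.1.2) '' Z ↔ _
    rw [e.symm_apply_apply]
  filter_upwards [hUo.mem_nhds htU, hC.isOpen_compl.mem_nhds (mt (hCU ⟨t, htU⟩).1 ht)] with s h1 h2
  exact mt (hCU ⟨s, h1⟩).2 h2

/-- Where `g` has rank `m`, comparing dimensions forces `U = Im g`. This locus is dense below
because it contains the class, and dense above because it meets every fibre of the bundle. -/
theorem isBirationalMorphism_twoColumnPairs [Infinite k] (hB : B.Nondegenerate)
    (hm : 2 * m ≤ Module.finrank k V) {ε : k}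
    (hε : ∀ x y, B x y = ε * B y x) (hε1 : (ε = 1 ∧ Even m) ∨ ε = -1)
    (hskew : ∀ p : (twoColumnPairs B m).carrier, p.1.1.1 ∈ skewAdjointInto B p.1.2.1.1)
    (hcl : ∀ U : (isotropicGrassmannian B m).carrier, ∀ g ∈ skewAdjointInto B U.1.1,
      g ∈ closure[(affineSpace k (Module.End k V)).top] (twoColumnClass B m)) :
    IsBirationalMorphism (twoColumnPairs B m) (twoColumnClosure B m) (fun p => p.1.1) := by
  have hf : IsMorphism (twoColumnPairs B m) (twoColumnClosure B m) (fun p => p.1.1) :=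
    isMorphism_iff.2 isMorphismAt_pairs_closure
  let Ω : Set (twoColumnClosure B m).carrier := {g | m ≤ Module.finrank k (LinearMap.range g.1)}
  have hΩ : IsOpen[(twoColumnClosure B m).top] Ω :=
    @IsOpen.preimage _ _ (twoColumnClosure B m).top (affineSpace k (Module.End k V)).top _
      (@continuous_induced_dom _ _ _ (affineSpace k (Module.End k V)).top) _
      (isOpen_le_finrank_range m)
  have hpre : IsOpen[(twoColumnPairs B m).top] ((fun p => p.1.1) ⁻¹' Ω) :=
    @IsOpen.preimage _ _ (twoColumnPairs B m).top (twoColumnClosure B m).top _ hf.continuous _ hΩ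
  have hrange : ∀ g ∈ Ω, Module.finrank k (LinearMap.range g.1) = m := fun g hg =>
    le_antisymm (closure_twoColumnClass_subset hm g.2).2.2 hg
  have hiso : ∀ g : (twoColumnClosure B m).carrier,
      ∀ x ∈ LinearMap.range g.1, ∀ y ∈ LinearMap.range g.1, B x y = 0 := by
    rintro g _ ⟨x, rfl⟩ _ ⟨y, rfl⟩
    obtain ⟨h1, h2, -⟩ := closure_twoColumnClass_subset hm g.2
    rw [mem_skewAdjointLieSubalgebra.1 h1, h2, map_zero, neg_zero]
  let e : ↥((fun p : (twoColumnPairs B m).carrier => p.1.1) ⁻¹' Ω) ≃ ↥Ω :=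
    { toFun := fun p => ⟨p.1.1.1, p.2⟩
      invFun := fun g => ⟨⟨(g.1, ⟨⟨LinearMap.range g.1.1, hrange _ g.2⟩, hiso g.1⟩),
        (le_rfl : LinearMap.range g.1.1 ≤ _)⟩, g.2⟩
      left_inv := fun p => Subtype.ext (twoColumnPairs_ext rfl
        (Submodule.eq_of_le_of_finrank_eq p.1.2 ((hrange _ p.2).trans p.1.1.2.1.2.symm)))
      right_inv := fun _ => rfl }
  refine ⟨hf, Ω, hΩ, ?_, ?_, e, fun _ => rfl, .of_isMorphismAt (fun p => ?_) fun g => ?_⟩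
  · refine Set.eq_univ_of_forall fun g => ?_
    rw [@closure_induced _ _ (affineSpace k (Module.End k V)).top]
    refine @closure_mono _ (affineSpace k (Module.End k V)).top _ _ ?_ _ g.2
    intro g₀ hg₀
    exact ⟨⟨g₀, @subset_closure _ (affineSpace k (Module.End k V)).top _ _ hg₀⟩,
      ((hasNilpotentJordanType_two_one hm).1 hg₀.2).2.ge, rfl⟩
  · refine Set.eq_univ_of_forall fun p => ?_
    obtain ⟨g₀, hg₀, hr⟩ := exists_mem_skewAdjointInto hB hε hε1 p.1.2.1.2
    let γ : k → (twoColumnPairs B m).carrier := fun t =>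
      twoColumnPair hcl p.1.2 (p.1.1.1 + t • (g₀ - p.1.1.1))
        (add_mem (hskew p) (Submodule.smul_mem _ _ (sub_mem hg₀ (hskew p))))
    have hγ : IsMorphism (affineSpace k k) (twoColumnPairs B m) γ :=
      isMorphism_iff.2 fun t => isMorphismAt_pairs isLocal_affineSpace
        (isRegularAt_line p.1.1.1 g₀ t) (.const p.1.2.1 t)
    have h0 : γ 0 = p := twoColumnPairs_ext (by simp [γ, twoColumnPair]) rfl
    rw [← h0]
    refine mem_closure_of_line hγ hpre ?_
    simpa [γ, twoColumnPair, Ω] using hr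
  · exact .sub_mk (IsMorphismAt.comp_val (isMorphismAt_pairs_closure p.1))
  · have hloc : ((twoColumnClosure B m).sub Ω).IsLocal := (isLocal_twoColumnClosure B m).sub Ω
    have hreg : IsRegularAt ((twoColumnClosure B m).sub Ω) (fun g => g.1.1) g :=
      IsRegularAt.comp (X := (twoColumnClosure B m).sub Ω) (Y := twoColumnClosure B m)
        (f := fun g => g.1) (g := Subtype.val) (isRegularAt_closure g.1) (IsMorphismAt.val Ω g)
    refine .sub_mk (isMorphismAt_pairs hloc hreg ?_)
    -- With these `x i` fixed, the vectors `g' (x i)` are a basis of the image for all `g'` near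
    -- `g`, so the image varies regularly.
    obtain ⟨x, π, hdet⟩ := le_finrank_range_iff.1 g.2
    have hc : ∀ i, IsRegularAt ((twoColumnClosure B m).sub Ω) (fun g => g.1.1 (x i)) g := fun i =>
      hreg.apply_hom (x i)
    refine isMorphismAt_grassmannian hloc (c := fun g i => g.1.1 (x i)) (.pi hc) ?_
    filter_upwards [(IsRegularAt.det fun i j => ((hc i).linear π).apply j).eventually_ne_zero
      hloc hdet] with g' hg'
    have hli := linearIndependent_of_det_ne_zero hg'
    refine ⟨hli, (Submodule.eq_of_le_of_finrank_eq ?_ ?_).symm⟩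
    · rw [Submodule.span_le]
      rintro _ ⟨i, rfl⟩
      exact ⟨x i, rfl⟩
    · rw [finrank_span_eq_card hli, Fintype.card_fin]
      exact (hrange _ g'.2).symm

end Resolution

theorem mainTheorem8 {V : Type u} [AddCommGroup V] [Module ℂ V] [FiniteDimensional ℂ V]
    (B : LinearMap.BilinForm ℂ V) (hB : B.Nondegenerate) (m : ℕ)
    (hm : 2 * m ≤ Module.finrank ℂ V) (hε : (B.IsSymm ∧ Even m) ∨ B.IsAlt) :
    (∃ ι : ∀ U : (isotropicGrassmannian B m).carrier,
        {p : (twoColumnPairs B m).carrier // p.1.2 = U} ≃ skewAdjointInto B U.1.1,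
      (∀ U p, (ι U p : Module.End ℂ V) = p.1.1.1.1) ∧
      SpaceWithFunctions.IsVectorBundle (twoColumnPairs B m) (isotropicGrassmannian B m)
        (fun p => p.1.2) (fun U => skewAdjointInto B U.1.1) ι) ∧
    SpaceWithFunctions.IsResolutionOfSingularities (twoColumnPairs B m) (twoColumnClosure B m)
      (fun p => p.1.1) := by
  obtain ⟨ε, hεB, hε1⟩ : ∃ ε : ℂ, (∀ x y, B x y = ε * B y x) ∧ ((ε = 1 ∧ Even m) ∨ ε = -1) := by
    rcases hε with ⟨h, he⟩ | h
    · exact ⟨1, fun x y => by rw [one_mul, h.eq y x], .inl ⟨rfl, he⟩⟩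
    · exact ⟨-1, fun x y => by rw [← h.neg_eq, neg_one_mul], .inr rfl⟩
  have hε2 : ε * ε = 1 := by rcases hε1 with ⟨rfl, -⟩ | rfl <;> norm_num
  -- With `hskew` this identifies the fibre of pairs over `U` with all of `skewAdjointInto B U`; the
  -- remaining arguments use the closure of the class mostly through these two facts.
  have hcl : ∀ U : (isotropicGrassmannian B m).carrier, ∀ g ∈ skewAdjointInto B U.1.1,
      g ∈ closure[(affineSpace ℂ (Module.End ℂ V)).top] (twoColumnClass B m) := fun U _ hg =>
    skewAdjointInto_subset_closure hB hm hεB hε1 U.1.2 U.2 hg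
  have hskew : ∀ p : (twoColumnPairs B m).carrier, p.1.1.1 ∈ skewAdjointInto B p.1.2.1.1 :=
    fun p => ⟨(closure_twoColumnClass_subset hm p.1.1.2).1, fun x => p.2 ⟨x, rfl⟩⟩
  let ι : ∀ U : (isotropicGrassmannian B m).carrier,
      {p : (twoColumnPairs B m).carrier // p.1.2 = U} ≃ skewAdjointInto B U.1.1 := fun U =>
    { toFun := fun p => ⟨p.1.1.1.1, by
        obtain ⟨p, rfl⟩ := p
        exact hskew p⟩
      invFun := fun g => ⟨twoColumnPair hcl U g.1 g.2, rfl⟩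
      left_inv := fun p => Subtype.ext
        (twoColumnPairs_ext rfl (congrArg (fun W => W.1.1) p.2.symm))
      right_inv := fun _ => rfl }
  exact ⟨⟨ι, fun _ _ => rfl, isVectorBundle_twoColumnPairs hB hεB hskew hcl ι fun _ _ => rfl⟩,
    isVariety_twoColumnPairs hskew hcl,
    isVariety_of_isClosed (@isClosed_closure _ (affineSpace ℂ (Module.End ℂ V)).top _),
    isSmooth_twoColumnPairs two_ne_zero hB hεB hε2 hskew hcl,
    isProperMorphism_twoColumnPairs,
    isBirationalMorphism_twoColumnPairs hB hm hεB hε1 hskew hcl⟩
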